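/- **Conventions.** The incidence graph $G$ of a CNF formula (no clause contains a complementary pair of literals) is the bipartite graph whose vertices are the variables and the clauses, with edge set partitioned into $E_+$ and $E_-$: a variable $x$ is joined to a clause $c$ by an edge of $E_\star$, $\star\in\{+,-\}$, if $c$ contains the literal $x_\star$. $|G|$ denotes the number of vertices of $G$. $G[x_\star]$ is the incidence graph of the formula obtained by setting $x$ to $\star$, i.e. by removing all clauses that contain $x_\star$ and removing $x$ from the remaining clauses (the variables of a formula being those that occur in its clauses); it is an induced subgraph of $G$. $\mathscr{C}_0$ is the class of graphs without edges. A *strong recursive backdoor* of $G$ to $\mathscr{C}_0$ is a finite rooted tree whose nodes are labeled with subgraphs of $G$ (component nodes) or with variables (variable nodes) such that: the root is labeled with $G$; every leaf is labeled with a graph from $\mathscr{C}_0$; an inner node labeled with a connected graph $H$ has exactly one child, labeled with a variable $x$ of $H$, and this child has exactly two children, labeled with $H[x_+]$ and $H[x_-]$; an inner node labeled with a disconnected graph has one child for each connected component, labeled with that component. Its *depth* is the maximal number of variable nodes on a path from the root to a leaf, and $\mathrm{srbd}_{\mathscr{C}_0}(G)$ is the minimal depth of a strong recursive backdoor of $G$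 to $\mathscr{C}_0$. **Theorem.** There is an algorithm that, given as input an integer $k\ge 0$ and an incidence graph $G$, in time $2^{2^{O(k)}}\cdot|G|$ either 1. returns a strong recursive backdoor of $G$ to $\mathscr{C}_0$ of depth at most $3^k\cdot 4\cdot 2^k\cdot k^2$, or 2. correctly concludes that $\mathrm{srbd}_{\mathscr{C}_0}(G)>k$. Here an algorithm is a single program for a unit-cost random access machine (whose arithmetic is the addition of constants and truncated subtraction). $G$ is given by the adjacency lists of its clauses, stored in arrays, and the backdoor is returned as a word that codes the labeled tree. The time bound means that there is a constant $a$ such that, for all $k$ and $G$, the program halts after at most $2^{2^{a(k+1)}}\cdot\max(1,|G|)$ steps. -/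

import Mathlib

/-! ### Incidence graphs of CNF formulas -/

/-- The incidence graph of a CNF formula with set of variables `V` and set of clauses `C`.
`Edge true` is the set `E₊` of positive edges, `Edge false` the set `E₋` of negative edges;
no clause contains a complementary pair of literals. -/
structure IncidenceGraph (V C : Type) where
  Edge : Bool → V → C → Prop
  not_complementary : ∀ x c, ¬ (Edge true x c ∧ Edge false x c)

namespace IncidenceGraph

variable {V C : Type}

/-- The underlying (bipartite) graph, with vertex set `V ⊕ C`. -/
def graph (G : IncidenceGraph V C) : SimpleGraph (V ⊕ C) :=
  SimpleGraph.fromRel fun u v => ∃ s x c, u = Sum.inl x ∧ v = Sum.inr c ∧ G.Edge s x c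

/-! All graphs that arise from `G` by assigning variables and by passing to connected components
are induced subgraphs of `G`. Such a subgraph is given by its vertex set `S : Set (V ⊕ C)`. -/

/-- The subgraph induced by `S` is connected (or empty). -/
def IsConn (G : IncidenceGraph V C) (S : Set (V ⊕ C)) : Prop :=
  (G.graph.induce S).Preconnected

/-- `K` is the vertex set of a connected component of the subgraph induced by `S`. -/
def IsComponent (G : IncidenceGraph V C) (S K : Set (V ⊕ C)) : Prop :=
  ∃ c : (G.graph.induce S).ConnectedComponent, K = Subtype.val '' c.supp

/-- The class `𝒞₀`: the induced subgraphs of `G` without edges. -/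
def edgeless (G : IncidenceGraph V C) : Set (Set (V ⊕ C)) :=
  {S | ∀ s x c, Sum.inl x ∈ S → Sum.inr c ∈ S → ¬ G.Edge s x c}

/-- `H[x_s]`, where `H` is the subgraph induced by `S`: the clauses that contain the literal `x_s`
are removed, and `x` is removed from the others. As the variables of a formula are those that
occur in its clauses, only the variables that occur in a remaining clause are kept. -/
def assign (G : IncidenceGraph V C) (S : Set (V ⊕ C)) (x : V) (s : Bool) : Set (V ⊕ C) :=
  {v | v ∈ S ∧
    match v with
    | Sum.inl y => y ≠ x ∧ ∃ t c, Sum.inr c ∈ S ∧ ¬ G.Edge s x c ∧ G.Edge t y c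
    | Sum.inr c => ¬ G.Edge s x c}

end IncidenceGraph

/-! ### Strong recursive backdoors -/

/-- Labels of the nodes: an induced subgraph (component nodes) or a variable (variable nodes). -/
inductive BackdoorLabel (V C : Type) where
  | subgraph (S : Set (V ⊕ C))
  | var (x : V)

/-- Finite rooted labeled trees. -/
inductive BackdoorTree (V C : Type) where
  | node (label : BackdoorLabel V C) (children : List (BackdoorTree V C))

namespace BackdoorTree

variable {V C : Type}

mutual
/-- The maximal number of variable nodes on a path from the root to a leaf. -/
def depth : BackdoorTree V C → ℕ
  | node (.subgraph _) ts => maxDepth ts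
  | node (.var _) ts => 1 + maxDepth ts
/-- The maximum of the depths of the trees in a list (`0` for the empty list). -/
def maxDepth : List (BackdoorTree V C) → ℕ
  | [] => 0
  | t :: ts => max (depth t) (maxDepth ts)
end

/-- `IsSRB G 𝒞 S B`: the tree `B` is a strong recursive backdoor to the class `𝒞` of the
subgraph of `G` induced by `S`. -/
inductive IsSRB (G : IncidenceGraph V C) (𝒞 : Set (Set (V ⊕ C))) :
    Set (V ⊕ C) → BackdoorTree V C → Prop where
  /-- a leaf is labeled with a graph from the class -/
  | leaf {S} (hS : S ∈ 𝒞) : IsSRB G 𝒞 S (node (.subgraph S) [])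
  /-- an inner node labeled with a connected graph `H` has one child, labeled with a variable `x`
  of `H`, which in turn has two children, labeled with `H[x₊]` and `H[x₋]` -/
  | branch {S x Bpos Bneg} (hS : G.IsConn S) (hx : Sum.inl x ∈ S)
      (hpos : IsSRB G 𝒞 (G.assign S x true) Bpos)
      (hneg : IsSRB G 𝒞 (G.assign S x false) Bneg) :
      IsSRB G 𝒞 S (node (.subgraph S) [node (.var x) [Bpos, Bneg]])
  /-- an inner node labeled with a disconnected graph has one child for each component -/
  | split {S} {Ks : List (Set (V ⊕ C))} {Bs : List (BackdoorTree V C)} (hS : ¬ G.IsConn S)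
      (hnodup : Ks.Nodup) (hcomp : ∀ K, K ∈ Ks ↔ G.IsComponent S K)
      (hlen : Bs.length = Ks.length)
      (hBs : ∀ (i : ℕ) (hK : i < Ks.length) (hB : i < Bs.length), IsSRB G 𝒞 Ks[i] Bs[i]) :
      IsSRB G 𝒞 S (node (.subgraph S) Bs)

end BackdoorTree

/-- The strong recursive backdoor depth of `G` to the class `𝒞`: the minimal depth of a strong
recursive backdoor of `G` to `𝒞` (`⊤` if there is none). -/
noncomputable def IncidenceGraph.srbd {V C : Type} (G : IncidenceGraph V C)
    (𝒞 : Set (Set (V ⊕ C))) : ℕ∞ :=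
  ⨅ B ∈ {B : BackdoorTree V C | B.IsSRB G 𝒞 Set.univ}, (B.depth : ℕ∞)

/-! ### The machine model

A unit-cost random access machine with a fixed finite program, given in structured form
(sequencing, conditionals, loops, calls of subroutines). It works on finitely many registers and
finitely many arrays (those that its program mentions), which hold natural numbers, with indirect
addressing. The only arithmetic is the addition of constants and truncated subtraction,
so a number that is computed in `t` steps exceeds the largest number of the input and of the
program by at most `t` times a constant of the program: a computation of `t` steps only uses
words of `O(log t + log (largest input number))` bits, and the unit-cost measure is honest. -/

namespace RAM

/-- The memory: the contents `reg r` of the registers and the cells `arr a i` of the arrays. -/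
structure State where
  reg : ℕ → ℕ
  arr : ℕ → ℕ → ℕ

/-- Elementary instructions. -/
inductive Instr where
  /-- `r := v` for a constant `v` -/
  | const (r v : ℕ)
  /-- `r := p + v` for a register `p` and a constant `v` -/
  | addConst (r p v : ℕ)
  /-- `r := p - q` for registers `p`, `q`, truncated at `0` -/
  | sub (r p q : ℕ)
  /-- `r := a[p]` for an array `a` and a register `p` -/
  | load (r a p : ℕ)
  /-- `a[p] := q` for an array `a` and registers `p`, `q` -/
  | store (a p q : ℕ)

/-- The effect of an elementary instruction. -/
def Instr.eval : Instr → State → State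
  | .const r v, σ => { σ with reg := Function.update σ.reg r v }
  | .addConst r p v, σ => { σ with reg := Function.update σ.reg r (σ.reg p + v) }
  | .sub r p q, σ => { σ with reg := Function.update σ.reg r (σ.reg p - σ.reg q) }
  | .load r a p, σ => { σ with reg := Function.update σ.reg r (σ.arr a (σ.reg p)) }
  | .store a p q, σ =>
      { σ with arr := Function.update σ.arr a
                        (Function.update (σ.arr a) (σ.reg p) (σ.reg q)) }

/-- Comparisons of two registers. -/
inductive Test where
  | eq (p q : ℕ)
  | lt (p q : ℕ)

/-- The outcome of a comparison. -/
def Test.Holds : Test → State → Prop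
  | .eq p q, σ => σ.reg p = σ.reg q
  | .lt p q, σ => σ.reg p < σ.reg q

/-- Structured code. -/
inductive Code where
  | skip
  | instr (i : Instr)
  | seq (a b : Code)
  | ite (b : Test) (yes no : Code)
  | while (b : Test) (body : Code)
  | call (p : ℕ)

/-- A program: the code of its subroutines (which may be recursive and share all registers and
arrays), and its main code. -/
structure Program where
  procs : List Code
  main : Code

/-- `Exec procs a σ t τ`: the code `a`, started in the state `σ`, halts after exactly `t` steps in
the state `τ`. Every elementary instruction, every evaluation of a test and every call of a
subroutine is one step. -/
inductive Exec (procs : List Code) : Code → State → ℕ → State → Prop where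
  | skip {σ} : Exec procs .skip σ 1 σ
  | instr {i σ} : Exec procs (.instr i) σ 1 (i.eval σ)
  | seq {a b σ₁ σ₂ σ₃ t₁ t₂} (h₁ : Exec procs a σ₁ t₁ σ₂) (h₂ : Exec procs b σ₂ t₂ σ₃) :
      Exec procs (.seq a b) σ₁ (t₁ + t₂) σ₃
  | ite_yes {b yes no σ τ t} (hb : b.Holds σ) (h : Exec procs yes σ t τ) :
      Exec procs (.ite b yes no) σ (t + 1) τ
  | ite_no {b yes no σ τ t} (hb : ¬ b.Holds σ) (h : Exec procs no σ t τ) :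
      Exec procs (.ite b yes no) σ (t + 1) τ
  | while_done {b body σ} (hb : ¬ b.Holds σ) : Exec procs (.while b body) σ 1 σ
  | while_step {b body σ₁ σ₂ σ₃ t₁ t₂} (hb : b.Holds σ₁) (h₁ : Exec procs body σ₁ t₁ σ₂)
      (h₂ : Exec procs (.while b body) σ₂ t₂ σ₃) :
      Exec procs (.while b body) σ₁ (t₁ + t₂ + 1) σ₃
  | call {p body σ τ t} (hp : procs[p]? = some body) (h : Exec procs body σ t τ) :
      Exec procs (.call p) σ (t + 1) τ

/-- The program `P`, started in `σ`, halts after exactly `t` steps in the state `τ`. -/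
def Program.HaltsIn (P : Program) (σ : State) (t : ℕ) (τ : State) : Prop :=
  Exec P.procs P.main σ t τ

end RAM

/-! ### Input and output of the machine -/

/-- `L` is an adjacency-list representation of `G`: it lists, for every clause, the literals of
the clause in some order and without repetition. -/
def IncidenceGraph.IsAdjList {V C : Type} (G : IncidenceGraph V C) (L : C → List (V × Bool)) :
    Prop :=
  ∀ c, (L c).Nodup ∧ ∀ x s, (x, s) ∈ L c ↔ G.Edge s x c

/-- An array that starts with the entries of a list and is `0` elsewhere. -/
def RAM.arrayOf (l : List ℕ) : ℕ → ℕ := fun i => l.getD i 0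

/-- The initial state for the parameter `k` and a graph with `n` variables and `m` clauses that is
given by the adjacency lists `L`. Registers `0`, `1`, `2` hold `k`, `n`, `m`. The lists are stored
one after the other, the variables in array `1` and the polarities (`1` for `+`, `0` for `-`) in
array `2`; the list of the clause `j` occupies the positions from `a[j]` to `a[j + 1] - 1`,
where `a` is array `0`. Everything else is `0`. -/
def RAM.inputState (k n m : ℕ) (L : Fin m → List (Fin n × Bool)) : RAM.State where
  reg := RAM.arrayOf [k, n, m]
  arr
    | 0 => RAM.arrayOf
        ((List.range (m + 1)).map fun j => ((List.ofFn L).take j).flatten.length)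
    | 1 => RAM.arrayOf ((List.ofFn L).flatten.map fun l => (l.1 : ℕ))
    | 2 => RAM.arrayOf ((List.ofFn L).flatten.map fun l => l.2.toNat)
    | _ => RAM.arrayOf []

namespace BackdoorTree

mutual
/-- `IsCode B w`: the word `w` is a code (in preorder) of the tree `B`. A component node is coded
by `0`, the number and the list of its variables, the number and the list of its clauses,
the number of its children, and the codes of the children; a variable node by `1`, its variable,
the number of its children, and the codes of the children. Vertices may be listed in any order. -/
inductive IsCode {n m : ℕ} : BackdoorTree (Fin n) (Fin m) → List ℕ → Prop where
  | subgraph {S : Set (Fin n ⊕ Fin m)} {xs : List (Fin n)} {cs : List (Fin m)}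
      {ts : List (BackdoorTree (Fin n) (Fin m))} {w : List ℕ}
      (hxs : xs.Nodup) (hcs : cs.Nodup)
      (hxS : ∀ x, x ∈ xs ↔ Sum.inl x ∈ S) (hcS : ∀ c, c ∈ cs ↔ Sum.inr c ∈ S)
      (hts : IsForestCode ts w) :
      IsCode (node (.subgraph S) ts)
        ([0] ++ [xs.length] ++ xs.map Fin.val ++ [cs.length] ++ cs.map Fin.val
          ++ [ts.length] ++ w)
  | var {x : Fin n} {ts : List (BackdoorTree (Fin n) (Fin m))} {w : List ℕ}
      (hts : IsForestCode ts w) :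
      IsCode (node (.var x) ts) ([1] ++ [x.val] ++ [ts.length] ++ w)
/-- The code of a list of trees is the concatenation of their codes. -/
inductive IsForestCode {n m : ℕ} : List (BackdoorTree (Fin n) (Fin m)) → List ℕ → Prop where
  | nil : IsForestCode [] []
  | cons {t : BackdoorTree (Fin n) (Fin m)} {ts : List (BackdoorTree (Fin n) (Fin m))}
      {v w : List ℕ} (ht : IsCode t v) (hts : IsForestCode ts w) : IsForestCode (t :: ts) (v ++ w)
end

end BackdoorTree

/-- In the final state `τ`, the machine returns the tree `B`: register `0` holds `1`, register `1`
holds the length of a code of `B`, and array `3` starts with that code. -/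
def RAM.State.ReturnsTree {n m : ℕ} (τ : RAM.State) (B : BackdoorTree (Fin n) (Fin m)) : Prop :=
  τ.reg 0 = 1 ∧ B.IsCode ((List.range (τ.reg 1)).map (τ.arr 3))

/-- In the final state `τ`, the machine returns no tree but claims that the strong recursive
backdoor depth exceeds the parameter: register `0` holds `0`. -/
def RAM.State.Rejects (τ : RAM.State) : Prop := τ.reg 0 = 0

-- A strong recursive backdoor is a strategy in a game: one player names a variable of the current
-- connected graph, the opponent chooses its value, and after a split the opponent chooses a
-- component. Small depth is certified by a tree. Large depth is certified by an obstruction: a set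
-- `O` of clauses such that every subgraph that contains `O` and its variables outside a set `X` of
-- assigned variables needs depth greater than `j` (`Forces O X j`).
--
-- A single clause with an unassigned variable forces depth greater than `0`. The induction step is
-- `Forces.combine`. Suppose that `O₁` and `O₂` force level `j`, that both lie in a connected set of
-- clauses `O`, and that no variable attacks both of them. Then the opponent can answer every
-- variable by a value that leaves `O₁` or `O₂` intact, and `O` forces level `j + 1`. A variable
-- does not attack a set if it does not occur in it, or if it was assigned before the set was found:
-- the set then survives under some value of the variable, and does not need the variable.
--
-- The algorithm turns this into a recursion on the level. At level `j + 1` it runs level `j`, which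
-- yields a tree or an obstruction `O₁`. In the latter case it branches on all unassigned variables
-- of `O₁` and runs level `j` on what remains. If all branches yield trees, they combine to a tree
-- that is deeper by at most the number of these variables. If some branch yields an obstruction
-- `O₂`, every variable of `O₁` is assigned in that branch or does not occur in `O₂`, so both sets,
-- joined by a path, form an obstruction of level `j + 1` (`Obstruction.join`). An obstruction of
-- level `k` for the whole graph allows to reject.
--
-- Two further lower bounds keep the obstructions small. A clause with more than `k` literals
-- (`forces_of_card`) and a pair of vertices at distance more than `2 ^ (k + 2)` (`lt_srbd_of_dist`,
-- from a long induced path by `forces_path`) force depth greater than `k`. Otherwise, clauses have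
-- at most `k` variables and connecting paths have `O(2 ^ k)` clauses, the obstructions of level
-- below `k` have at most `maxObs k = 4 * 6 ^ k` clauses, and each of the `k` levels adds at most `k
-- * maxObs k` to the depth.
--
-- On the machine, components are found by propagating smallest vertex numbers for `2 ^ (k + 2)`
-- rounds (`runs_label`). Either this comes to rest and the parent pointers provide short connecting
-- paths, or there is a large distance. Correctness and running time are proved together in a
-- Hoare-style logic (`Runs`). The mutually recursive subroutines `solve` and `solveConn` keep their
-- data on stacks, and `Pres` states what a call leaves alone. The induction on level and number of
-- pending variables is `specConn`; its steps are `specSolve_of_specConn`, `specConn_succ` and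
-- `specConn_level`. The resulting bound `time` is linear in the number of vertices, with a factor
-- that `time_le` estimates.

/-! ### Lower bounds for the strong recursive backdoor depth -/

namespace IncidenceGraph

variable {V C : Type} (G : IncidenceGraph V C)

/-- The variable `x` occurs in the clause `c`. -/
def Occurs (x : V) (c : C) : Prop := ∃ s, G.Edge s x c

theorem graph_adj_inl_inr {x : V} {c : C} :
    G.graph.Adj (.inl x) (.inr c) ↔ G.Occurs x c := by
  simp [graph, Occurs]

theorem graph_adj_inr_inl {x : V} {c : C} :
    G.graph.Adj (.inr c) (.inl x) ↔ G.Occurs x c := by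
  rw [SimpleGraph.adj_comm, graph_adj_inl_inr]

theorem not_graph_adj_inl_inl {x y : V} : ¬ G.graph.Adj (.inl x) (.inl y) := by
  simp [graph]

theorem not_graph_adj_inr_inr {c d : C} : ¬ G.graph.Adj (.inr c) (.inr d) := by
  simp [graph]

/-- The subgraph induced by `S`, as a graph on all vertices. -/
def restrict (S : Set (V ⊕ C)) : SimpleGraph (V ⊕ C) where
  Adj u v := u ∈ S ∧ v ∈ S ∧ G.graph.Adj u v
  symm := ⟨fun _ _ h => ⟨h.2.1, h.1, h.2.2.symm⟩⟩
  loopless := ⟨fun _ h => G.graph.loopless.irrefl _ h.2.2⟩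

-- Reachability and components inside vertex sets.

variable {G}

theorem restrict_mono {S T : Set (V ⊕ C)} (h : S ⊆ T) : G.restrict S ≤ G.restrict T :=
  fun _ _ hh => ⟨h hh.1, h hh.2.1, hh.2.2⟩

theorem mem_of_reachable_restrict {S : Set (V ⊕ C)} {u v : V ⊕ C} (hu : u ∈ S)
    (h : (G.restrict S).Reachable u v) : v ∈ S := by
  rw [SimpleGraph.reachable_iff_reflTransGen] at h
  induction h with
  | refl => exact hu
  | tail _ h _ => exact h.2.1

/-- The graphs `G.restrict S` all live on the same vertex type, so walks for different `S` can be
compared by `restrict_mono`. This transports reachability from the induced graphs of the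
definitions. -/
theorem reachable_induce_iff {S : Set (V ⊕ C)} {u v : S} :
    (G.graph.induce S).Reachable u v ↔ (G.restrict S).Reachable u.1 v.1 := by
  constructor
  · intro h
    exact h.map (f := (⟨Subtype.val, fun {a b} hab => ⟨a.2, b.2, hab⟩⟩ :
      (G.graph.induce S) →g (G.restrict S)))
  · obtain ⟨u, hu⟩ := u
    obtain ⟨v, hv⟩ := v
    intro h
    simp only at h
    have h' := h
    rw [SimpleGraph.reachable_iff_reflTransGen] at h
    induction h with
    | refl => exact SimpleGraph.Reachable.refl _
    | tail hb hbc ih =>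
      have hb' := (SimpleGraph.reachable_iff_reflTransGen _ _).2 hb
      refine (ih hbc.1 hb').trans (SimpleGraph.Adj.reachable ?_)
      exact hbc.2.2

theorem isConn_iff {S : Set (V ⊕ C)} :
    G.IsConn S ↔ ∀ u ∈ S, ∀ v ∈ S, (G.restrict S).Reachable u v := by
  constructor
  · intro h u hu v hv
    exact reachable_induce_iff.1 (h ⟨u, hu⟩ ⟨v, hv⟩)
  · intro h u v
    exact reachable_induce_iff.2 (h u u.2 v v.2)

/-- Describing a component by a representative vertex is the form that both the lower bounds and the
labelling of components use. -/
theorem isComponent_iff {S K : Set (V ⊕ C)} :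
    G.IsComponent S K ↔ ∃ u ∈ S, K = {v | v ∈ S ∧ (G.restrict S).Reachable u v} := by
  have key : ∀ u : S, Subtype.val '' ((G.graph.induce S).connectedComponentMk u).supp =
      {v | v ∈ S ∧ (G.restrict S).Reachable u.1 v} := by
    intro u
    ext v
    simp only [Set.mem_image, SimpleGraph.ConnectedComponent.mem_supp_iff,
      SimpleGraph.ConnectedComponent.eq, Set.mem_ofPred_eq]
    constructor
    · rintro ⟨w, hw, rfl⟩
      exact ⟨w.2, (reachable_induce_iff.1 hw).symm⟩
    · rintro ⟨hv, h⟩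
      exact ⟨⟨v, hv⟩, reachable_induce_iff.2 h.symm, rfl⟩
  constructor
  · rintro ⟨c, rfl⟩
    induction c using SimpleGraph.ConnectedComponent.ind with
    | h u => exact ⟨u.1, u.2, key u⟩
  · rintro ⟨u, hu, rfl⟩
    exact ⟨_, (key ⟨u, hu⟩).symm⟩

end IncidenceGraph

namespace BackdoorTree

variable {V C : Type}

theorem maxDepth_le_iff {ts : List (BackdoorTree V C)} {d : ℕ} :
    maxDepth ts ≤ d ↔ ∀ t ∈ ts, t.depth ≤ d := by
  induction ts with
  | nil => simp [maxDepth]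
  | cons t ts ih => simp [maxDepth, ih]

theorem depth_le_maxDepth {ts : List (BackdoorTree V C)} {t : BackdoorTree V C} (h : t ∈ ts) :
    t.depth ≤ maxDepth ts :=
  maxDepth_le_iff.1 le_rfl t h

end BackdoorTree

-- Clause sets that force a large depth.

namespace IncidenceGraph

open BackdoorTree

variable {V C : Type} (G : IncidenceGraph V C)

/-- Every subgraph that contains the clauses in `O` and all of their variables outside of `X` has
strong recursive backdoor depth greater than `j`. -/
def Forces (O : Set C) (X : Set V) (j : ℕ) : Prop :=
  ∀ S B, IsSRB G G.edgeless S B → (∀ c ∈ O, Sum.inr c ∈ S) →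
    (∀ c ∈ O, ∀ x, G.Occurs x c → x ∉ X → Sum.inl x ∈ S) → j < B.depth

/-- Every variable in `X` can be assigned without satisfying a clause in `O`. -/
def Safe (O : Set C) (X : Set V) : Prop :=
  ∀ x ∈ X, ∃ s, ∀ c ∈ O, ¬ G.Edge s x c

/-- The clauses in `O` and their variables outside of `X`. -/
def span (O : Set C) (X : Set V) : Set (V ⊕ C) :=
  {v | match v with
    | .inl x => x ∉ X ∧ ∃ c ∈ O, G.Occurs x c
    | .inr c => c ∈ O}

/-- The clauses in `O` are connected through their variables outside of `X`. -/
def Linked (O : Set C) (X : Set V) : Prop :=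
  ∀ a ∈ O, ∀ b ∈ O, (G.restrict (G.span O X)).Reachable (.inr a) (.inr b)

variable {G}

theorem Safe.mono {O O' : Set C} {X X' : Set V} (h : G.Safe O X) (hO : O' ⊆ O) (hX : X' ⊆ X) :
    G.Safe O' X' := fun x hx => by
  obtain ⟨s, hs⟩ := h x (hX hx)
  exact ⟨s, fun c hc => hs c (hO hc)⟩

theorem span_mono {O O' : Set C} {X X' : Set V} (hO : O ⊆ O') (hX : X' ⊆ X) :
    G.span O X ⊆ G.span O' X' := by
  rintro (x | c) h
  · obtain ⟨hx, c, hc, hxc⟩ := h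
    exact ⟨fun h => hx (hX h), c, hO hc, hxc⟩
  · exact hO h

/-- At the root every clause and every variable is present, whatever `X` is. The strict inequality
needs the detour through `k + 1`, because an infimum is bounded below only weakly. -/
theorem lt_srbd_of_forces {O : Set C} {X : Set V} {k : ℕ} (h : G.Forces O X k) :
    (k : ℕ∞) < G.srbd G.edgeless := by
  refine lt_of_lt_of_le (b := ((k + 1 : ℕ) : ℕ∞)) (by exact_mod_cast Nat.lt_succ_self k) ?_
  refine le_iInf₂ fun B hB => ?_
  exact_mod_cast h Set.univ B hB (fun _ _ => trivial) (fun _ _ _ _ _ => trivial)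

/-- The strategy of the opponent: answer every variable by a value for which a set of clauses
that forces one level less survives. -/
theorem forces_of_branch {O : Set C} {X : Set V} {j : ℕ} (hsafe : G.Safe O X)
    (hlink : G.Linked O X) (hedge : ∃ c ∈ O, ∃ x, x ∉ X ∧ G.Occurs x c)
    (hbranch : ∀ x, x ∉ X → ∀ i, j = i + 1 → ∃ s O' X', O' ⊆ O ∧ X ⊆ X' ∧
      (∀ c ∈ O', ¬ G.Edge s x c) ∧ (x ∈ X' ∨ ∀ c ∈ O', ¬ G.Occurs x c) ∧ G.Forces O' X' i) :
    G.Forces O X j := by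
  obtain ⟨c₀, hc₀, x₀, hx₀, hxc₀⟩ := hedge
  -- Assigning `x` keeps the unsatisfied clauses, and their variables other than `x` are kept
  -- because they still occur in one of these clauses. Nothing else needs to survive.
  have survive : ∀ (S : Set (V ⊕ C)) (x : V) (s : Bool) (O' : Set C) (X' : Set V),
      (∀ c ∈ O', ¬ G.Edge s x c) → (x ∈ X' ∨ ∀ c ∈ O', ¬ G.Occurs x c) →
      (∀ c ∈ O', Sum.inr c ∈ S) → (∀ c ∈ O', ∀ y, G.Occurs y c → y ∉ X' → Sum.inl y ∈ S) →
      (∀ c ∈ O', Sum.inr c ∈ G.assign S x s) ∧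
      (∀ c ∈ O', ∀ y, G.Occurs y c → y ∉ X' → Sum.inl y ∈ G.assign S x s) := by
    intro S x s O' X' hs hx hO hV
    refine ⟨fun c hc => ⟨hO c hc, hs c hc⟩, fun c hc y hyc hy => ⟨hV c hc y hyc hy, ?_, ?_⟩⟩
    · rintro rfl
      exact hx.elim hy fun h => h c hc hyc
    · obtain ⟨t, ht⟩ := hyc
      exact ⟨t, c, hO c hc, hs c hc, ht⟩
  intro S B hB
  -- The induction is on the backdoor and not on `j`: splits and assignments of variables in `X` do
  -- not lower the level.
  induction hB with
  | @leaf S hS =>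
    intro hO hV
    obtain ⟨s, hs⟩ := hxc₀
    exact absurd hs (hS s x₀ c₀ (hV c₀ hc₀ x₀ ⟨s, hs⟩ hx₀) (hO c₀ hc₀))
  | @branch S x Bp Bn hS hx hp hn ihp ihn =>
    intro hO hV
    have hd : ∀ s, ∃ B', IsSRB G G.edgeless (G.assign S x s) B' ∧ B'.depth <
        (node (.subgraph S) [node (.var x) [Bp, Bn]]).depth := by
      rintro (_ | _)
      · exact ⟨Bn, hn, by simp [depth, maxDepth]; omega⟩
      · exact ⟨Bp, hp, by simp [depth, maxDepth]; omega⟩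
    -- A variable in `X` is answered by its safe value. Then all of `O` survives, and the child is
    -- already deeper than `j`.
    by_cases hxX : x ∈ X
    · obtain ⟨s, hs⟩ := hsafe x hxX
      obtain ⟨h1, h2⟩ := survive S x s O X hs (.inl hxX) hO hV
      cases s
      · have := ihn h1 h2
        simp [depth, maxDepth]; omega
      · have := ihp h1 h2
        simp [depth, maxDepth]; omega
    · rcases j with _ | i
      · obtain ⟨B', -, h⟩ := hd true
        omega
      · obtain ⟨s, O', X', hO', hX', hs, hx', hF⟩ := hbranch x hxX i rfl
        obtain ⟨h1, h2⟩ := survive S x s O' X' hs hx' (fun c hc => hO c (hO' hc))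
          (fun c hc y hy hyX => hV c (hO' hc) y hy fun h => hyX (hX' h))
        obtain ⟨B', hB', hlt⟩ := hd s
        have := hF _ _ hB' h1 h2
        omega
  | @split S Ks Bs hS hnd hcomp hlen hBs ih =>
    intro hO hV
    have hsub : G.span O X ⊆ S := by
      rintro (x | c) h
      · obtain ⟨h1, c, hc, h2⟩ := h
        exact hV c hc x h2 h1
      · exact hO c h
    -- Since `O` is linked, a single component contains all of `O` with its variables outside `X`;
    -- the opponent moves there.
    have hK : {v | v ∈ S ∧ (G.restrict S).Reachable (.inr c₀) v} ∈ Ks :=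
      (hcomp _).2 (isComponent_iff.2 ⟨_, hO c₀ hc₀, rfl⟩)
    obtain ⟨i, hi, hKi⟩ := List.getElem_of_mem hK
    have hreach : ∀ c ∈ O, (G.restrict S).Reachable (.inr c₀) (.inr c) := fun c hc =>
      (hlink c₀ hc₀ c hc).mono (restrict_mono hsub)
    have := ih i hi (by omega) (fun c hc => by rw [hKi]; exact ⟨hO c hc, hreach c hc⟩)
      (fun c hc x hxc hx => by
        rw [hKi]
        refine ⟨hV c hc x hxc hx, (hreach c hc).trans (SimpleGraph.Adj.reachable ?_)⟩
        exact ⟨hO c hc, hV c hc x hxc hx, graph_adj_inr_inl G |>.2 hxc⟩)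
    exact lt_of_lt_of_le this (by
      rw [depth]; exact depth_le_maxDepth (List.getElem_mem _))

theorem linked_singleton (c : C) (X : Set V) : G.Linked {c} X := by
  rintro a rfl b rfl
  exact SimpleGraph.Reachable.refl _

/-- A clause contains at most one of the two literals of a variable, so the other value does not
satisfy it. -/
theorem safe_singleton (c : C) (X : Set V) : G.Safe {c} X := by
  intro x _
  by_cases h : G.Edge true x c
  · exact ⟨false, by rintro _ rfl h'; exact G.not_complementary _ _ ⟨h, h'⟩⟩
  · exact ⟨true, by rintro _ rfl h'; exact h h'⟩

theorem forces_singleton {c : C} {x : V} {X : Set V} (h : G.Occurs x c) (hx : x ∉ X) :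
    G.Forces {c} X 0 :=
  forces_of_branch (safe_singleton c X) (linked_singleton c X) ⟨c, rfl, x, hx, h⟩
    (fun _ _ _ h => by omega)

/-- A long clause forces a large depth. -/
theorem forces_of_card {c : C} {j : ℕ} : ∀ {X : Set V} {F : Finset V}, j < F.card →
    (∀ x ∈ F, G.Occurs x c ∧ x ∉ X) → G.Forces {c} X j := by
  classical
  induction j with
  | zero =>
    intro X F hF h
    obtain ⟨x, hx⟩ := Finset.card_pos.1 hF
    exact forces_singleton (h x hx).1 (h x hx).2
  | succ j ih =>
    intro X F hF h
    obtain ⟨x, hx⟩ := Finset.card_pos.1 (Nat.zero_lt_of_lt hF)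
    refine forces_of_branch (safe_singleton c X) (linked_singleton c X)
      ⟨c, rfl, x, (h x hx).2, (h x hx).1⟩ fun y hy i hi => ?_
    obtain rfl : j = i := by omega
    -- The opponent always keeps the clause alive; the other player thus uses up at most one
    -- variable of `F` per level.
    obtain ⟨s, hs⟩ := safe_singleton (G := G) c {y} y rfl
    refine ⟨s, {c}, insert y X, subset_rfl, Set.subset_insert _ _, hs,
      .inl (Set.mem_insert _ _), ih (F := F.erase y) ?_ ?_⟩
    · have := Finset.pred_card_le_card_erase (s := F) (a := y)
      omega
    · intro z hz
      rw [Finset.mem_erase] at hz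
      exact ⟨(h z hz.2).1, by rintro (rfl | h'); exacts [hz.1 rfl, (h z hz.2).2 h']⟩

/-- Otherwise the graph spanned by `O` outside `X` would be edgeless, and a single leaf of depth `0`
would violate the strict bound. -/
theorem Forces.nonempty_edge {O : Set C} {X : Set V} {j : ℕ} (h : G.Forces O X j) :
    ∃ c ∈ O, ∃ x, x ∉ X ∧ G.Occurs x c := by
  by_contra! hcon
  have := h (G.span O X) _ (.leaf ?_) (fun c hc => hc) (fun c hc x hxc hx => ⟨hx, c, hc, hxc⟩)
  · simp [depth, maxDepth] at this
  · rintro s x c hx hc hs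
    exact hcon c hc x hx.1 ⟨s, hs⟩

/-- Two sets of clauses that force depth `j` and that the other player cannot attack at the same
time, force depth `j + 1` once they are connected. -/
theorem Forces.combine {O O₁ O₂ : Set C} {X X₁ X₂ : Set V} {j : ℕ} (hsafe : G.Safe O X)
    (hlink : G.Linked O X) (hO₁ : O₁ ⊆ O) (hO₂ : O₂ ⊆ O) (hX₁ : X ⊆ X₁) (hX₂ : X ⊆ X₂)
    (hs₁ : G.Safe O₁ X₁) (hs₂ : G.Safe O₂ X₂) (h₁ : G.Forces O₁ X₁ j) (h₂ : G.Forces O₂ X₂ j)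
    (hcover : ∀ x, x ∈ X₁ ∨ x ∈ X₂ ∨ (∀ c ∈ O₁, ¬ G.Occurs x c) ∨ (∀ c ∈ O₂, ¬ G.Occurs x c)) :
    G.Forces O X (j + 1) := by
  obtain ⟨c, hc, x, hx, hxc⟩ := h₁.nonempty_edge
  refine forces_of_branch hsafe hlink ⟨c, hO₁ hc, x, fun h => hx (hX₁ h), hxc⟩
    fun y hy i hi => ?_
  obtain rfl : j = i := by omega
  -- The opponent keeps the set that `y` does not attack. If `y` was assigned before that set was
  -- found, the safe value is used; if `y` does not occur, any value will do.
  rcases hcover y with h | h | h | h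
  · obtain ⟨s, hs⟩ := hs₁ y h
    exact ⟨s, O₁, X₁, hO₁, hX₁, hs, .inl h, h₁⟩
  · obtain ⟨s, hs⟩ := hs₂ y h
    exact ⟨s, O₂, X₂, hO₂, hX₂, hs, .inl h, h₂⟩
  · exact ⟨true, O₁, X₁, hO₁, hX₁, fun c hc hs => h c hc ⟨_, hs⟩, .inr h, h₁⟩
  · exact ⟨true, O₂, X₂, hO₂, hX₂, fun c hc hs => h c hc ⟨_, hs⟩, .inr h, h₂⟩

/-- Only the first `t` values of the sequence matter; taking it total on `ℕ` avoids dependent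
indices when paths are halved later. -/
theorem linked_path {X : Set V} (c : ℕ → C) (t : ℕ)
    (hlink : ∀ i, i + 1 < t → ∃ x, x ∉ X ∧ G.Occurs x (c i) ∧ G.Occurs x (c (i + 1))) :
    G.Linked (c '' Set.Iio t) X := by
  have key : ∀ i, i < t →
      (G.restrict (G.span (c '' Set.Iio t) X)).Reachable (.inr (c 0)) (.inr (c i)) := by
    intro i
    induction i with
    | zero => intro _; exact SimpleGraph.Reachable.refl _
    | succ i ih =>
      intro hi
      obtain ⟨x, hx, h1, h2⟩ := hlink i hi
      have m1 : c i ∈ c '' Set.Iio t := ⟨i, by simp; omega, rfl⟩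
      have m2 : c (i + 1) ∈ c '' Set.Iio t := ⟨i + 1, hi, rfl⟩
      have mx : (Sum.inl x : V ⊕ C) ∈ G.span (c '' Set.Iio t) X := ⟨hx, _, m1, h1⟩
      have a1 : (G.restrict (G.span (c '' Set.Iio t) X)).Adj (.inr (c i)) (.inl x) :=
        ⟨m1, mx, (graph_adj_inr_inl G).2 h1⟩
      have a2 : (G.restrict (G.span (c '' Set.Iio t) X)).Adj (.inl x) (.inr (c (i + 1))) :=
        ⟨mx, m2, (graph_adj_inl_inr G).2 h2⟩
      exact ((ih (by omega)).trans a1.reachable).trans a2.reachable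
  rintro _ ⟨i, hi, rfl⟩ _ ⟨j, hj, rfl⟩
  exact (key i hi).symm.trans (key j hj)

/-- A long induced path forces a large depth. -/
theorem forces_path {X : Set V} (j : ℕ) : ∀ (c : ℕ → C),
    G.Safe (c '' Set.Iio (2 ^ (j + 1) - 1)) X →
    (∀ i, i + 1 < 2 ^ (j + 1) - 1 → ∃ x, x ∉ X ∧ G.Occurs x (c i) ∧ G.Occurs x (c (i + 1))) →
    (∀ i, i < 2 ^ (j + 1) - 1 → ∃ x, x ∉ X ∧ G.Occurs x (c i)) →
    (∀ i i' x, i < 2 ^ (j + 1) - 1 → i' < 2 ^ (j + 1) - 1 → x ∉ X → G.Occurs x (c i) →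
      G.Occurs x (c i') → i' ≤ i + 1) →
    G.Forces (c '' Set.Iio (2 ^ (j + 1) - 1)) X j := by
  induction j with
  | zero =>
    intro c hs hl hv hf
    obtain ⟨x, hx, h⟩ := hv 0 (by norm_num)
    have : c '' Set.Iio (2 ^ (0 + 1) - 1) = {c 0} := by
      ext d; simp
    rw [this]
    exact forces_singleton h hx
  | succ j ih =>
    intro c hs hl hv hf
    -- A path of `2 * N + 1` clauses consists of two paths of `N` clauses and a clause in the
    -- middle. A variable outside `X` occurs only in clauses of adjacent positions, so the missing
    -- middle clause keeps it from attacking both halves.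
    obtain ⟨N, hN⟩ : ∃ N, N = 2 ^ (j + 1) - 1 := ⟨_, rfl⟩
    have hN1 : 2 ^ (j + 1) = N + 1 := by have := Nat.one_le_two_pow (n := j + 1); omega
    have hN2 : 2 ^ (j + 1 + 1) - 1 = 2 * N + 1 := by rw [pow_succ, hN1]; omega
    rw [hN2] at hs hl hv hf ⊢
    rw [← hN] at ih
    have sub1 : c '' Set.Iio N ⊆ c '' Set.Iio (2 * N + 1) := by
      rintro _ ⟨i, hi, rfl⟩
      exact ⟨i, by simp at *; omega, rfl⟩
    have sub2 : (fun i => c (i + (N + 1))) '' Set.Iio N ⊆ c '' Set.Iio (2 * N + 1) := by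
      rintro _ ⟨i, hi, rfl⟩
      exact ⟨i + (N + 1), by simp at *; omega, rfl⟩
    refine Forces.combine hs (linked_path c _ hl) sub1 sub2 subset_rfl subset_rfl
      (hs.mono sub1 subset_rfl) (hs.mono sub2 subset_rfl) (ih c (hs.mono sub1 subset_rfl) ?_ ?_ ?_)
      (ih _ (hs.mono sub2 subset_rfl) ?_ ?_ ?_) ?_
    · exact fun i hi => hl i (by omega)
    · exact fun i hi => hv i (by omega)
    · exact fun i i' x hi hi' => hf i i' x (by omega) (by omega)
    · intro i hi
      have := hl (i + (N + 1)) (by omega)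
      rwa [show i + (N + 1) + 1 = i + 1 + (N + 1) by omega] at this
    · exact fun i hi => hv _ (by omega)
    · intro i i' x hi hi' hx h1 h2
      have := hf _ _ x (by omega) (by omega) hx h1 h2
      omega
    · intro x
      by_cases hx : x ∈ X
      · exact .inl hx
      refine .inr (.inr ?_)
      by_contra! hcon
      obtain ⟨⟨_, ⟨i, hi, rfl⟩, h1⟩, ⟨_, ⟨i', hi', rfl⟩, h2⟩⟩ := hcon
      simp only [Set.mem_Iio] at hi hi'
      have := hf _ _ x (by omega) (by omega) hx h1 h2
      omega

/-- `S` arises by assigning the variables in `X` and passing to components. -/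
structure IsResidual (G : IncidenceGraph V C) (X : Set V) (S : Set (V ⊕ C)) : Prop where
  notMem : ∀ x ∈ X, Sum.inl x ∉ S
  closed : ∀ c x, Sum.inr c ∈ S → G.Occurs x c → x ∉ X → Sum.inl x ∈ S
  safe : ∀ x ∈ X, ∃ s, ∀ c, Sum.inr c ∈ S → ¬ G.Edge s x c

/-- Vertices of large distance force a large depth. -/
theorem lt_srbd_of_dist {X : Set V} {S : Set (V ⊕ C)} (hG : G.IsResidual X S) {u w : V ⊕ C} {k : ℕ}
    (hw : w ∈ S)
    (hr : (G.restrict S).Reachable w u) (hd : 2 ^ (k + 2) < (G.restrict S).dist w u) :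
    (k : ℕ∞) < G.srbd G.edgeless := by
  obtain ⟨p, hp⟩ := hr.exists_walk_length_eq_dist
  rw [← hp] at hd
  have hadj : ∀ i, i < p.length → (G.restrict S).Adj (p.getVert i) (p.getVert (i + 1)) :=
    fun i hi => p.adj_getVert_succ hi
  -- A shorter way to an intermediate vertex of a shortest walk would shorten the whole walk.
  have hdist : ∀ i, i ≤ p.length → (G.restrict S).dist w (p.getVert i) = i := by
    intro i hi
    have h1 : (G.restrict S).dist w (p.getVert i) ≤ i := by
      have := SimpleGraph.dist_le (p.take i)
      rwa [SimpleGraph.Walk.take_length, min_eq_left hi] at this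
    have h2 := SimpleGraph.dist_le (p.drop i)
    rw [SimpleGraph.Walk.drop_length] at h2
    have h3 := SimpleGraph.Reachable.dist_triangle_left (w := u) (p.take i).reachable
    omega
  obtain ⟨N, hN⟩ : ∃ N, N = 2 ^ (k + 1) := ⟨_, rfl⟩
  have hN2 : 2 ^ (k + 2) = 2 * N := by rw [hN]; ring
  rw [hN2] at hd
  have hNpos : 0 < N := by rw [hN]; positivity
  -- The walk alternates between variables and clauses; `e` skips a leading variable.
  obtain ⟨e, he, c0, hc0⟩ : ∃ e ≤ 1, ∃ c, p.getVert e = .inr c := by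
    rcases h0 : p.getVert 0 with x | c
    · have h := hadj 0 (by omega)
      rw [h0] at h
      rcases h1 : p.getVert 1 with y | c
      · rw [h1] at h
        exact absurd h.2.2 (not_graph_adj_inl_inl G)
      · exact ⟨1, le_rfl, c, h1⟩
    · exact ⟨0, by omega, c, h0⟩
  have hstep : ∀ i c, p.getVert i = .inr c → i + 2 ≤ p.length →
      ∃ x d, p.getVert (i + 1) = .inl x ∧ p.getVert (i + 2) = .inr d := by
    intro i c hc hi
    have h1 := hadj i (by omega)
    have h2 := hadj (i + 1) (by omega)
    rw [hc] at h1
    rcases hx : p.getVert (i + 1) with x | d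
    · rcases hy : p.getVert (i + 1 + 1) with y | d
      · rw [hx, hy] at h2
        exact absurd h2.2.2 (not_graph_adj_inl_inl G)
      · exact ⟨x, d, rfl, rfl⟩
    · rw [hx] at h1
      exact absurd h1.2.2 (not_graph_adj_inr_inr G)
  -- The condition sits inside the existential so that the clauses form a total sequence; beyond the
  -- end of the walk the last clause is repeated.
  have hcl : ∀ i, ∃ c, e + 2 * i ≤ p.length → p.getVert (e + 2 * i) = .inr c := by
    intro i
    induction i with
    | zero => exact ⟨c0, fun _ => hc0⟩
    | succ i ih =>
      obtain ⟨c, hc⟩ := ih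
      by_cases hi : e + 2 * (i + 1) ≤ p.length
      · obtain ⟨x, d, -, hd⟩ := hstep _ c (hc (by omega)) (by omega)
        exact ⟨d, fun _ => hd⟩
      · exact ⟨c, fun h => absurd h hi⟩
  choose c hc using hcl
  have hmem : ∀ i, i ≤ p.length → p.getVert i ∈ S := fun i _ =>
    mem_of_reachable_restrict hw (p.take i).reachable
  have hmemc : ∀ i, i < N - 1 → Sum.inr (c i) ∈ S := fun i hi => by
    rw [← hc i (by omega)]; exact hmem _ (by omega)
  have hnext : ∀ i, i < N - 1 → ∃ x, x ∉ X ∧ G.Occurs x (c i) ∧ G.Occurs x (c (i + 1)) := by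
    intro i hi
    obtain ⟨x, d, hx, hd⟩ := hstep _ _ (hc i (by omega)) (by omega)
    have h1 := hadj (e + 2 * i) (by omega)
    have h2 := hadj (e + 2 * i + 1) (by omega)
    rw [hx, hc i (by omega)] at h1
    rw [hx, show e + 2 * i + 1 + 1 = e + 2 * (i + 1) by ring, hc (i + 1) (by omega)] at h2
    exact ⟨x, fun h => hG.notMem x h h1.2.1, (graph_adj_inr_inl G).1 h1.2.2,
      (graph_adj_inl_inr G).1 h2.2.2⟩
  refine lt_srbd_of_forces (O := c '' Set.Iio (N - 1)) (X := X) ?_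
  subst hN
  refine forces_path k c ?_ (fun i hi => hnext i (by omega))
    (fun i hi => ?_) ?_
  · intro x hx
    obtain ⟨s, hs⟩ := hG.safe x hx
    refine ⟨s, ?_⟩
    rintro _ ⟨i, hi, rfl⟩
    exact hs _ (hmemc i hi)
  · obtain ⟨x, hx, h, -⟩ := hnext i hi
    exact ⟨x, hx, h⟩
  · intro i i' x hi hi' hx h1 h2
    have m1 := hmemc i hi
    have m2 := hmemc i' hi'
    have mx := hG.closed _ _ m1 h1 hx
    have a1 : (G.restrict S).Adj (.inr (c i)) (.inl x) := ⟨m1, mx, (graph_adj_inr_inl G).2 h1⟩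
    have a2 : (G.restrict S).Adj (.inl x) (.inr (c i')) := ⟨mx, m2, (graph_adj_inl_inr G).2 h2⟩
    have d1 := hdist (e + 2 * i) (by omega)
    have d2 := hdist (e + 2 * i') (by omega)
    rw [hc i (by omega)] at d1
    rw [hc i' (by omega)] at d2
    have hreach : (G.restrict S).Reachable w (.inr (c i)) := by
      rw [← hc i (by omega)]; exact (p.take _).reachable
    have h3 := SimpleGraph.Reachable.dist_triangle_left (w := .inr (c i')) hreach
    -- A common variable gives a walk of length two between the clauses, so the second is at most
    -- two further away from `w`. Hence only adjacent clauses of the path share a variable.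
    have h4 := SimpleGraph.dist_le (SimpleGraph.Walk.cons a1 (SimpleGraph.Walk.cons a2 .nil))
    simp at h4
    omega

end IncidenceGraph

/-! ### A program logic for the machine -/

namespace RAM

/-- The code `c`, started in `σ`, halts after at most `T` steps in a state that satisfies `Q`. -/
def Runs (ps : List Code) (c : Code) (σ : State) (T : ℕ) (Q : State → Prop) : Prop :=
  ∃ t τ, Exec ps c σ t τ ∧ t ≤ T ∧ Q τ

abbrev ld (r a p : ℕ) : Code := .instr (.load r a p)
abbrev st (a p q : ℕ) : Code := .instr (.store a p q)
abbrev cst (r v : ℕ) : Code := .instr (.const r v)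
abbrev addc (r p v : ℕ) : Code := .instr (.addConst r p v)
abbrev sb (r p q : ℕ) : Code := .instr (.sub r p q)

/-- Sequential composition of a list of codes. -/
def block : List Code → Code
  | [] => .skip
  | c :: cs => .seq c (block cs)

/-- The outcome of a comparison, as a Boolean. -/
def Test.check : Test → State → Bool
  | .eq p q, σ => decide (σ.reg p = σ.reg q)
  | .lt p q, σ => decide (σ.reg p < σ.reg q)

theorem Test.check_eq_true {b : Test} {σ : State} (h : b.Holds σ) : b.check σ = true := by
  cases b <;> simpa [Test.check, Test.Holds] using h

theorem Test.check_eq_false {b : Test} {σ : State} (h : ¬ b.Holds σ) : b.check σ = false := by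
  cases b <;> simpa [Test.check, Test.Holds] using h

namespace Code

/-- The effect of code without loops and calls. -/
def run : Code → State → State
  | .skip, σ => σ
  | .instr i, σ => i.eval σ
  | .seq a b, σ => b.run (a.run σ)
  | .ite b y n, σ => cond (b.check σ) (y.run σ) (n.run σ)
  | .while _ _, σ => σ
  | .call _, σ => σ

/-- The code has no loops and no calls. -/
def straight : Code → Bool
  | .skip => true
  | .instr _ => true
  | .seq a b => a.straight && b.straight
  | .ite _ y n => y.straight && n.straight
  | .while _ _ => false
  | .call _ => false

/-- The code has no calls. -/
def callFree : Code → Bool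
  | .skip => true
  | .instr _ => true
  | .seq a b => a.callFree && b.callFree
  | .ite _ y n => y.callFree && n.callFree
  | .while _ b => b.callFree
  | .call _ => false

/-- A bound for the number of steps of code without loops and calls. -/
def cost : Code → ℕ
  | .skip => 1
  | .instr _ => 1
  | .seq a b => a.cost + b.cost
  | .ite _ y n => max y.cost n.cost + 1
  | .while _ _ => 0
  | .call _ => 0

/-- The registers that are written by the code. -/
def wregs : Code → List ℕ
  | .skip => []
  | .instr (.const r _) => [r]
  | .instr (.addConst r _ _) => [r]
  | .instr (.sub r _ _) => [r]
  | .instr (.load r _ _) => [r]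
  | .instr (.store _ _ _) => []
  | .seq a b => a.wregs ++ b.wregs
  | .ite _ y n => y.wregs ++ n.wregs
  | .while _ b => b.wregs
  | .call _ => []

/-- The arrays that are written by the code. -/
def warrs : Code → List ℕ
  | .skip => []
  | .instr (.const _ _) => []
  | .instr (.addConst _ _ _) => []
  | .instr (.sub _ _ _) => []
  | .instr (.load _ _ _) => []
  | .instr (.store a _ _) => [a]
  | .seq a b => a.warrs ++ b.warrs
  | .ite _ y n => y.warrs ++ n.warrs
  | .while _ b => b.warrs
  | .call _ => []

end Code

/-- Only the registers in `R` and the arrays in `A` are modified. -/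
structure Frame (R A : List ℕ) (σ τ : State) : Prop where
  reg : ∀ r, r ∉ R → τ.reg r = σ.reg r
  arr : ∀ a, a ∉ A → τ.arr a = σ.arr a

theorem Frame.refl (R A : List ℕ) (σ : State) : Frame R A σ σ := ⟨fun _ _ => rfl, fun _ _ => rfl⟩

theorem Frame.trans {R A : List ℕ} {σ τ ρ : State} (h : Frame R A σ τ) (h' : Frame R A τ ρ) :
    Frame R A σ ρ :=
  ⟨fun r hr => (h'.reg r hr).trans (h.reg r hr), fun a ha => (h'.arr a ha).trans (h.arr a ha)⟩

theorem Frame.mono {R A R' A' : List ℕ} {σ τ : State} (h : Frame R A σ τ) (hR : R ⊆ R')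
    (hA : A ⊆ A') : Frame R' A' σ τ :=
  ⟨fun r hr => h.reg r fun h' => hr (hR h'), fun a ha => h.arr a fun h' => ha (hA h')⟩

theorem frame_instr (i : Instr) (σ : State) :
    Frame (Code.instr i).wregs (Code.instr i).warrs σ (i.eval σ) := by
  cases i <;> constructor <;> intro r hr <;>
    simp_all [Instr.eval, Code.wregs, Code.warrs, Function.update_of_ne]

/-- The written cells are over-approximated syntactically. For concrete code these are concrete
lists of numbers, so non-interference becomes decidable. Calls are excluded because their effect is
not visible in the code. -/
theorem Exec.frame {ps : List Code} {c : Code} {σ τ : State} {t : ℕ} (h : Exec ps c σ t τ) :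
    c.callFree = true → Frame c.wregs c.warrs σ τ := by
  induction h with
  | skip => exact fun _ => Frame.refl _ _ _
  | instr => exact fun _ => frame_instr _ _
  | seq h₁ h₂ ih₁ ih₂ =>
    intro hc
    simp only [Code.callFree, Bool.and_eq_true] at hc
    exact ((ih₁ hc.1).mono (by simp [Code.wregs]) (by simp [Code.warrs])).trans
      ((ih₂ hc.2).mono (by simp [Code.wregs]) (by simp [Code.warrs]))
  | ite_yes hb h ih =>
    intro hc
    simp only [Code.callFree, Bool.and_eq_true] at hc
    exact (ih hc.1).mono (by simp [Code.wregs]) (by simp [Code.warrs])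
  | ite_no hb h ih =>
    intro hc
    simp only [Code.callFree, Bool.and_eq_true] at hc
    exact (ih hc.2).mono (by simp [Code.wregs]) (by simp [Code.warrs])
  | while_done => exact fun _ => Frame.refl _ _ _
  | while_step hb h₁ h₂ ih₁ ih₂ => exact fun hc => (ih₁ hc).trans (ih₂ hc)
  | call => intro hc; simp [Code.callFree] at hc

variable {ps : List Code}

-- Rules of the program logic.

namespace Runs

theorem mono {c : Code} {σ : State} {T T' : ℕ} {Q Q' : State → Prop} (h : Runs ps c σ T Q)
    (hT : T ≤ T') (hQ : ∀ τ, Q τ → Q' τ) : Runs ps c σ T' Q' := by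
  obtain ⟨t, τ, h1, h2, h3⟩ := h
  exact ⟨t, τ, h1, h2.trans hT, hQ τ h3⟩

theorem skip {σ : State} {Q : State → Prop} (h : Q σ) : Runs ps .skip σ 1 Q :=
  ⟨1, σ, .skip, le_rfl, h⟩

theorem seq {a b : Code} {σ : State} {T T' : ℕ} {P Q : State → Prop} (h : Runs ps a σ T P)
    (h' : ∀ τ, P τ → Runs ps b τ T' Q) : Runs ps (.seq a b) σ (T + T') Q := by
  obtain ⟨t, τ, h1, h2, h3⟩ := h
  obtain ⟨t', ρ, h1', h2', h3'⟩ := h' τ h3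
  exact ⟨t + t', ρ, .seq h1 h1', by omega, h3'⟩

theorem block_nil {σ : State} {Q : State → Prop} (h : Q σ) : Runs ps (block []) σ 1 Q :=
  skip h

theorem block_cons {a : Code} {cs : List Code} {σ : State} {T T' : ℕ} {P Q : State → Prop}
    (h : Runs ps a σ T P) (h' : ∀ τ, P τ → Runs ps (block cs) τ T' Q) :
    Runs ps (block (a :: cs)) σ (T + T') Q := seq h h'

theorem ite {b : Test} {y n : Code} {σ : State} {T : ℕ} {Q : State → Prop}
    (hy : b.Holds σ → Runs ps y σ T Q) (hn : ¬ b.Holds σ → Runs ps n σ T Q) :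
    Runs ps (.ite b y n) σ (T + 1) Q := by
  by_cases hb : b.Holds σ
  · obtain ⟨t, τ, h1, h2, h3⟩ := hy hb
    exact ⟨t + 1, τ, .ite_yes hb h1, by omega, h3⟩
  · obtain ⟨t, τ, h1, h2, h3⟩ := hn hb
    exact ⟨t + 1, τ, .ite_no hb h1, by omega, h3⟩

theorem while_done {b : Test} {body : Code} {σ : State} {Q : State → Prop} (hb : ¬ b.Holds σ)
    (h : Q σ) : Runs ps (.while b body) σ 1 Q :=
  ⟨1, σ, .while_done hb, le_rfl, h⟩

theorem while_step {b : Test} {body : Code} {σ : State} {T T' : ℕ} {P Q : State → Prop}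
    (hb : b.Holds σ) (h : Runs ps body σ T P) (h' : ∀ τ, P τ → Runs ps (.while b body) τ T' Q) :
    Runs ps (.while b body) σ (T + T' + 1) Q := by
  obtain ⟨t, τ, h1, h2, h3⟩ := h
  obtain ⟨t', ρ, h1', h2', h3'⟩ := h' τ h3
  exact ⟨t + t' + 1, ρ, .while_step hb h1 h1', by omega, h3'⟩

theorem call {p : ℕ} {body : Code} {σ : State} {T : ℕ} {Q : State → Prop}
    (hp : ps[p]? = some body) (h : Runs ps body σ T Q) : Runs ps (.call p) σ (T + 1) Q := by
  obtain ⟨t, τ, h1, h2, h3⟩ := h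
  exact ⟨t + 1, τ, .call hp h1, by omega, h3⟩

end Runs

/-- Code without loops and calls is evaluated by a function, which lets `simp` compute the final
state; the cost takes the longer branch of every conditional. -/
theorem exec_straight : ∀ (c : Code) (σ : State), c.straight = true →
    ∃ t, Exec ps c σ t (c.run σ) ∧ t ≤ c.cost
  | .skip, σ, _ => ⟨1, .skip, le_rfl⟩
  | .instr i, σ, _ => ⟨1, .instr, le_rfl⟩
  | .seq a b, σ, h => by
    simp only [Code.straight, Bool.and_eq_true] at h
    obtain ⟨t, h1, h2⟩ := exec_straight a σ h.1
    obtain ⟨t', h1', h2'⟩ := exec_straight b (a.run σ) h.2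
    exact ⟨t + t', .seq h1 h1', by simp only [Code.cost]; omega⟩
  | .ite b y n, σ, h => by
    simp only [Code.straight, Bool.and_eq_true] at h
    by_cases hb : b.Holds σ
    · obtain ⟨t, h1, h2⟩ := exec_straight y σ h.1
      exact ⟨t + 1, by simpa only [Code.run, Test.check_eq_true hb] using .ite_yes hb h1,
        by simp only [Code.cost]; omega⟩
    · obtain ⟨t, h1, h2⟩ := exec_straight n σ h.2
      exact ⟨t + 1, by simpa only [Code.run, Test.check_eq_false hb] using .ite_no hb h1,
        by simp only [Code.cost]; omega⟩
  | .while _ _, σ, h => by simp [Code.straight] at h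
  | .call _, σ, h => by simp [Code.straight] at h

theorem Runs.straight {c : Code} {σ : State} {Q : State → Prop} (hc : c.straight = true)
    (h : Q (c.run σ)) : Runs ps c σ c.cost Q := by
  obtain ⟨t, h1, h2⟩ := exec_straight (ps := ps) c σ hc
  exact ⟨t, _, h1, h2, h⟩

theorem callFree_of_straight : ∀ (c : Code), c.straight = true → c.callFree = true
  | .skip, _ => rfl
  | .instr _, _ => rfl
  | .seq a b, h => by
    simp only [Code.straight, Bool.and_eq_true] at h
    simp [Code.callFree, callFree_of_straight a h.1, callFree_of_straight b h.2]
  | .ite _ a b, h => by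
    simp only [Code.straight, Bool.and_eq_true] at h
    simp [Code.callFree, callFree_of_straight a h.1, callFree_of_straight b h.2]
  | .while _ _, h => by simp [Code.straight] at h
  | .call _, h => by simp [Code.straight] at h

theorem frame_run {c : Code} (hc : c.straight = true) (σ : State) :
    Frame c.wregs c.warrs σ (c.run σ) := by
  obtain ⟨t, h, -⟩ := exec_straight (ps := []) c σ hc
  exact h.frame (callFree_of_straight c hc)

/-! ### Lists in arrays -/

/-- The array `f` contains the list `w` from position `lo` on. -/
def Seg (f : ℕ → ℕ) (lo : ℕ) (w : List ℕ) : Prop := ∀ i (h : i < w.length), f (lo + i) = w[i]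

theorem Seg.congr {f g : ℕ → ℕ} {lo : ℕ} {w : List ℕ} (h : Seg f lo w)
    (hg : ∀ i, lo ≤ i → i < lo + w.length → g i = f i) : Seg g lo w := fun i hi => by
  rw [hg _ (by omega) (by omega), h i hi]

theorem seg_nil (f : ℕ → ℕ) (lo : ℕ) : Seg f lo [] := fun i hi => by simp at hi

theorem seg_append {f : ℕ → ℕ} {lo : ℕ} {v w : List ℕ} :
    Seg f lo (v ++ w) ↔ Seg f lo v ∧ Seg f (lo + v.length) w := by
  constructor
  · intro h
    refine ⟨fun i hi => ?_, fun i hi => ?_⟩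
    · rw [h i (by simp; omega), List.getElem_append_left hi]
    · rw [add_assoc, h (v.length + i) (by simp; omega), List.getElem_append_right (by omega)]
      simp
  · rintro ⟨h1, h2⟩ i hi
    by_cases hv : i < v.length
    · rw [List.getElem_append_left hv, h1 i hv]
    · rw [List.getElem_append_right (by omega), ← h2 (i - v.length) (by simp at hi; omega)]
      congr 1; omega

theorem seg_cons {f : ℕ → ℕ} {lo a : ℕ} {w : List ℕ} :
    Seg f lo (a :: w) ↔ f lo = a ∧ Seg f (lo + 1) w := by
  rw [← List.singleton_append, seg_append]
  simp [Seg]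

theorem Seg.push {f : ℕ → ℕ} {lo a p : ℕ} {w : List ℕ} (h : Seg f lo w) (hp : p = lo + w.length) :
    Seg (Function.update f p a) lo (w ++ [a]) := by
  subst hp
  refine seg_append.2 ⟨h.congr fun i _ hi => Function.update_of_ne (by omega) _ _, ?_⟩
  simp [Seg]

theorem Seg.map_range {f : ℕ → ℕ} {w : List ℕ} (h : Seg f 0 w) :
    (List.range w.length).map f = w := by
  apply List.ext_getElem
  · simp
  · intro i h1 h2
    simpa using h i h2

/-- The number of a vertex: variables come first. -/
def vid {n m : ℕ} : Fin n ⊕ Fin m → ℕ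
  | .inl x => x
  | .inr c => n + c

theorem vid_injective {n m : ℕ} : Function.Injective (vid : Fin n ⊕ Fin m → ℕ) := by
  rintro (x | c) (y | d) h <;> simp only [vid] at h
  · exact congrArg _ (Fin.ext h)
  · omega
  · omega
  · exact congrArg _ (Fin.ext (by omega))

theorem vid_inj {n m : ℕ} {u v : Fin n ⊕ Fin m} : vid u = vid v ↔ u = v := vid_injective.eq_iff

/-! ### Loops -/

/-- Loop over the positions from `s` to `e` of the array `a`. -/
def forSeg (s e a : ℕ) (body : Code) : Code :=
  block [addc 12 s 0, .while (.lt 12 e) (block [ld 13 a 12, body, addc 12 12 1])]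

/-- Loop over the unassigned literals of the clauses in the array `a` between `s` and `e`. -/
def forEdges (s e a : ℕ) (body : Code) : Code :=
  block [addc 12 s 0, .while (.lt 12 e) (block [ld 13 a 12,
    .ite (.lt 13 1) .skip (block [block [sb 17 13 1, ld 14 0 17, addc 17 17 1, ld 15 0 17],
      .while (.lt 14 15) (block [block [ld 16 1 14, ld 18 4 16],
        .ite (.eq 18 7) body .skip, addc 14 14 1])]),
    addc 12 12 1])]

/-- Properties that do not depend on the registers used by the loops. -/
def Stable (I : State → Prop) : Prop :=
  ∀ τ τ', I τ → (∀ r, r < 12 ∨ 18 < r → τ'.reg r = τ.reg r) → τ'.arr = τ.arr → I τ'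

/-- The frame of a loop. -/
abbrev LoopFrame (body : Code) : State → State → Prop :=
  Frame ([12, 13, 14, 15, 16, 17, 18] ++ body.wregs) body.warrs

theorem loopFrame_of_agree {body : Code} {σ τ τ' : State} (h : LoopFrame body σ τ)
    (hr : ∀ r, r < 12 ∨ 18 < r → τ'.reg r = τ.reg r) (ha : τ'.arr = τ.arr) :
    LoopFrame body σ τ' := by
  refine ⟨fun r hr' => ?_, fun a ha' => by rw [ha, h.arr a ha']⟩
  rw [hr r ?_, h.reg r hr']
  by_contra hcon
  apply hr'
  simp
  omega

theorem loopFrame_run {body : Code} {σ τ : State} (hb : body.straight = true)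
    (h : LoopFrame body σ τ) : LoopFrame body σ (body.run τ) :=
  h.trans ((frame_run hb τ).mono (List.subset_append_right _ _) (List.Subset.refl _))

variable {n m : ℕ}

/-- The invariant is indexed by the processed prefix of the list and must not depend on the
registers of the loop itself (`Stable`). The condition `hseg` is asked for throughout the loop,
because the body may push onto the very array that is being scanned. -/
theorem runs_forSeg {s e a : ℕ} {body : Code} (hb : body.straight = true)
    (h12 : 12 ∉ body.wregs) (he : e ∉ [12, 13, 14, 15, 16, 17, 18] ++ body.wregs)
    (l : List (Fin n ⊕ Fin m)) (Inv : List (Fin n ⊕ Fin m) → State → Prop) {σ : State} {lo : ℕ}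
    (hs : σ.reg s = lo) (hend : σ.reg e = lo + l.length)
    (hstable : ∀ pre, Stable (Inv pre))
    (hseg : ∀ pre τ, Inv pre τ → LoopFrame body σ τ → Seg (τ.arr a) lo (l.map vid))
    (h0 : Inv [] σ)
    (hbody : ∀ pre v post τ, l = pre ++ v :: post → Inv pre τ → LoopFrame body σ τ →
      τ.reg 13 = vid v → Inv (pre ++ [v]) (body.run τ)) :
    Runs ps (forSeg s e a body) σ ((body.cost + 4) * l.length + 3)
      (fun τ => Inv l τ ∧ LoopFrame body σ τ) := by
  have key : ∀ post pre τ, l = pre ++ post → τ.reg 12 = lo + pre.length → Inv pre τ →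
      LoopFrame body σ τ →
      Runs ps (.while (.lt 12 e) (block [ld 13 a 12, body, addc 12 12 1])) τ
        ((body.cost + 4) * post.length + 1) (fun τ => Inv l τ ∧ LoopFrame body σ τ) := by
    intro post
    induction post with
    | nil =>
      intro pre τ hl h1 h2 h3
      refine (Runs.while_done ?_ ?_).mono (by omega) fun _ h => h
      · simp only [Test.Holds, h3.reg e he, hend, h1, hl]; simp
      · rw [hl, List.append_nil]; exact ⟨h2, h3⟩
    | cons v post ih =>
      intro pre τ hl h1 h2 h3
      have hsg := hseg pre τ h2 h3
      have hv : τ.arr a (τ.reg 12) = vid v := by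
        rw [h1, hsg pre.length (by rw [hl]; simp)]
        simp [hl]
      have hst : (block [ld 13 a 12, body, addc 12 12 1]).straight = true := by
        simp [block, Code.straight, hb]
      refine (Runs.while_step (T := (block [ld 13 a 12, body, addc 12 12 1]).cost)
        (T' := (body.cost + 4) * post.length + 1) ?_ (Runs.straight hst
          (Q := fun ρ => ρ.reg 12 = lo + (pre ++ [v]).length ∧ Inv (pre ++ [v]) ρ ∧
            LoopFrame body σ ρ) ?_)
          (fun ρ hρ => ih (pre ++ [v]) ρ (by simp [hl]) hρ.1 hρ.2.1 hρ.2.2)).mono ?_ fun _ h => h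
      · simp only [Test.Holds, h3.reg e he, hend, h1, hl]; simp
      · simp only [block, Code.run]
        set τ₁ := Instr.eval (.load 13 a 12) τ with hτ₁
        have hr1 : ∀ r, r < 12 ∨ 18 < r → τ₁.reg r = τ.reg r := by
          intro r hr
          simp only [hτ₁, Instr.eval]
          exact Function.update_of_ne (by omega) _ _
        have ha1 : τ₁.arr = τ.arr := rfl
        have hF1 := loopFrame_of_agree h3 hr1 ha1
        have hI1 := hbody pre v post τ₁ hl (hstable _ _ _ h2 hr1 ha1) hF1 (by
          simp [hτ₁, Instr.eval, hv])
        have hF2 := loopFrame_run hb hF1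
        set τ₂ := body.run τ₁ with hτ₂
        have h12' : τ₂.reg 12 = lo + pre.length := by
          rw [hτ₂, (frame_run hb τ₁).reg 12 h12, hτ₁]
          simp [Instr.eval, h1]
        set τ₃ := Instr.eval (.addConst 12 12 1) τ₂ with hτ₃
        have hr3 : ∀ r, r < 12 ∨ 18 < r → τ₃.reg r = τ₂.reg r := by
          intro r hr
          simp only [hτ₃, Instr.eval]
          exact Function.update_of_ne (by omega) _ _
        refine ⟨?_, hstable _ _ _ hI1 hr3 rfl, loopFrame_of_agree hF2 hr3 rfl⟩
        simp [hτ₃, Instr.eval, h12', add_assoc]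
      · simp only [block, Code.cost, List.length_cons]
        ring_nf
        omega
  refine (Runs.block_cons (T := 1) (Runs.straight (c := addc 12 s 0) rfl
    (Q := fun τ => τ.reg 12 = lo ∧ Inv [] τ ∧ LoopFrame body σ τ) ?_) (fun τ hτ =>
      Runs.block_cons (key l [] τ rfl (by simpa using hτ.1) hτ.2.1 hτ.2.2)
        fun ρ hρ => Runs.block_nil hρ)).mono (by omega) fun _ h => h
  have hr : ∀ r, r < 12 ∨ 18 < r → ((addc 12 s 0).run σ).reg r = σ.reg r := by
    intro r hr
    simp only [Code.run, Instr.eval]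
    exact Function.update_of_ne (by omega) _ _
  exact ⟨by simp [Code.run, Instr.eval, hs], hstable _ _ _ h0 hr rfl,
    loopFrame_of_agree (Frame.refl _ _ _) hr rfl⟩

/-- The input arrays contain the adjacency lists `L`. -/
structure Loaded (L : Fin m → List (Fin n × Bool)) (f : ℕ → ℕ → ℕ) : Prop where
  off : ∀ c : Fin m, f 0 (c + 1) = f 0 c + (L c).length
  var : ∀ (c : Fin m) (i : ℕ) (h : i < (L c).length), f 1 (f 0 c + i) = ((L c)[i].1 : ℕ)
  pol : ∀ (c : Fin m) (i : ℕ) (h : i < (L c).length), f 2 (f 0 c + i) = (L c)[i].2.toNat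

open Classical in
/-- The edges at the clause `c` to the variables outside of `X` in a list of literals. -/
noncomputable def litEdges (X : Set (Fin n)) (c : Fin m) (ls : List (Fin n × Bool)) :
    List (Fin m × Fin n × Bool) :=
  (ls.filter fun p => p.1 ∉ X).map fun p => (c, p.1, p.2)

/-- The edges between the clauses in `l` and the variables outside of `X`. -/
noncomputable def edges (L : Fin m → List (Fin n × Bool)) (X : Set (Fin n))
    (l : List (Fin n ⊕ Fin m)) : List (Fin m × Fin n × Bool) :=
  l.flatMap fun
    | .inl _ => []
    | .inr c => litEdges X c (L c)

theorem mem_litEdges {X : Set (Fin n)} {c : Fin m} {ls : List (Fin n × Bool)}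
    {e : Fin m × Fin n × Bool} :
    e ∈ litEdges X c ls ↔ e.1 = c ∧ e.2 ∈ ls ∧ e.2.1 ∉ X := by
  obtain ⟨c', x, s⟩ := e
  simp only [litEdges, List.mem_map, List.mem_filter, decide_eq_true_eq, Prod.mk.injEq,
    Prod.exists]
  constructor
  · rintro ⟨a, b, ⟨h1, h2⟩, rfl, rfl, rfl⟩
    exact ⟨rfl, h1, h2⟩
  · rintro ⟨rfl, h1, h2⟩
    exact ⟨x, s, ⟨h1, h2⟩, rfl, rfl, rfl⟩

theorem mem_edges {L : Fin m → List (Fin n × Bool)} {X : Set (Fin n)}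
    {l : List (Fin n ⊕ Fin m)} {e : Fin m × Fin n × Bool} :
    e ∈ edges L X l ↔ Sum.inr e.1 ∈ l ∧ e.2 ∈ L e.1 ∧ e.2.1 ∉ X := by
  simp only [edges, List.mem_flatMap]
  constructor
  · rintro ⟨x | c, h1, h2⟩
    · simp at h2
    · obtain ⟨rfl, h3⟩ := mem_litEdges.1 h2
      exact ⟨h1, h3⟩
  · rintro ⟨h1, h2⟩
    exact ⟨_, h1, mem_litEdges.2 ⟨rfl, h2⟩⟩

/-- This later bounds the number of variables that are branched on for an obstruction. -/
theorem length_edges_le {L : Fin m → List (Fin n × Bool)} {K : ℕ} (hK : ∀ c, (L c).length ≤ K)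
    (X : Set (Fin n)) (l : List (Fin n ⊕ Fin m)) : (edges L X l).length ≤ l.length * K := by
  induction l with
  | nil => simp [edges]
  | cons v l ih =>
    have : (edges L X (v :: l)).length ≤ K + (edges L X l).length := by
      rcases v with x | c
      · simp [edges]
      · simp only [edges, List.flatMap_cons, List.length_append]
        gcongr
        exact (by simpa [litEdges] using List.length_filter_le _ _ : _ ≤ (L c).length).trans (hK c)
    rw [List.length_cons, Nat.succ_mul]
    omega

/-- The literals of the listed clauses are visited in the order of `edges`, and assigned variables
are recognized by their entries in the array `4`. The body finds the clause in the register `13`,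
the variable in `16` and the position of the literal in `14`. Since clauses have at most `K`
literals, the loop is linear in the number of vertices. -/
theorem runs_forEdges {s e a : ℕ} {body : Code} (hb : body.straight = true)
    (hw : ∀ r ∈ [1, 7, 12, 13, 14, 15], r ∉ body.wregs)
    (he : e ∉ [12, 13, 14, 15, 16, 17, 18] ++ body.wregs)
    (hwa : ∀ b ∈ [0, 1, 2, 4, a], b ∉ body.warrs)
    {L : Fin m → List (Fin n × Bool)} {K : ℕ} (hK : ∀ c, (L c).length ≤ K) {X : Set (Fin n)}
    (l : List (Fin n ⊕ Fin m)) (Inv : List (Fin m × Fin n × Bool) → State → Prop) {σ : State}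
    {lo : ℕ} (hs : σ.reg s = lo) (hend : σ.reg e = lo + l.length)
    (hn : σ.reg 1 = n) (hz : σ.reg 7 = 0) (hL : Loaded L σ.arr)
    (hX : ∀ x : Fin n, σ.arr 4 x = 0 ↔ x ∉ X)
    (hseg : Seg (σ.arr a) lo (l.map vid))
    (hstable : ∀ pre, Stable (Inv pre)) (h0 : Inv [] σ)
    (hbody : ∀ pre c x b τ, (c, x, b) ∈ edges L X l → Inv pre τ → LoopFrame body σ τ →
      τ.reg 13 = n + c → τ.reg 16 = x → σ.arr 2 (τ.reg 14) = b.toNat →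
      Inv (pre ++ [(c, x, b)]) (body.run τ)) :
    Runs ps (forEdges s e a body) σ ((K * (body.cost + 8) + 12) * l.length + 3)
      (fun τ => Inv (edges L X l) τ ∧ LoopFrame body σ τ) := by
  have hreg : ∀ {τ}, LoopFrame body σ τ → ∀ r ∈ [1, 7], τ.reg r = σ.reg r := by
    intro τ hτ r hr
    refine hτ.reg r ?_
    simp only [List.mem_append, not_or]
    refine ⟨?_, hw r ?_⟩
    · simp at hr ⊢; omega
    · simp at hr ⊢; omega
  have harr : ∀ {τ}, LoopFrame body σ τ → ∀ b ∈ [0, 1, 2, 4, a], τ.arr b = σ.arr b :=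
    fun hτ b hb' => hτ.arr b (hwa b hb')
  -- the loop over the literals of a clause
  have inner : ∀ (c : Fin m) (P : List (Fin m × Fin n × Bool)), Sum.inr c ∈ l →
      ∀ rest done τ, L c = done ++ rest → τ.reg 13 = n + c → τ.reg 12 < lo + l.length →
      τ.reg 14 = σ.arr 0 c + done.length →
      τ.reg 15 = σ.arr 0 c + (L c).length → Inv (P ++ litEdges X c done) τ →
      LoopFrame body σ τ →
      Runs ps (.while (.lt 14 15) (block [block [ld 16 1 14, ld 18 4 16],
        .ite (.eq 18 7) body .skip, addc 14 14 1])) τ ((body.cost + 8) * rest.length + 1)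
        (fun ρ => Inv (P ++ litEdges X c (L c)) ρ ∧ LoopFrame body σ ρ ∧
          ρ.reg 12 = τ.reg 12) := by
    intro c P hc rest
    induction rest with
    | nil =>
      intro done τ hL' _ _ h14 h15 hI hF
      rw [List.append_nil] at hL'
      refine (Runs.while_done ?_ ?_).mono (by omega) fun _ h => h
      · simp [Test.Holds, h14, h15, hL']
      · exact ⟨hL' ▸ hI, hF, rfl⟩
    | cons p rest ih =>
      intro done τ hL' h13 h12 h14 h15 hI hF
      have hlen : done.length < (L c).length := by rw [hL']; simp
      have hp : (L c)[done.length] = p := by simp [hL']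
      have hx : τ.arr 1 (τ.reg 14) = p.1 := by
        rw [h14, harr hF 1 (by simp), hL.var c _ hlen, hp]
      have hpol : σ.arr 2 (τ.reg 14) = p.2.toNat := by
        rw [h14, hL.pol c _ hlen, hp]
      have hst : (block [block [ld 16 1 14, ld 18 4 16],
          .ite (.eq 18 7) body .skip, addc 14 14 1]).straight = true := by
        simp [block, Code.straight, hb]
      refine (Runs.while_step (T := (block [block [ld 16 1 14, ld 18 4 16],
          .ite (.eq 18 7) body .skip, addc 14 14 1]).cost)
        (T' := (body.cost + 8) * rest.length + 1) ?_ (Runs.straight hst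
          (Q := fun ρ => ρ.reg 13 = n + c ∧ ρ.reg 12 = τ.reg 12 ∧
            ρ.reg 14 = σ.arr 0 c + (done ++ [p]).length ∧
            ρ.reg 15 = σ.arr 0 c + (L c).length ∧ Inv (P ++ litEdges X c (done ++ [p])) ρ ∧
            LoopFrame body σ ρ) ?_)
          (fun ρ ⟨i1, i2, i3, i4, i5, i6⟩ => (ih (done ++ [p]) ρ (by simp [hL']) i1
            (by rw [i2]; exact h12) i3 i4 i5 i6).mono le_rfl
              fun _ h => ⟨h.1, h.2.1, h.2.2.trans i2⟩)).mono ?_ fun _ h => h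
      · simp only [Test.Holds, h14, h15]; omega
      · simp only [block, Code.run]
        set τ₁ := Instr.eval (.load 18 4 16) (Instr.eval (.load 16 1 14) τ) with hτ₁
        have hr1 : ∀ r, r ≠ 16 → r ≠ 18 → τ₁.reg r = τ.reg r := by
          intro r h1 h2
          simp [hτ₁, Instr.eval, h1, h2]
        have hr1' : ∀ r, r < 12 ∨ 18 < r → τ₁.reg r = τ.reg r :=
          fun r hr => hr1 r (by omega) (by omega)
        have ha1 : τ₁.arr = τ.arr := rfl
        have hF1 := loopFrame_of_agree hF hr1' ha1
        have hI1 := hstable _ _ _ hI hr1' ha1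
        have h16 : τ₁.reg 16 = p.1 := by simp [hτ₁, Instr.eval, hx]
        have h18 : τ₁.reg 18 = σ.arr 4 p.1 := by
          simp [hτ₁, Instr.eval, hx, harr hF 4]
        have hz1 : τ₁.reg 7 = 0 := by rw [hreg hF1 7 (by simp), hz]
        -- A literal of an assigned variable contributes nothing to `litEdges`, so skipping the body
        -- maintains the invariant in that case.
        have hmid : ∃ τ₂, cond ((Test.eq 18 7).check τ₁) (body.run τ₁) τ₁ = τ₂ ∧
            Inv (P ++ litEdges X c (done ++ [p])) τ₂ ∧ LoopFrame body σ τ₂ ∧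
            ∀ r ∈ [12, 13, 14, 15], τ₂.reg r = τ.reg r := by
          by_cases hX' : p.1 ∈ X
          · have : ¬ (Test.eq 18 7).Holds τ₁ := by
              simp only [Test.Holds, h18, hz1, hX]; simpa using hX'
            rw [Test.check_eq_false this, cond_false]
            refine ⟨_, rfl, ?_, hF1, fun r hr => ?_⟩
            · simpa [litEdges, hX'] using hI1
            · exact hr1 r (by rintro rfl; simp at hr) (by rintro rfl; simp at hr)
          · have : (Test.eq 18 7).Holds τ₁ := by
              simp only [Test.Holds, h18, hz1, hX]; exact hX'
            rw [Test.check_eq_true this, cond_true]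
            refine ⟨_, rfl, ?_, loopFrame_run hb hF1, fun r hr => ?_⟩
            · have hI2 := hbody _ c p.1 p.2 τ₁ (mem_edges.2 ⟨hc, by simp [hL'], hX'⟩) hI1 hF1
                (by rw [hr1 13 (by simp) (by simp), h13]) h16
                (by rw [hr1 14 (by simp) (by simp), hpol])
              simpa [litEdges, hX'] using hI2
            · rw [(frame_run hb τ₁).reg r (hw r (by simp at hr ⊢; omega))]
              exact hr1 r (by rintro rfl; simp at hr) (by rintro rfl; simp at hr)
        obtain ⟨τ₂, hτ₂, hI2, hF2, hr2⟩ := hmid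
        simp only [hτ₂]
        have hr3 : ∀ r, r ≠ 14 → (Instr.eval (.addConst 14 14 1) τ₂).reg r = τ₂.reg r := by
          intro r hr
          simp [Instr.eval, hr]
        have hr3' : ∀ r, r < 12 ∨ 18 < r →
            (Instr.eval (.addConst 14 14 1) τ₂).reg r = τ₂.reg r := fun r hr => hr3 r (by omega)
        refine ⟨?_, ?_, ?_, ?_, hstable _ _ _ hI2 hr3' rfl, loopFrame_of_agree hF2 hr3' rfl⟩
        · rw [hr3 13 (by simp), hr2 13 (by simp), h13]
        · rw [hr3 12 (by simp), hr2 12 (by simp)]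
        · simp [Instr.eval, hr2 14, h14, add_assoc]
        · rw [hr3 15 (by simp), hr2 15 (by simp), h15]
      · simp only [block, Code.cost, List.length_cons, Nat.mul_succ]
        omega
  have key : ∀ post pre τ, l = pre ++ post → τ.reg 12 = lo + pre.length →
      Inv (edges L X pre) τ → LoopFrame body σ τ →
      Runs ps (.while (.lt 12 e) (block [ld 13 a 12,
        .ite (.lt 13 1) .skip (block [block [sb 17 13 1, ld 14 0 17, addc 17 17 1, ld 15 0 17],
          .while (.lt 14 15) (block [block [ld 16 1 14, ld 18 4 16],
            .ite (.eq 18 7) body .skip, addc 14 14 1])]),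
        addc 12 12 1])) τ ((K * (body.cost + 8) + 12) * post.length + 1)
        (fun τ => Inv (edges L X l) τ ∧ LoopFrame body σ τ) := by
    intro post
    induction post with
    | nil =>
      intro pre τ hl h1 h2 h3
      refine (Runs.while_done ?_ ?_).mono (by omega) fun _ h => h
      · simp only [Test.Holds, h3.reg e he, hend, h1, hl]; simp
      · rw [hl, List.append_nil]; exact ⟨h2, h3⟩
    | cons v post ih =>
      intro pre τ hl h12 hI hF
      have hvl : v ∈ l := by rw [hl]; simp
      have hv : τ.arr a (τ.reg 12) = vid v := by
        rw [h12, harr hF a (by simp), hseg pre.length (by rw [hl]; simp)]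
        simp [hl]
      have hlt : τ.reg 12 < lo + l.length := by rw [h12, hl]; simp
      have hedges : ∀ es, es = edges L X (pre ++ [v]) → es = edges L X pre ++ (match v with
          | .inl _ => []
          | .inr c => litEdges X c (L c)) := by
        rintro _ rfl
        rcases v with x | c <;> simp [edges]
      refine (Runs.while_step (T := (K * (body.cost + 8) + 11))
        (T' := (K * (body.cost + 8) + 12) * post.length + 1) ?_ (?_ : Runs ps _ τ _
          (fun ρ => ρ.reg 12 = lo + (pre ++ [v]).length ∧ Inv (edges L X (pre ++ [v])) ρ ∧
            LoopFrame body σ ρ))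
          (fun ρ hρ => ih (pre ++ [v]) ρ (by simp [hl]) hρ.1 hρ.2.1 hρ.2.2)).mono ?_ fun _ h => h
      · simp only [Test.Holds, hF.reg e he, hend, h12, hl]; simp
      · refine (Runs.block_cons (T := 1) (P := fun ρ => ρ.reg 13 = vid v ∧ ρ.reg 12 = τ.reg 12 ∧
          Inv (edges L X pre) ρ ∧ LoopFrame body σ ρ) (Runs.straight rfl ?_)
          (fun τ₁ ⟨j13, j12, jI, jF⟩ => Runs.block_cons (T := K * (body.cost + 8) + 1 + 6 + 1)
            (T' := 2)
            (P := fun ρ => ρ.reg 12 = τ.reg 12 ∧ Inv (edges L X (pre ++ [v])) ρ ∧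
              LoopFrame body σ ρ) (Runs.ite ?_ ?_)
            (fun τ₂ ⟨i12, iI, iF⟩ => Runs.straight (ps := ps) (c := block [addc 12 12 1])
              rfl ?_))).mono (by omega) fun _ h => h
        · have hr : ∀ r, r ≠ 13 → ((ld 13 a 12).run τ).reg r = τ.reg r := by
            intro r hr
            simp [Code.run, Instr.eval, hr]
          exact ⟨by simp [Code.run, Instr.eval, hv], hr 12 (by simp),
            hstable _ _ _ hI (fun r h => hr r (by omega)) rfl,
            loopFrame_of_agree hF (fun r h => hr r (by omega)) rfl⟩
        · intro hlt1
          simp only [Test.Holds, j13, hreg jF 1 (by simp), hn] at hlt1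
          refine (Runs.skip ?_).mono (by omega) fun _ h => h
          rcases v with x | c
          · rw [hedges _ rfl, List.append_nil]
            exact ⟨j12, jI, jF⟩
          · simp [vid] at hlt1
        · intro hlt1
          simp only [Test.Holds, j13, hreg jF 1 (by simp), hn] at hlt1
          rcases v with x | c
          · simp [vid] at hlt1
          rw [hedges _ rfl]
          simp only [vid] at j13
          refine (Runs.block_cons (T := 5) (P := fun ρ => ρ.reg 13 = n + c ∧ ρ.reg 12 = τ.reg 12 ∧
            ρ.reg 14 = σ.arr 0 c ∧ ρ.reg 15 = σ.arr 0 c + (L c).length ∧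
            Inv (edges L X pre) ρ ∧ LoopFrame body σ ρ)
            (Runs.straight rfl ?_) (fun τ₂ ⟨i13, i12, i14, i15, iI, iF⟩ =>
              Runs.block_cons (inner c (edges L X pre) hvl (L c) [] τ₂ rfl i13
                (by rw [i12]; exact hlt) (by simpa using i14) i15
                (by simpa [litEdges] using iI) iF)
                (fun τ₃ h₃ => Runs.block_nil ⟨h₃.2.2.trans i12, h₃.1, h₃.2.1⟩))).mono ?_
              fun _ h => h
          · set τ₂ := (block [sb 17 13 1, ld 14 0 17, addc 17 17 1, ld 15 0 17]).run τ₁ with hτ₂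
            have hr : ∀ r, r ≠ 14 → r ≠ 15 → r ≠ 17 → τ₂.reg r = τ₁.reg r := by
              intro r h1 h2 h3
              simp [hτ₂, block, Code.run, Instr.eval, h1, h2, h3]
            -- Clauses are numbered from `n` on; the subtraction recovers the index into the array
            -- of offsets.
            have hc17 : τ₁.reg 13 - τ₁.reg 1 = c := by
              rw [j13, hreg jF 1 (by simp), hn]; omega
            have ha0 : τ₁.arr 0 = σ.arr 0 := harr jF 0 (by simp)
            refine ⟨by rw [hr 13 (by simp) (by simp) (by simp), j13],
              by rw [hr 12 (by simp) (by simp) (by simp), j12], ?_, ?_,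
              hstable _ _ _ jI (fun r h => hr r (by omega) (by omega) (by omega)) rfl,
              loopFrame_of_agree jF (fun r h => hr r (by omega) (by omega) (by omega)) rfl⟩
            · simp [hτ₂, block, Code.run, Instr.eval, hc17, ha0]
            · simp [hτ₂, block, Code.run, Instr.eval, hc17, ha0, hL.off]
          · have := Nat.mul_le_mul_left (body.cost + 8) (hK c)
            rw [Nat.mul_comm K]
            omega
        · have hr : ∀ r, r ≠ 12 → ((block [addc 12 12 1]).run τ₂).reg r = τ₂.reg r := by
            intro r hr
            simp [block, Code.run, Instr.eval, hr]
          exact ⟨by simp [block, Code.run, Instr.eval, i12, h12, add_assoc],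
            hstable _ _ _ iI (fun r h => hr r (by omega)) rfl,
            loopFrame_of_agree iF (fun r h => hr r (by omega)) rfl⟩
      · rw [List.length_cons]
        apply le_of_eq
        ring
  refine (Runs.block_cons (T := 1) (Runs.straight (c := addc 12 s 0) rfl
    (Q := fun τ => τ.reg 12 = lo ∧ Inv [] τ ∧ LoopFrame body σ τ) ?_) (fun τ hτ =>
      Runs.block_cons (key l [] τ rfl (by simpa using hτ.1) hτ.2.1 hτ.2.2)
        fun ρ hρ => Runs.block_nil hρ)).mono (by omega) fun _ h => h
  have hr : ∀ r, r < 12 ∨ 18 < r → ((addc 12 s 0).run σ).reg r = σ.reg r := by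
    intro r hr
    simp only [Code.run, Instr.eval]
    exact Function.update_of_ne (by omega) _ _
  exact ⟨by simp [Code.run, Instr.eval, hs], hstable _ _ _ h0 hr rfl,
    loopFrame_of_agree (Frame.refl _ _ _) hr rfl⟩

end RAM

/-! ### Propagation of labels -/

namespace RAM

open IncidenceGraph

variable {n m : ℕ}

/-- Labels `f` and parents `g` after some labels have been lowered along the pairs in `E`. -/
structure HalfStep (E : List ((Fin n ⊕ Fin m) × (Fin n ⊕ Fin m)))
    (f g f' g' : Fin n ⊕ Fin m → ℕ) : Prop where
  le : ∀ b, f' b ≤ f b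
  relaxed : ∀ p ∈ E, f' p.2 ≤ f p.1
  cases : ∀ b, (f' b = f b ∧ g' b = g b) ∨
    ∃ p ∈ E, p.2 = b ∧ f' b = f p.1 ∧ f' b < f b ∧ g' b = vid p.1

/-- Following parents from `u` leads to `ρ` in at most `t` steps; all labels on the way are the
number of `ρ`. -/
inductive ParChain (H : SimpleGraph (Fin n ⊕ Fin m)) (f g : Fin n ⊕ Fin m → ℕ)
    (ρ : Fin n ⊕ Fin m) : ℕ → Fin n ⊕ Fin m → Prop
  | root {t} : ParChain H f g ρ t ρ
  | step {t u w} (hf : f u = vid ρ) (hadj : H.Adj u w) (hg : g u = vid w)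
      (h : ParChain H f g ρ t w) : ParChain H f g ρ (t + 1) u

theorem ParChain.mono {H : SimpleGraph (Fin n ⊕ Fin m)} {f g : Fin n ⊕ Fin m → ℕ}
    {ρ u : Fin n ⊕ Fin m} {t t' : ℕ} (h : ParChain H f g ρ t u) (ht : t ≤ t') :
    ParChain H f g ρ t' u := by
  induction h generalizing t' with
  | root => exact .root
  | step hf hadj hg _ ih =>
    obtain ⟨t', rfl⟩ : ∃ i, t' = i + 1 := ⟨t' - 1, by omega⟩
    exact .step hf hadj hg (ih (by omega))

/-- The invariant of the label propagation. -/
structure LabelInv (S : Set (Fin n ⊕ Fin m)) (H : SimpleGraph (Fin n ⊕ Fin m)) (t : ℕ)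
    (f g : Fin n ⊕ Fin m → ℕ) : Prop where
  le : ∀ u ∈ S, f u ≤ vid u
  reach : ∀ u ∈ S, ∃ w ∈ S, H.Reachable u w ∧ f u = vid w
  chain : ∀ ρ ∈ S, (∀ w, H.Reachable ρ w → vid ρ ≤ vid w) → ∀ u ∈ S, f u = vid ρ →
    ParChain H f g ρ t u

/-- A vertex that carries the smallest number of its component is never lowered again, so its parent
is final and old chains persist. A vertex that receives this number now points to a neighbour that
already had it, which lengthens the chain by one. -/
theorem LabelInv.halfStep {S : Set (Fin n ⊕ Fin m)} {H : SimpleGraph (Fin n ⊕ Fin m)} {t : ℕ}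
    {f g f' g' : Fin n ⊕ Fin m → ℕ} (h : LabelInv S H t f g)
    {E : List ((Fin n ⊕ Fin m) × (Fin n ⊕ Fin m))} (hH : ∀ u v, H.Adj u v → v ∈ S)
    (hE : ∀ p ∈ E, H.Adj p.2 p.1) (hs : HalfStep E f g f' g') : LabelInv S H (t + 1) f' g' := by
  have hreach : ∀ u ∈ S, ∃ w ∈ S, H.Reachable u w ∧ f' u = vid w := by
    intro u hu
    rcases hs.cases u with ⟨h1, -⟩ | ⟨p, hp, rfl, h1, -, -⟩
    · rw [h1]; exact h.reach u hu
    · obtain ⟨w, hw, h2, h3⟩ := h.reach p.1 (hH _ _ (hE p hp))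
      exact ⟨w, hw, (hE p hp).reachable.trans h2, h1.trans h3⟩
  refine ⟨fun u hu => (hs.le u).trans (h.le u hu), hreach, fun ρ hρ hmin u hu hf => ?_⟩
  have key : ∀ v, f v = vid ρ → v ∈ S → f' v = vid ρ ∧ g' v = g v := by
    intro v hv hvS
    obtain ⟨w, -, hw, hfw⟩ := h.reach v hvS
    obtain rfl : ρ = w := vid_injective (hv.symm.trans hfw)
    obtain ⟨w', -, hw', hfw'⟩ := hreach v hvS
    have h1 := hmin w' (hw.symm.trans hw')
    rcases hs.cases v with ⟨h2, h3⟩ | ⟨p, hp, -, -, h2, -⟩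
    · exact ⟨h2.trans hv, h3⟩
    · omega
  have key' : ∀ t' v, ParChain H f g ρ t' v → v ∈ S → ParChain H f' g' ρ t' v := by
    intro t' v hv
    induction hv with
    | root => exact fun _ => .root
    | step hf hadj hg hc ih =>
      intro hvS
      obtain ⟨h1, h2⟩ := key _ hf hvS
      exact .step h1 hadj (h2.trans hg) (ih (hH _ _ hadj))
  rcases hs.cases u with ⟨h1, h2⟩ | ⟨p, hp, rfl, h1, h2, h3⟩
  · exact (key' _ _ (h.chain ρ hρ hmin u hu (h1.symm.trans hf)) hu).mono (by omega)
  · have hp1 := hH _ _ (hE p hp)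
    exact .step hf (hE p hp) h3 (key' _ _ (h.chain ρ hρ hmin _ hp1 (h1.symm.trans hf)) hp1)

/-- After `r` rounds, labels have travelled along walks of length `r`. -/
def Spread (S : Set (Fin n ⊕ Fin m)) (H : SimpleGraph (Fin n ⊕ Fin m)) (r : ℕ)
    (f : Fin n ⊕ Fin m → ℕ) : Prop :=
  ∀ w ∈ S, ∀ u, ∀ p : H.Walk w u, p.length ≤ r → f u ≤ vid w

/-- The last edge of a walk of length `r + 1` is relaxed in one of the two half steps, and the other
half step can only lower labels further. -/
theorem Spread.round {S : Set (Fin n ⊕ Fin m)} {H : SimpleGraph (Fin n ⊕ Fin m)} {r : ℕ}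
    {f g f₁ g₁ f₂ g₂ : Fin n ⊕ Fin m → ℕ} (h : Spread S H r f)
    {E₁ E₂ : List ((Fin n ⊕ Fin m) × (Fin n ⊕ Fin m))}
    (hE : ∀ u v, H.Adj u v → (u, v) ∈ E₁ ∨ (u, v) ∈ E₂) (h₁ : HalfStep E₁ f g f₁ g₁)
    (h₂ : HalfStep E₂ f₁ g₁ f₂ g₂) : Spread S H (r + 1) f₂ := by
  intro w hw u p hp
  rcases Nat.lt_or_ge r p.length with hlt | hle
  · have hadj := p.adj_getVert_succ (i := r) (by omega)
    have hu : p.getVert (r + 1) = u := by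
      rw [show r + 1 = p.length by omega]; exact p.getVert_length
    rw [hu] at hadj
    have h0 := h w hw _ (p.take r) (by simp)
    rcases hE _ _ hadj with h' | h'
    · exact ((h₂.le _).trans (h₁.relaxed _ h')).trans h0
    · exact ((h₂.relaxed _ h').trans (h₁.le _)).trans h0
  · exact ((h₂.le u).trans (h₁.le u)).trans (h w hw u p hle)

/-- The labels have reached their final values. -/
structure StableLabels (S : Set (Fin n ⊕ Fin m)) (H : SimpleGraph (Fin n ⊕ Fin m)) (t : ℕ)
    (f g : Fin n ⊕ Fin m → ℕ) : Prop where
  le : ∀ u ∈ S, f u ≤ vid u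
  root : ∀ u ∈ S, ∃ ρ ∈ S, f u = vid ρ ∧ f ρ = vid ρ
  reachable_iff : ∀ u ∈ S, ∀ v ∈ S, H.Reachable u v ↔ f u = f v
  chain : ∀ ρ ∈ S, ∀ u ∈ S, f ρ = vid ρ → f u = vid ρ → ParChain H f g ρ t u

/-- Labels that agree along edges are constant on components. As every label is the number of a
vertex of the same component, different components have different labels; as labels are at most the
vertex numbers, the common label is the smallest number, which is what the chains require. -/
theorem LabelInv.stable {S : Set (Fin n ⊕ Fin m)} {H : SimpleGraph (Fin n ⊕ Fin m)} {t : ℕ}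
    {f g : Fin n ⊕ Fin m → ℕ} (h : LabelInv S H t f g) (hH : ∀ u v, H.Adj u v → v ∈ S)
    (hf : ∀ u v, H.Adj u v → f u = f v) : StableLabels S H t f g := by
  have hconst : ∀ u v, H.Reachable u v → f u = f v := by
    intro u v huv
    rw [SimpleGraph.reachable_iff_reflTransGen] at huv
    induction huv with
    | refl => rfl
    | tail _ hbc ih => exact ih.trans (hf _ _ hbc)
  have hmem : ∀ u ∈ S, ∀ v, H.Reachable u v → v ∈ S := by
    intro u hu v huv
    rw [SimpleGraph.reachable_iff_reflTransGen] at huv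
    induction huv with
    | refl => exact hu
    | tail _ hbc ih => exact hH _ _ hbc
  refine ⟨h.le, fun u hu => ?_, fun u hu v hv => ⟨hconst u v, fun huv => ?_⟩,
    fun ρ hρ u hu hfρ hfu => h.chain ρ hρ (fun w hw => ?_) u hu hfu⟩
  · obtain ⟨w, hw, h1, h2⟩ := h.reach u hu
    exact ⟨w, hw, h2, (hconst u w h1).symm.trans h2⟩
  · obtain ⟨w, hw, h1, h2⟩ := h.reach u hu
    obtain ⟨w', hw', h1', h2'⟩ := h.reach v hv
    obtain rfl : w = w' := vid_injective (by rw [← h2, ← h2', huv])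
    exact h1.trans h1'.symm
  · rw [← hfρ, hconst ρ w hw]
    exact h.le w (hmem ρ hρ w hw)

/-- If all distances were at most `r`, every label would be at most every vertex number of its
component. The labels at the ends of an edge are themselves such numbers, so each would be at most
the other. -/
theorem LabelInv.exists_dist {S : Set (Fin n ⊕ Fin m)} {H : SimpleGraph (Fin n ⊕ Fin m)} {t r : ℕ}
    {f g : Fin n ⊕ Fin m → ℕ} (h : LabelInv S H t f g) (hr : Spread S H r f)
    {u v : Fin n ⊕ Fin m} (hu : u ∈ S) (hv : v ∈ S) (huv : H.Adj u v) (hne : f u ≠ f v) :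
    ∃ w ∈ S, ∃ u, H.Reachable w u ∧ r < H.dist w u := by
  by_contra! hcon
  have key : ∀ w ∈ S, ∀ u, H.Reachable w u → f u ≤ vid w := by
    intro w hw u hwu
    obtain ⟨p, hp⟩ := hwu.exists_walk_length_eq_dist
    exact hr w hw u p (hp ▸ hcon w hw u hwu)
  obtain ⟨w, hw, h1, h2⟩ := h.reach u hu
  obtain ⟨w', hw', h1', h2'⟩ := h.reach v hv
  have h3 := key w hw v (h1.symm.trans huv.reachable)
  have h4 := key w' hw' u (h1'.symm.trans huv.symm.reachable)
  omega

/-! ### The code for the propagation -/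

/-- The numbers of the variables and clauses, the constants, the input and the assigned variables
are in place. -/
structure Env (k : ℕ) (L : Fin m → List (Fin n × Bool)) (X : Set (Fin n)) (σ : State) : Prop where
  vars : σ.reg 1 = n
  zero : σ.reg 7 = 0
  one : σ.reg 8 = 1
  rounds : σ.reg 9 = 2 ^ (k + 2)
  loaded : Loaded L σ.arr
  assigned : ∀ x : Fin n, σ.arr 4 x = 0 ↔ x ∉ X

/-- The vertices in `l` are listed in the array `9` between the positions in the registers `10`
and `11`. -/
structure Cur (l : List (Fin n ⊕ Fin m)) (lo : ℕ) (σ : State) : Prop where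
  first : σ.reg 10 = lo
  last : σ.reg 11 = lo + l.length
  seg : Seg (σ.arr 9) lo (l.map vid)

theorem Env.congr {k : ℕ} {L : Fin m → List (Fin n × Bool)} {X : Set (Fin n)} {σ τ : State}
    (h : Env k L X σ) (hr : ∀ r ∈ [1, 7, 8, 9], τ.reg r = σ.reg r)
    (ha : ∀ a ∈ [0, 1, 2, 4], τ.arr a = σ.arr a) : Env k L X τ := by
  refine ⟨by rw [hr 1 (by simp), h.vars], by rw [hr 7 (by simp), h.zero],
    by rw [hr 8 (by simp), h.one], by rw [hr 9 (by simp), h.rounds], ⟨?_, ?_, ?_⟩, ?_⟩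
  · rw [ha 0 (by simp)]; exact h.loaded.off
  · rw [ha 0 (by simp), ha 1 (by simp)]; exact h.loaded.var
  · rw [ha 0 (by simp), ha 2 (by simp)]; exact h.loaded.pol
  · rw [ha 4 (by simp)]; exact h.assigned

theorem Env.frame {k : ℕ} {L : Fin m → List (Fin n × Bool)} {X : Set (Fin n)} {σ τ : State}
    {R A : List ℕ} (h : Env k L X σ) (hF : Frame R A σ τ)
    (hr : ∀ r ∈ [1, 7, 8, 9], r ∉ R) (ha : ∀ a ∈ [0, 1, 2, 4], a ∉ A) : Env k L X τ :=
  h.congr (fun r h' => hF.reg r (hr r h')) fun a h' => hF.arr a (ha a h')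

theorem Cur.congr {l : List (Fin n ⊕ Fin m)} {lo : ℕ} {σ τ : State} (h : Cur l lo σ)
    (hr : ∀ r ∈ [10, 11], τ.reg r = σ.reg r)
    (ha : ∀ i, lo ≤ i → i < lo + l.length → τ.arr 9 i = σ.arr 9 i) : Cur l lo τ :=
  ⟨by rw [hr 10 (by simp), h.first], by rw [hr 11 (by simp), h.last],
    h.seg.congr fun i h1 h2 => ha i h1 (by simpa using h2)⟩

theorem Cur.frame {l : List (Fin n ⊕ Fin m)} {lo : ℕ} {σ τ : State} {R A : List ℕ}
    (h : Cur l lo σ) (hF : Frame R A σ τ) (hr : ∀ r ∈ [10, 11], r ∉ R) (ha : 9 ∉ A) :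
    Cur l lo τ :=
  h.congr (fun r h' => hF.reg r (hr r h')) fun i _ _ => by rw [hF.arr 9 ha]

/-- Lower the label of the vertex in the register `t` to that of the vertex in the register
`s`. -/
def relax (s t : ℕ) : Code :=
  block [ld 19 5 s, ld 20 5 t, .ite (.lt 19 20) (block [st 5 t 19, st 6 t s]) .skip]

theorem relax_spec {s t : ℕ} (hs : s ≠ 19 ∧ s ≠ 20) (ht : t ≠ 19 ∧ t ≠ 20) (τ : State) :
    ((relax s t).run τ).arr 5 = Function.update (τ.arr 5) (τ.reg t)
      (min (τ.arr 5 (τ.reg t)) (τ.arr 5 (τ.reg s))) ∧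
    ((relax s t).run τ).arr 6 = if τ.arr 5 (τ.reg s) < τ.arr 5 (τ.reg t) then
      Function.update (τ.arr 6) (τ.reg t) (τ.reg s) else τ.arr 6 := by
  by_cases h : τ.arr 5 (τ.reg s) < τ.arr 5 (τ.reg t)
  · simp [relax, block, Code.run, Instr.eval, Test.check, hs, ht, h, min_eq_right h.le]
  · simp [relax, block, Code.run, Instr.eval, Test.check, hs, ht, h, min_eq_left (not_lt.1 h)]

variable {ps : List Code} {k : ℕ} {L : Fin m → List (Fin n × Bool)} {X : Set (Fin n)}

/-- By `hdisj` the sources keep their labels during the pass, so that a sequential scan acts like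
one parallel step. This is why the two directions of the edges are relaxed in separate passes: in a
mixed pass, labels could travel arbitrarily far and chains of parents could become long. -/
theorem runs_relax {s t : ℕ} (hs : s ≠ 19 ∧ s ≠ 20) (ht : t ≠ 19 ∧ t ≠ 20)
    (src dst : Fin m × Fin n × Bool → Fin n ⊕ Fin m)
    (hreg : ∀ (e : Fin m × Fin n × Bool) (τ : State), τ.reg 13 = n + e.1 → τ.reg 16 = e.2.1 →
      τ.reg s = vid (src e) ∧ τ.reg t = vid (dst e))
    (hdisj : ∀ e e', src e ≠ dst e') (hK : ∀ c, (L c).length ≤ k)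
    {l : List (Fin n ⊕ Fin m)} {lo : ℕ} {σ : State} (hE : Env k L X σ) (hC : Cur l lo σ) :
    Runs ps (forEdges 10 11 9 (relax s t)) σ ((k * 15 + 12) * l.length + 3) fun τ =>
      HalfStep ((edges L X l).map fun e => (src e, dst e)) (fun v => σ.arr 5 (vid v))
        (fun v => σ.arr 6 (vid v)) (fun v => τ.arr 5 (vid v)) (fun v => τ.arr 6 (vid v)) ∧
      Frame [12, 13, 14, 15, 16, 17, 18, 19, 20] [5, 6] σ τ := by
  refine (runs_forEdges (body := relax s t) rfl (by simp [relax, block, Code.wregs])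
    (by simp [relax, block, Code.wregs]) (by simp [relax, block, Code.warrs]) hK l
    (fun pre τ => HalfStep (pre.map fun e => (src e, dst e)) (fun v => σ.arr 5 (vid v))
        (fun v => σ.arr 6 (vid v)) (fun v => τ.arr 5 (vid v)) (fun v => τ.arr 6 (vid v)))
    hC.first hC.last hE.vars hE.zero hE.loaded hE.assigned hC.seg ?_ ?_ ?_).mono
      (by simp [relax, block, Code.cost]) fun τ hτ => ⟨hτ.1, hτ.2.mono
        (by simp [relax, block, Code.wregs]) (by simp [relax, block, Code.warrs])⟩
  · intro pre τ τ' h _ ha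
    simpa [ha] using h
  · exact ⟨fun _ => le_rfl, by simp, fun _ => .inl ⟨rfl, rfl⟩⟩
  · intro pre c x b τ he h hF h13 h16 _
    obtain ⟨hs', ht'⟩ := hreg (c, x, b) τ h13 h16
    obtain ⟨h5, h6⟩ := relax_spec hs ht τ
    rw [hs', ht'] at h5 h6
    set e : Fin m × Fin n × Bool := (c, x, b)
    -- A source is never the target of a pair, so its label is still the one from the beginning of
    -- the pass.
    have hsrc : τ.arr 5 (vid (src e)) = σ.arr 5 (vid (src e)) := by
      rcases h.cases (src e) with h' | ⟨p, hp, h', -⟩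
      · exact h'.1
      · obtain ⟨e', -, rfl⟩ := List.mem_map.1 hp
        exact absurd h'.symm (hdisj e e')
    have e5 : ∀ v, ((relax s t).run τ).arr 5 (vid v) = if v = dst e then
        min (τ.arr 5 (vid v)) (σ.arr 5 (vid (src e))) else τ.arr 5 (vid v) := by
      intro v
      rw [h5, Function.update_apply, hsrc]
      simp only [vid_inj]
      split_ifs with hv <;> simp [hv]
    refine ⟨fun v => ?_, fun p hp => ?_, fun v => ?_⟩
    · have := h.le v
      simp only [e5]
      split_ifs <;> omega
    · rw [List.map_append, List.mem_append] at hp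
      simp only [e5]
      rcases hp with hp | hp
      · have := h.relaxed p hp
        split_ifs <;> omega
      · simp only [List.map_cons, List.map_nil, List.mem_singleton] at hp
        subst hp
        simp
    · simp only [e5]
      have hmem : ∀ p ∈ pre.map fun e => (src e, dst e),
          p ∈ (pre ++ [e]).map fun e => (src e, dst e) := fun p hp => by
          rw [List.map_append]; exact List.mem_append_left _ hp
      by_cases hlt : σ.arr 5 (vid (src e)) < τ.arr 5 (vid (dst e))
      · rw [hsrc, if_pos hlt] at h6
        rw [h6, Function.update_apply]
        simp only [vid_inj]
        by_cases hv : v = dst e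
        · subst hv
          have := h.le (dst e)
          refine .inr ⟨(src e, dst e), by simp, rfl, ?_, ?_, ?_⟩
          · simp; omega
          · simp; omega
          · simp
        · simp only [hv, if_false]
          exact (h.cases v).imp_right fun ⟨p, hp, h'⟩ => ⟨p, hmem p hp, h'⟩
      · rw [hsrc, if_neg hlt] at h6
        rw [h6]
        have : (if v = dst e then min (τ.arr 5 (vid v)) (σ.arr 5 (vid (src e)))
            else τ.arr 5 (vid v)) = τ.arr 5 (vid v) := by
          split_ifs with hv
          · subst hv; omega
          · rfl
        rw [this]
        exact (h.cases v).imp_right fun ⟨p, hp, h'⟩ => ⟨p, hmem p hp, h'⟩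

def labelInit : Code := forSeg 10 11 9 (block [st 5 13 13, st 7 13 7])

def labelRound : Code :=
  block [forEdges 10 11 9 (relax 16 13), forEdges 10 11 9 (relax 13 16)]

def labelRounds : Code := block [cst 25 0, .while (.lt 25 9) (block [labelRound, addc 25 25 1])]

def labelCheck : Code :=
  block [cst 24 0, forEdges 10 11 9 (block [ld 19 5 13, ld 20 5 16,
    .ite (.eq 19 20) .skip (cst 24 1)])]

/-- Compute the components of the current graph by propagating the smallest vertex numbers, and
set the register `24` if this has not come to an end. The array `5` contains the labels, the array
`6` the parents; the array `7` is cleared. -/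
def label : Code := block [labelInit, labelRounds, labelCheck]

/-- The heads of the lists of components in the array `7` are reset only on `l`; the other entries
may belong to lists that an outer call still needs. -/
theorem runs_labelInit {l : List (Fin n ⊕ Fin m)} {lo : ℕ} {σ : State}
    (hE : Env k L X σ) (hC : Cur l lo σ) :
    Runs ps labelInit σ (7 * l.length + 3) fun τ =>
      (∀ v ∈ l, τ.arr 5 (vid v) = vid v ∧ τ.arr 7 (vid v) = 0) ∧
      (∀ v ∉ l, τ.arr 7 (vid v) = σ.arr 7 (vid v)) ∧
      Frame [12, 13, 14, 15, 16, 17, 18] [5, 7] σ τ := by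
  refine (runs_forSeg (body := block [st 5 13 13, st 7 13 7]) rfl (by decide) (by decide) l
    (fun pre τ => (∀ v ∈ pre, τ.arr 5 (vid v) = vid v ∧ τ.arr 7 (vid v) = 0) ∧
      (∀ v ∉ pre, τ.arr 7 (vid v) = σ.arr 7 (vid v))) hC.first hC.last ?_ ?_ (by simp) ?_).mono
      (by simp [block, Code.cost]) fun τ hτ => ⟨hτ.1.1, hτ.1.2, hτ.2.mono (by decide) (by decide)⟩
  · intro pre τ τ' h _ ha
    simpa [ha] using h
  · intro pre τ _ hF
    rw [hF.arr 9 (by decide)]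
    exact hC.seg
  · intro pre v post τ _ h hF h13
    have h7 := (hF.reg 7 (by decide)).trans hE.zero
    constructor
    · intro w hw
      by_cases hwv : w = v
      · subst hwv
        simp [block, Code.run, Instr.eval, h13, h7]
      · have hw' : w ∈ pre := by simpa [hwv] using hw
        simpa [block, Code.run, Instr.eval, h13, h7, Function.update_apply, vid_inj, hwv] using
          h.1 w hw'
    · intro w hw
      simp only [List.mem_append, List.mem_singleton, not_or] at hw
      simpa [block, Code.run, Instr.eval, h13, h7, Function.update_apply, vid_inj, hw.2] using
        h.2 w hw.1

variable {G : IncidenceGraph (Fin n) (Fin m)}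

theorem mem_edges_iff (hA : G.IsAdjList L) {l : List (Fin n ⊕ Fin m)} {c : Fin m} {x : Fin n}
    {b : Bool} : (c, x, b) ∈ edges L X l ↔ Sum.inr c ∈ l ∧ G.Edge b x c ∧ x ∉ X := by
  rw [mem_edges, (hA c).2]

theorem restrict_adj_of_mem_edges (hA : G.IsAdjList L) {l : List (Fin n ⊕ Fin m)}
    (hR : G.IsResidual X {v | v ∈ l}) {e : Fin m × Fin n × Bool} (he : e ∈ edges L X l) :
    (G.restrict {v | v ∈ l}).Adj (.inr e.1) (.inl e.2.1) := by
  obtain ⟨c, x, b⟩ := e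
  obtain ⟨h1, h2, h3⟩ := (mem_edges_iff hA).1 he
  exact ⟨h1, hR.closed c x h1 ⟨b, h2⟩ h3, (graph_adj_inr_inl G).2 ⟨b, h2⟩⟩

theorem exists_edge_of_adj (hA : G.IsAdjList L) {l : List (Fin n ⊕ Fin m)}
    (hR : G.IsResidual X {v | v ∈ l}) {c : Fin m} {x : Fin n}
    (h : (G.restrict {v | v ∈ l}).Adj (.inr c) (.inl x)) : ∃ b, (c, x, b) ∈ edges L X l := by
  obtain ⟨h1, h2, h3⟩ := h
  obtain ⟨b, hb⟩ := (graph_adj_inr_inl G).1 h3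
  exact ⟨b, (mem_edges_iff hA).2 ⟨h1, hb, fun h => hR.notMem x h h2⟩⟩

/-- Every round consists of two half steps, whence the chain length `2 * 2 ^ (k + 2)`, while labels
are only guaranteed to travel one edge per round. -/
theorem runs_labelRounds (hA : G.IsAdjList L) (hK : ∀ c, (L c).length ≤ k)
    {l : List (Fin n ⊕ Fin m)} (hR : G.IsResidual X {v | v ∈ l}) {lo : ℕ} {σ : State}
    (hE : Env k L X σ) (hC : Cur l lo σ) (h5 : ∀ v ∈ l, σ.arr 5 (vid v) = vid v) :
    Runs ps labelRounds σ (((k * 30 + 24) * l.length + 10) * 2 ^ (k + 2) + 3) fun τ =>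
      LabelInv {v | v ∈ l} (G.restrict {v | v ∈ l}) (2 * 2 ^ (k + 2))
        (fun v => τ.arr 5 (vid v)) (fun v => τ.arr 6 (vid v)) ∧
      Spread {v | v ∈ l} (G.restrict {v | v ∈ l}) (2 ^ (k + 2)) (fun v => τ.arr 5 (vid v)) ∧
      Frame [12, 13, 14, 15, 16, 17, 18, 19, 20, 25] [5, 6] σ τ := by
  set H := G.restrict {v | v ∈ l} with hH
  have hHS : ∀ u v, H.Adj u v → v ∈ {v | v ∈ l} := fun u v h => h.2.1
  have key : ∀ i r τ, r + i = 2 ^ (k + 2) → τ.reg 25 = r →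
      LabelInv {v | v ∈ l} H (2 * r) (fun v => τ.arr 5 (vid v)) (fun v => τ.arr 6 (vid v)) →
      Spread {v | v ∈ l} H r (fun v => τ.arr 5 (vid v)) →
      Frame [12, 13, 14, 15, 16, 17, 18, 19, 20, 25] [5, 6] σ τ →
      Runs ps (.while (.lt 25 9) (block [labelRound, addc 25 25 1])) τ
        (((k * 30 + 24) * l.length + 10) * i + 1) fun τ =>
      LabelInv {v | v ∈ l} H (2 * 2 ^ (k + 2))
        (fun v => τ.arr 5 (vid v)) (fun v => τ.arr 6 (vid v)) ∧
      Spread {v | v ∈ l} H (2 ^ (k + 2)) (fun v => τ.arr 5 (vid v)) ∧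
      Frame [12, 13, 14, 15, 16, 17, 18, 19, 20, 25] [5, 6] σ τ := by
    intro i
    induction i with
    | zero =>
      intro r τ hr h25 h1 h2 hF
      obtain rfl : r = 2 ^ (k + 2) := by omega
      refine (Runs.while_done ?_ ⟨h1, h2, hF⟩).mono (by omega) fun _ h => h
      simp [Test.Holds, h25, hF.reg 9, hE.rounds]
    | succ i ih =>
      intro r τ hr h25 h1 h2 hF
      have hE1 : Env k L X τ := hE.frame hF (by decide) (by decide)
      have hC1 : Cur l lo τ := hC.frame hF (by decide) (by decide)
      refine (Runs.while_step (T := ((k * 30 + 24) * l.length + 9))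
        (T' := ((k * 30 + 24) * l.length + 10) * i + 1) (P := fun ρ => ρ.reg 25 = r + 1 ∧
          LabelInv {v | v ∈ l} H (2 * (r + 1)) (fun v => ρ.arr 5 (vid v))
            (fun v => ρ.arr 6 (vid v)) ∧
          Spread {v | v ∈ l} H (r + 1) (fun v => ρ.arr 5 (vid v)) ∧
          Frame [12, 13, 14, 15, 16, 17, 18, 19, 20, 25] [5, 6] σ ρ) ?_ ?_
        fun ρ ⟨i1, i2, i3, i4⟩ => ih (r + 1) ρ (by omega) i1 i2 i3 i4).mono ?_ fun _ h => h
      · simp only [Test.Holds, h25, hF.reg 9 (by decide), hE.rounds]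
        omega
      · refine (Runs.block_cons (T := (k * 30 + 24) * l.length + 7) (T' := 2)
          (P := fun ρ => ρ.reg 25 = r ∧
          LabelInv {v | v ∈ l} H (2 * (r + 1)) (fun v => ρ.arr 5 (vid v))
            (fun v => ρ.arr 6 (vid v)) ∧
          Spread {v | v ∈ l} H (r + 1) (fun v => ρ.arr 5 (vid v)) ∧
          Frame [12, 13, 14, 15, 16, 17, 18, 19, 20, 25] [5, 6] σ ρ) ?_
          fun ρ ⟨i1, i2, i3, i4⟩ => Runs.straight (ps := ps) (c := block [addc 25 25 1]) rfl
            ?_).mono (by omega) fun _ h => h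
        · refine (Runs.block_cons (runs_relax (s := 16) (t := 13) (by simp) (by simp)
            (fun e => .inl e.2.1) (fun e => .inr e.1) (by rintro e τ h h'; exact ⟨h', h⟩)
            (by simp) hK hE1 hC1) fun τ₁ ⟨s1, F1⟩ => Runs.block_cons
            (runs_relax (s := 13) (t := 16) (by simp) (by simp)
            (fun e => .inr e.1) (fun e => .inl e.2.1) (by rintro e τ h h'; exact ⟨h, h'⟩)
            (by simp) hK (hE1.frame F1 (by decide) (by decide))
            (hC1.frame F1 (by decide) (by decide))) fun τ₂ ⟨s2, F2⟩ => Runs.block_nil ?_).mono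
            (by ring_nf; omega) fun _ h => h
          have F3 := (F1.trans F2)
          refine ⟨by rw [F3.reg 25 (by decide), h25], ?_, ?_,
            hF.trans (F3.mono (by decide) (by decide))⟩
          · refine (h1.halfStep hHS ?_ s1).halfStep hHS ?_ s2
            · intro p hp
              obtain ⟨e, he, rfl⟩ := List.mem_map.1 hp
              exact restrict_adj_of_mem_edges hA hR he
            · intro p hp
              obtain ⟨e, he, rfl⟩ := List.mem_map.1 hp
              exact (restrict_adj_of_mem_edges hA hR he).symm
          · refine h2.round ?_ s1 s2
            rintro (x | c) (y | d) huv
            · exact absurd huv.2.2 (not_graph_adj_inl_inl G)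
            · obtain ⟨b, hb⟩ := exists_edge_of_adj hA hR huv.symm
              exact .inl (List.mem_map.2 ⟨_, hb, rfl⟩)
            · obtain ⟨b, hb⟩ := exists_edge_of_adj hA hR huv
              exact .inr (List.mem_map.2 ⟨_, hb, rfl⟩)
            · exact absurd huv.2.2 (not_graph_adj_inr_inr G)
        · have hF' := frame_run (c := block [addc 25 25 1]) rfl ρ
          refine ⟨by simp [block, Code.run, Instr.eval, i1], ?_, ?_,
            i4.trans (hF'.mono (by decide) (by decide))⟩
          · exact i2
          · exact i3
      · apply le_of_eq
        ring
  refine (Runs.block_cons (T := 1) (T' := ((k * 30 + 24) * l.length + 10) * 2 ^ (k + 2) + 1 + 1)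
    (P := fun τ => τ.reg 25 = 0 ∧ τ.arr = σ.arr ∧
    Frame [12, 13, 14, 15, 16, 17, 18, 19, 20, 25] [5, 6] σ τ)
    (Runs.straight (c := cst 25 0) rfl ⟨by simp [Code.run, Instr.eval], rfl,
      (frame_run (c := cst 25 0) rfl σ).mono (by decide) (by decide)⟩)
    fun τ ⟨i1, i2, i3⟩ => Runs.block_cons (key (2 ^ (k + 2)) 0 τ (by omega) i1 ?_ ?_ i3)
      fun ρ hρ => Runs.block_nil hρ).mono (by omega) fun _ h => h
  · rw [i2]
    refine ⟨fun u hu => (h5 u hu).le, fun u hu => ⟨u, hu, .refl _, h5 u hu⟩,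
      fun ρ hρ _ u hu h => ?_⟩
    -- Initially only `ρ` itself carries its number, so the array of parents may contain anything.
    obtain rfl : u = ρ := vid_injective ((h5 u hu).symm.trans h)
    exact .root
  · rw [i2]
    intro w hw u p hp
    obtain rfl := SimpleGraph.Walk.eq_of_length_eq_zero (p := p) (by omega)
    exact (h5 _ hw).le

theorem runs_labelCheck (hK : ∀ c, (L c).length ≤ k)
    {l : List (Fin n ⊕ Fin m)} {lo : ℕ} {σ : State} (hE : Env k L X σ) (hC : Cur l lo σ) :
    Runs ps labelCheck σ ((k * 13 + 12) * l.length + 5) fun τ =>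
      (τ.reg 24 = 0 ↔ ∀ e ∈ edges L X l, σ.arr 5 (vid (.inr e.1 : Fin n ⊕ Fin m)) =
        σ.arr 5 (vid (.inl e.2.1 : Fin n ⊕ Fin m))) ∧
      Frame [12, 13, 14, 15, 16, 17, 18, 19, 20, 24] [] σ τ := by
  have F0 := frame_run (c := cst 24 0) rfl σ
  refine (Runs.block_cons (T := 1) (P := fun τ => τ.reg 24 = 0 ∧ Frame [24] [] σ τ)
    (Runs.straight (c := cst 24 0) rfl ⟨by simp [Code.run, Instr.eval], F0⟩) fun τ₁ ⟨h1, F1⟩ =>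
    Runs.block_cons (runs_forEdges (body := block [ld 19 5 13, ld 20 5 16,
      .ite (.eq 19 20) .skip (cst 24 1)]) rfl (by decide) (by decide) (by decide) hK l
      (fun pre τ => τ.reg 24 = 0 ↔ ∀ e ∈ pre, σ.arr 5 (vid (.inr e.1 : Fin n ⊕ Fin m)) =
        σ.arr 5 (vid (.inl e.2.1 : Fin n ⊕ Fin m)))
      (hC.frame F1 (by decide) (by decide)).first (hC.frame F1 (by decide) (by decide)).last
      (hE.frame F1 (by decide) (by decide)).vars (hE.frame F1 (by decide) (by decide)).zero
      (hE.frame F1 (by decide) (by decide)).loaded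
      (hE.frame F1 (by decide) (by decide)).assigned (hC.frame F1 (by decide) (by decide)).seg
      ?_ (by simp [h1]) ?_) fun τ h => Runs.block_nil ⟨h.1, (F1.mono (by decide) (by decide)).trans
        (h.2.mono (by decide) (by decide))⟩).mono (by simp [block, Code.cost]; omega) fun _ h => h
  · intro pre τ τ' h hr _
    rw [hr 24 (by simp)]
    exact h
  · intro pre c x b τ he h hF h13 h16 _
    have a5 : τ.arr 5 = σ.arr 5 := (hF.arr 5 (by decide)).trans (F1.arr 5 (by decide))
    have hv1 : vid (.inr c : Fin n ⊕ Fin m) = n + c := rfl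
    have hv2 : vid (.inl x : Fin n ⊕ Fin m) = x := rfl
    by_cases heq : σ.arr 5 (n + c) = σ.arr 5 x
    · have : ((block [ld 19 5 13, ld 20 5 16,
          .ite (.eq 19 20) .skip (cst 24 1)]).run τ).reg 24 = τ.reg 24 := by
        simp [block, Code.run, Instr.eval, Test.check, h13, h16, a5, heq]
      rw [this, h]
      simp [hv1, hv2, heq, or_imp, forall_and]
    · have : ((block [ld 19 5 13, ld 20 5 16,
          .ite (.eq 19 20) .skip (cst 24 1)]).run τ).reg 24 = 1 := by
        simp [block, Code.run, Instr.eval, Test.check, h13, h16, a5, heq]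
      rw [this]
      simp only [one_ne_zero, false_iff]
      exact fun h => heq (h (c, x, b) (by simp))

/-- If the final check finds no edge with different labels, the labels are stable. Otherwise `2 ^ (k
+ 2)` rounds were too few, so some distance is larger than that, and this forces a depth greater
than `k`. -/
theorem runs_label (hA : G.IsAdjList L) (hK : ∀ c, (L c).length ≤ k)
    {l : List (Fin n ⊕ Fin m)} (hR : G.IsResidual X {v | v ∈ l}) {lo : ℕ} {σ : State}
    (hE : Env k L X σ) (hC : Cur l lo σ) :
    Runs ps label σ (60 * ((k + 1) * 2 ^ (k + 2) * (l.length + 1))) fun τ =>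
      (τ.reg 24 = 0 → StableLabels {v | v ∈ l} (G.restrict {v | v ∈ l}) (2 * 2 ^ (k + 2))
        (fun v => τ.arr 5 (vid v)) (fun v => τ.arr 6 (vid v))) ∧
      (τ.reg 24 ≠ 0 → (k : ℕ∞) < G.srbd G.edgeless) ∧
      (∀ v ∈ l, τ.arr 7 (vid v) = 0) ∧ (∀ v ∉ l, τ.arr 7 (vid v) = σ.arr 7 (vid v)) ∧
      Frame [12, 13, 14, 15, 16, 17, 18, 19, 20, 24, 25] [5, 6, 7] σ τ := by
  refine (Runs.block_cons (runs_labelInit hE hC) fun τ₁ ⟨h1, h2, F1⟩ =>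
    Runs.block_cons (runs_labelRounds hA hK hR (hE.frame F1 (by decide) (by decide))
      (hC.frame F1 (by decide) (by decide)) fun v hv => (h1 v hv).1) fun τ₂ ⟨h3, h4, F2⟩ =>
    Runs.block_cons (runs_labelCheck hK ((hE.frame F1 (by decide) (by decide)).frame F2
      (by decide) (by decide)) ((hC.frame F1 (by decide) (by decide)).frame F2
      (by decide) (by decide))) fun τ₃ ⟨h5, F3⟩ => Runs.block_nil ?_).mono ?_ fun _ h => h
  · have e5 : τ₃.arr 5 = τ₂.arr 5 := F3.arr 5 (by decide)
    have e6 : τ₃.arr 6 = τ₂.arr 6 := F3.arr 6 (by decide)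
    have e7 : τ₃.arr 7 = τ₁.arr 7 := (F3.arr 7 (by decide)).trans (F2.arr 7 (by decide))
    rw [e5, e6, e7]
    refine ⟨fun h => ?_, fun h => ?_, fun v hv => (h1 v hv).2, h2,
      ((F1.mono (by decide) (by decide)).trans (F2.mono (by decide) (by decide))).trans
        (F3.mono (by decide) (by decide))⟩
    · refine h3.stable (fun u v h => h.2.1) ?_
      have h6 := h5.1 h
      rintro (x | c) (y | d) huv
      · exact absurd huv.2.2 (not_graph_adj_inl_inl G)
      · obtain ⟨b, hb⟩ := exists_edge_of_adj hA hR huv.symm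
        exact (h6 _ hb).symm
      · obtain ⟨b, hb⟩ := exists_edge_of_adj hA hR huv
        exact h6 _ hb
      · exact absurd huv.2.2 (not_graph_adj_inr_inr G)
    · rw [Ne, h5] at h
      push Not at h
      obtain ⟨e, he, hne⟩ := h
      have hadj := restrict_adj_of_mem_edges hA hR he
      obtain ⟨w, hw, u, h7, h8⟩ := h3.exists_dist h4 hadj.1 hadj.2.1 hadj hne
      exact lt_srbd_of_dist hR hw h7 h8
  · have h1 : 1 ≤ 2 ^ (k + 2) := Nat.one_le_two_pow
    generalize 2 ^ (k + 2) = D at *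
    generalize l.length = N at *
    obtain ⟨D, rfl⟩ : ∃ i, D = i + 1 := ⟨D - 1, by omega⟩
    ring_nf
    omega

end RAM

/-! ### Codes of trees -/

namespace RAM

open IncidenceGraph BackdoorTree

variable {n m : ℕ}

/-- The number of a variable. -/
def varOf : Fin n ⊕ Fin m → Option ℕ
  | .inl x => some x
  | .inr _ => none

/-- The number of a clause. -/
def clauseOf : Fin n ⊕ Fin m → Option ℕ
  | .inl _ => none
  | .inr c => some c

/-- The code of the label of a component node, preceded by `0`. -/
def header (l : List (Fin n ⊕ Fin m)) : List ℕ :=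
  [0] ++ ((l.filterMap varOf).length :: l.filterMap varOf) ++
    ((l.filterMap clauseOf).length :: l.filterMap clauseOf)

theorem filterMap_varOf (l : List (Fin n ⊕ Fin m)) :
    l.filterMap varOf = (l.filterMap Sum.getLeft?).map Fin.val := by
  induction l with
  | nil => rfl
  | cons v l ih => rcases v with x | c <;> simp [varOf, List.filterMap_cons, ih]

theorem filterMap_clauseOf (l : List (Fin n ⊕ Fin m)) :
    l.filterMap clauseOf = (l.filterMap Sum.getRight?).map Fin.val := by
  induction l with
  | nil => rfl
  | cons v l ih => rcases v with x | c <;> simp [clauseOf, List.filterMap_cons, ih]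

theorem isCode_subgraph {l : List (Fin n ⊕ Fin m)} (hl : l.Nodup)
    {ts : List (BackdoorTree (Fin n) (Fin m))} {w : List ℕ} (h : IsForestCode ts w) :
    IsCode (node (.subgraph {v | v ∈ l}) ts) (header l ++ [ts.length] ++ w) := by
  have h1 : (l.filterMap Sum.getLeft?).Nodup := hl.filterMap fun a b c ha hb => by
    rcases a with a | a <;> rcases b with b | b <;> simp_all
  have h2 : (l.filterMap Sum.getRight?).Nodup := hl.filterMap fun a b c ha hb => by
    rcases a with a | a <;> rcases b with b | b <;> simp_all
  have := IsCode.subgraph (S := {v | v ∈ l}) h1 h2 (by simp) (by simp) h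
  simpa [header, filterMap_varOf, filterMap_clauseOf] using this

/-- The word `w` codes a strong recursive backdoor of the subgraph induced by `S`, of depth at
most `δ`. -/
def HasTree (G : IncidenceGraph (Fin n) (Fin m)) (S : Set (Fin n ⊕ Fin m)) (δ : ℕ) (w : List ℕ) :
    Prop :=
  ∃ B, IsSRB G G.edgeless S B ∧ B.depth ≤ δ ∧ IsCode B w

variable {G : IncidenceGraph (Fin n) (Fin m)} {l : List (Fin n ⊕ Fin m)} {δ : ℕ}

theorem HasTree.mono {S : Set (Fin n ⊕ Fin m)} {δ' : ℕ} {w : List ℕ} (h : HasTree G S δ w)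
    (hδ : δ ≤ δ') : HasTree G S δ' w := by
  obtain ⟨B, h1, h2, h3⟩ := h
  exact ⟨B, h1, h2.trans hδ, h3⟩

theorem hasTree_leaf (hl : l.Nodup) (h : {v | v ∈ l} ∈ G.edgeless) (δ : ℕ) :
    HasTree G {v | v ∈ l} δ (header l ++ [0]) :=
  ⟨_, .leaf h, by simp [depth, maxDepth], by simpa using isCode_subgraph hl .nil⟩

theorem hasTree_branch (hl : l.Nodup) (hconn : G.IsConn {v | v ∈ l}) {x : Fin n}
    (hx : Sum.inl x ∈ l) {w₁ w₂ : List ℕ} (h₁ : HasTree G (G.assign {v | v ∈ l} x true) δ w₁)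
    (h₂ : HasTree G (G.assign {v | v ∈ l} x false) δ w₂) :
    HasTree G {v | v ∈ l} (δ + 1) (header l ++ [1] ++ [1, x.val, 2] ++ w₁ ++ w₂) := by
  obtain ⟨B₁, i1, i2, i3⟩ := h₁
  obtain ⟨B₂, j1, j2, j3⟩ := h₂
  refine ⟨_, .branch hconn hx i1 j1, by simp [depth, maxDepth]; omega, ?_⟩
  have hf : IsForestCode [node (.var x) [B₁, B₂]]
      (([1] ++ [x.val] ++ [[B₁, B₂].length] ++ (w₁ ++ (w₂ ++ []))) ++ []) :=
    .cons (.var (.cons i3 (.cons j3 .nil))) .nil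
  simpa using isCode_subgraph hl hf

/-- The trees exist separately for each component; the induction on `Forall₂` chooses them all
together with the code of the forest. -/
theorem hasTree_split (hl : l.Nodup) (hconn : ¬ G.IsConn {v | v ∈ l})
    {Ks : List (Set (Fin n ⊕ Fin m))} {ws : List (List ℕ)} (hnd : Ks.Nodup)
    (hcomp : ∀ K, K ∈ Ks ↔ G.IsComponent {v | v ∈ l} K)
    (h : List.Forall₂ (fun K w => HasTree G K δ w) Ks ws) :
    HasTree G {v | v ∈ l} δ (header l ++ [Ks.length] ++ ws.flatten) := by
  have key : ∃ Bs : List (BackdoorTree (Fin n) (Fin m)),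
      List.Forall₂ (fun K B => IsSRB G G.edgeless K B ∧ B.depth ≤ δ) Ks Bs ∧
      IsForestCode Bs ws.flatten := by
    clear hnd hcomp
    induction h with
    | nil => exact ⟨[], .nil, .nil⟩
    | cons h _ ih =>
      obtain ⟨Bs, h1, h2⟩ := ih
      obtain ⟨B, h3, h4, h5⟩ := h
      exact ⟨B :: Bs, .cons ⟨h3, h4⟩ h1, .cons h5 h2⟩
  obtain ⟨Bs, h1, h2⟩ := key
  refine ⟨node (.subgraph {v | v ∈ l}) Bs, .split hconn hnd hcomp h1.length_eq.symm
    fun i hK hB => (h1.get hK hB).1, ?_, ?_⟩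
  · rw [depth, maxDepth_le_iff]
    intro B hB
    obtain ⟨i, hi, rfl⟩ := List.getElem_of_mem hB
    exact (h1.get (by rw [h1.length_eq]; exact hi) hi).2
  · rw [h1.length_eq]
    exact isCode_subgraph hl h2

/-! ### Writing to the output -/

/-- The word `w` has been appended to the output. -/
structure Wrote (w : List ℕ) (σ τ : State) : Prop where
  pos : τ.reg 3 = σ.reg 3 + w.length
  seg : Seg (τ.arr 3) (σ.reg 3) w
  below : ∀ i < σ.reg 3, τ.arr 3 i = σ.arr 3 i

theorem Wrote.trans {v w : List ℕ} {σ τ ρ : State} (h : Wrote v σ τ) (h' : Wrote w τ ρ) :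
    Wrote (v ++ w) σ ρ := by
  refine ⟨by rw [h'.pos, h.pos, List.length_append, add_assoc], seg_append.2 ⟨?_, ?_⟩,
    fun i hi => ?_⟩
  · exact h.seg.congr fun i _ hi => h'.below i (by rw [h.pos]; exact hi)
  · rw [← h.pos]; exact h'.seg
  · rw [h'.below i (by rw [h.pos]; omega), h.below i hi]

theorem Wrote.congr {w : List ℕ} {σ τ τ' : State} (h : Wrote w σ τ) (h3 : τ'.reg 3 = τ.reg 3)
    (ha : τ'.arr 3 = τ.arr 3) : Wrote w σ τ' :=
  ⟨h3.trans h.pos, by rw [ha]; exact h.seg, by rw [ha]; exact h.below⟩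

theorem Wrote.congr_left {w : List ℕ} {σ σ' τ : State} (h : Wrote w σ τ) (h3 : σ'.reg 3 = σ.reg 3)
    (ha : σ'.arr 3 = σ.arr 3) : Wrote w σ' τ :=
  ⟨by rw [h.pos, h3], by rw [h3]; exact h.seg, by rw [h3, ha]; exact h.below⟩

/-- Append the register `r` to the output. -/
def emit (r : ℕ) : Code := block [st 3 3 r, addc 3 3 1]

variable {ps : List Code}

theorem runs_emit {r : ℕ} {σ : State} :
    Runs ps (emit r) σ 3 fun τ => Wrote [σ.reg r] σ τ ∧ Frame [3] [3] σ τ := by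
  refine Runs.straight (c := emit r) rfl ⟨⟨?_, ?_, ?_⟩, (frame_run (c := emit r) rfl σ).mono
    (by simp [emit, block, Code.wregs]) (by simp [emit, block, Code.warrs])⟩
  · simp [emit, block, Code.run, Instr.eval]
  · simp [emit, block, Code.run, Instr.eval, Seg]
  · intro i hi
    simp [emit, block, Code.run, Instr.eval, Function.update_of_ne hi.ne]

/-- The length precedes the entries but is known only after the scan, so a cell is reserved for it
and filled at the end. -/
def emitSel (body : Code) : Code :=
  block [block [addc 31 3 0, addc 3 3 1, cst 26 0], forSeg 10 11 9 body, st 3 31 26]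

theorem runs_emitSel {body : Code} (sel : Fin n ⊕ Fin m → Option ℕ) (hb : body.straight = true)
    (hw : body.wregs ⊆ [3, 19, 26]) (ha : body.warrs ⊆ [3])
    (h₁ : ∀ τ v, τ.reg 13 = vid v → τ.reg 1 = n → sel v = none → (body.run τ).reg 3 = τ.reg 3 ∧
      (body.run τ).reg 26 = τ.reg 26 ∧ (body.run τ).arr 3 = τ.arr 3)
    (h₂ : ∀ τ v a, τ.reg 13 = vid v → τ.reg 1 = n → sel v = some a →
      (body.run τ).reg 3 = τ.reg 3 + 1 ∧ (body.run τ).reg 26 = τ.reg 26 + 1 ∧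
      (body.run τ).arr 3 = Function.update (τ.arr 3) (τ.reg 3) a)
    {lo : ℕ} {σ : State} (hn : σ.reg 1 = n) (hC : Cur l lo σ) :
    Runs ps (emitSel body) σ ((body.cost + 4) * l.length + 9) fun τ =>
      Wrote ((l.filterMap sel).length :: l.filterMap sel) σ τ ∧
      Frame [3, 12, 13, 14, 15, 16, 17, 18, 19, 26, 31] [3] σ τ := by
  have hnw : ∀ r, r ∉ [3, 19, 26] → r ∉ body.wregs := fun r hr h => hr (hw h)
  have F0 := frame_run (c := block [addc 31 3 0, addc 3 3 1, cst 26 0]) rfl σ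
  have hlf : ∀ {τ τ'}, LoopFrame body τ τ' → Frame [3, 12, 13, 14, 15, 16, 17, 18, 19, 26, 31] [3]
      τ τ' := by
    intro τ τ' h
    refine h.mono ?_ ha
    refine List.append_subset.2 ⟨by decide, fun r hr => ?_⟩
    have := hw hr
    simp at this ⊢
    omega
  refine (Runs.block_cons (T := 4) (P := fun τ => τ.reg 31 = σ.reg 3 ∧ τ.reg 3 = σ.reg 3 + 1 ∧
      τ.reg 26 = 0 ∧ τ.arr 3 = σ.arr 3 ∧ Frame [3, 26, 31] [] σ τ)
    (Runs.straight (c := block [addc 31 3 0, addc 3 3 1, cst 26 0]) rfl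
      ⟨by simp [block, Code.run, Instr.eval], by simp [block, Code.run, Instr.eval],
        by simp [block, Code.run, Instr.eval], rfl, F0.mono (by decide) (by decide)⟩)
    fun τ₁ ⟨i31, i3, i26, ia, F1⟩ => Runs.block_cons (runs_forSeg hb (hnw _ (by decide))
      (by simp [hnw]) l (fun pre τ => τ.reg 3 = σ.reg 3 + 1 + (pre.filterMap sel).length ∧
        τ.reg 26 = (pre.filterMap sel).length ∧
        Seg (τ.arr 3) (σ.reg 3 + 1) (pre.filterMap sel) ∧
        ∀ i < σ.reg 3, τ.arr 3 i = σ.arr 3 i)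
      (hC.frame F1 (by decide) (by decide)).first (hC.frame F1 (by decide) (by decide)).last
      ?_ ?_ ?_ ?_) fun τ₂ ⟨⟨j3, j26, jseg, jb⟩, F2⟩ => Runs.straight (ps := ps)
        (c := block [st 3 31 26]) rfl
        (?_ : Wrote ((l.filterMap sel).length :: l.filterMap sel) σ _ ∧ _)).mono
        (by simp [block, Code.cost]; omega) fun _ h => h
  · intro pre τ τ' h hr ha
    rw [hr 3 (by simp), hr 26 (by simp), ha]
    exact h
  · intro pre τ _ hF
    rw [(hlf hF).arr 9 (by decide)]
    exact (hC.frame F1 (by decide) (by decide)).seg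
  · simp [i3, i26, ia, seg_nil]
  · intro pre v post τ _ ⟨j3, j26, jseg, jb⟩ hF h13
    have hn' : τ.reg 1 = n := by
      rw [hF.reg 1 (by simp [hnw]), F1.reg 1 (by decide), hn]
    rcases hv : sel v with _ | a
    · obtain ⟨k3, k26, ka⟩ := h₁ τ v h13 hn' hv
      simp only [List.filterMap_append, List.filterMap_cons, hv, List.filterMap_nil,
        List.append_nil, k3, k26, ka]
      exact ⟨j3, j26, jseg, jb⟩
    · obtain ⟨k3, k26, ka⟩ := h₂ τ v a h13 hn' hv
      simp only [List.filterMap_append, List.filterMap_cons, hv, List.filterMap_nil,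
        List.length_append, List.length_singleton, k3, k26, ka]
      refine ⟨by omega, by omega, jseg.push j3, fun i hi => ?_⟩
      rw [Function.update_of_ne (by omega), jb i hi]
  · have e31 : τ₂.reg 31 = σ.reg 3 := by rw [F2.reg 31 (by simp [hnw]), i31]
    have e3 : ((block [st 3 31 26]).run τ₂).arr 3 = Function.update (τ₂.arr 3) (σ.reg 3)
        (l.filterMap sel).length := by
      simp [block, Code.run, Instr.eval, e31, j26]
    refine ⟨⟨?_, ?_, ?_⟩, ((F1.mono (by decide) (by decide)).trans (hlf F2)).trans
      ((frame_run (c := block [st 3 31 26]) rfl τ₂).mono (by decide) (by decide))⟩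
    · simp [block, Code.run, Instr.eval, j3]; omega
    · rw [e3, seg_cons]
      exact ⟨by simp, jseg.congr fun i hi _ => Function.update_of_ne (by omega) _ _⟩
    · intro i hi
      rw [e3, Function.update_of_ne (by omega), jb i hi]

def emitVarBody : Code :=
  .ite (.lt 13 1) (block [st 3 3 13, addc 3 3 1, addc 26 26 1]) .skip

def emitClauseBody : Code :=
  .ite (.lt 13 1) .skip (block [sb 19 13 1, st 3 3 19, addc 3 3 1, addc 26 26 1])

/-- Append the header of the current graph to the output. -/
def emitHeader : Code := block [emit 7, emitSel emitVarBody, emitSel emitClauseBody]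

theorem runs_emitHeader {k : ℕ} {L : Fin m → List (Fin n × Bool)} {X : Set (Fin n)} {lo : ℕ}
    {σ : State} (hE : Env k L X σ) (hC : Cur l lo σ) :
    Runs ps emitHeader σ (21 * l.length + 22) fun τ => Wrote (header l) σ τ ∧
      Frame [3, 12, 13, 14, 15, 16, 17, 18, 19, 26, 31] [3] σ τ := by
  refine (Runs.block_cons runs_emit fun τ₁ ⟨w1, F1⟩ => Runs.block_cons
    (runs_emitSel (body := emitVarBody) varOf rfl (by decide) (by decide) ?_ ?_
      (hE.frame F1 (by decide) (by decide)).vars (hC.frame F1 (by decide) (by decide)))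
    fun τ₂ ⟨w2, F2⟩ => Runs.block_cons
    (runs_emitSel (body := emitClauseBody) clauseOf rfl (by decide) (by decide) ?_ ?_
      ((hE.frame F1 (by decide) (by decide)).frame F2 (by decide) (by decide)).vars
      ((hC.frame F1 (by decide) (by decide)).frame F2 (by decide) (by decide)))
    fun τ₃ ⟨w3, F3⟩ => Runs.block_nil ⟨?_, ?_⟩).mono
      (by simp [emitVarBody, emitClauseBody, block, Code.cost]; omega) fun _ h => h
  · rintro τ (x | c) h13 h1 hv
    · simp [varOf] at hv
    · have : ¬ τ.reg 13 < τ.reg 1 := by rw [h13, h1]; simp [vid]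
      simp [emitVarBody, Code.run, Test.check, this]
  · rintro τ (x | c) a h13 h1 hv
    · have : τ.reg 13 < τ.reg 1 := by rw [h13, h1]; exact x.2
      simp only [varOf, Option.some.injEq] at hv
      subst hv
      simp only [emitVarBody, Code.run, Test.check, this, decide_true, cond_true, block]
      simp [Instr.eval, h13, vid]
    · simp [varOf] at hv
  · rintro τ (x | c) h13 h1 hv
    · have : τ.reg 13 < τ.reg 1 := by rw [h13, h1]; exact x.2
      simp [emitClauseBody, Code.run, Test.check, this]
    · simp [clauseOf] at hv
  · rintro τ (x | c) a h13 h1 hv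
    · simp [clauseOf] at hv
    · have : ¬ τ.reg 13 < τ.reg 1 := by rw [h13, h1]; simp [vid]
      simp only [clauseOf, Option.some.injEq] at hv
      subst hv
      simp only [emitClauseBody, Code.run, Test.check, this, decide_false, cond_false, block]
      simp [Instr.eval, h13, h1, vid]
  · have := (w1.trans w2).trans w3
    rwa [hE.zero] at this
  · exact ((F1.mono (by decide) (by decide)).trans F2).trans F3

end RAM

/-! ### Further subroutines -/

namespace RAM

open IncidenceGraph

variable {n m : ℕ} {ps : List Code} {k : ℕ} {L : Fin m → List (Fin n × Bool)} {X : Set (Fin n)}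
  {G : IncidenceGraph (Fin n) (Fin m)} {l : List (Fin n ⊕ Fin m)} {lo : ℕ} {σ : State}

/-- Set the register `24` to the number of a clause with an edge, and to `0` if there is none. -/
def findEdge : Code := block [cst 24 0, forEdges 10 11 9 (addc 24 13 0)]

theorem runs_findEdge (hK : ∀ c, (L c).length ≤ k) (hE : Env k L X σ) (hC : Cur l lo σ) :
    Runs ps findEdge σ ((k * 9 + 12) * l.length + 5) fun τ =>
      ((τ.reg 24 = 0 ∧ edges L X l = []) ∨
        ∃ e ∈ edges L X l, τ.reg 24 = n + e.1 ∧ τ.reg 24 ≠ 0) ∧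
      Frame [12, 13, 14, 15, 16, 17, 18, 24] [] σ τ := by
  refine (Runs.block_cons (T := 1) (P := fun τ => τ.reg 24 = 0 ∧ Frame [24] [] σ τ)
    (Runs.straight (c := cst 24 0) rfl ⟨by simp [Code.run, Instr.eval],
      frame_run (c := cst 24 0) rfl σ⟩) fun τ₁ ⟨h1, F1⟩ =>
    Runs.block_cons (runs_forEdges (body := addc 24 13 0) rfl (by decide) (by decide) (by decide)
      hK l (fun pre τ => (τ.reg 24 = 0 ∧ pre = []) ∨
        ∃ e ∈ edges L X l, τ.reg 24 = n + e.1 ∧ τ.reg 24 ≠ 0)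
      (hC.frame F1 (by decide) (by decide)).first (hC.frame F1 (by decide) (by decide)).last
      (hE.frame F1 (by decide) (by decide)).vars (hE.frame F1 (by decide) (by decide)).zero
      (hE.frame F1 (by decide) (by decide)).loaded
      (hE.frame F1 (by decide) (by decide)).assigned (hC.frame F1 (by decide) (by decide)).seg
      ?_ (by simp [h1]) ?_) fun τ h => Runs.block_nil ⟨h.1, (F1.mono (by decide) (by decide)).trans
        (h.2.mono (by decide) (by decide))⟩).mono (by simp [Code.cost]; omega) fun _ h => h
  · intro pre τ τ' h hr _
    rw [hr 24 (by simp)]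
    exact h
  · intro pre c x b τ he _ _ h13 h16 _
    have h : ((addc 24 13 0).run τ).reg 24 = n + c := by simp [Code.run, Instr.eval, h13]
    refine .inr ⟨_, he, h, ?_⟩
    -- The existence of a variable makes `n` positive; hence the number of a clause with an edge is
    -- never `0`, and `0` can signal that there is none.
    have := x.pos
    omega

/-- Set the register `24` to `1` if the vertex in the register `22` belongs to the current graph,
and to `0` otherwise. -/
def isMember : Code := block [cst 24 0, forSeg 10 11 9 (.ite (.eq 13 22) (cst 24 1) .skip)]

theorem runs_isMember (hC : Cur l lo σ) {v : Fin n ⊕ Fin m} (hv : σ.reg 22 = vid v) :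
    Runs ps isMember σ (6 * l.length + 5) fun τ =>
      (v ∈ l → τ.reg 24 = 1) ∧ (v ∉ l → τ.reg 24 = 0) ∧
      Frame [12, 13, 14, 15, 16, 17, 18, 24] [] σ τ := by
  refine (Runs.block_cons (T := 1) (P := fun τ => τ.reg 24 = 0 ∧ Frame [24] [] σ τ)
    (Runs.straight (c := cst 24 0) rfl ⟨by simp [Code.run, Instr.eval],
      frame_run (c := cst 24 0) rfl σ⟩) fun τ₁ ⟨h1, F1⟩ =>
    Runs.block_cons (runs_forSeg (body := .ite (.eq 13 22) (cst 24 1) .skip) rfl (by decide)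
      (by decide) l (fun pre τ => (v ∈ pre → τ.reg 24 = 1) ∧ (v ∉ pre → τ.reg 24 = 0))
      (hC.frame F1 (by decide) (by decide)).first (hC.frame F1 (by decide) (by decide)).last
      ?_ ?_ (by simp [h1]) ?_) fun τ h => Runs.block_nil ⟨h.1.1, h.1.2,
        (F1.mono (by decide) (by decide)).trans
        (h.2.mono (by decide) (by decide))⟩).mono (by simp [Code.cost]; omega) fun _ h => h
  · intro pre τ τ' h hr _
    rw [hr 24 (by simp)]
    exact h
  · intro pre τ _ hF
    rw [hF.arr 9 (by decide)]
    exact (hC.frame F1 (by decide) (by decide)).seg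
  · intro pre w post τ _ h hF h13
    have h22 : τ.reg 22 = vid v := by
      rw [hF.reg 22 (by decide), F1.reg 22 (by decide), hv]
    by_cases hvw : v = w
    · subst hvw
      simp [Code.run, Test.check, h13, h22, Instr.eval]
    · have : ¬ vid w = vid v := fun h => hvw (vid_injective h.symm)
      simpa [Code.run, Test.check, h13, h22, Instr.eval, this, hvw] using h

/-! #### Assigning a variable -/

/-- The array `12` is scratch memory in which `1` will mark the vertices that survive an assignment.
At first all clauses are marked and no variables. -/
def markInit : Code := forSeg 10 11 9 (.ite (.lt 13 1) (st 12 13 7) (st 12 13 8))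

/-- The polarity of the current literal is read from the input at the position in the register `14`;
clauses that contain the satisfied literal lose their mark. -/
def markSatisfied : Code :=
  forEdges 10 11 9 (.ite (.eq 16 22) (block [ld 19 2 14, .ite (.eq 19 23) (st 12 13 7) .skip])
    .skip)

/-- Variables are kept only if they occur in a clause that is kept, so their marks are derived from
those of the clauses. -/
def markOccurring : Code :=
  forEdges 10 11 9 (block [ld 19 12 13, .ite (.eq 19 8) (st 12 16 8) .skip])

def pushMarked : Code :=
  block [addc 27 11 0, forSeg 10 11 9 (block [ld 19 12 13,
    .ite (.eq 19 8) (block [st 9 27 13, addc 27 27 1]) .skip])]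

/-- Push the vertices that remain when the variable in the register `22` is set to the value in
the register `23`. -/
def assignVar : Code := block [markInit, markSatisfied, st 4 22 8, markOccurring, pushMarked]

theorem runs_markInit (hE : Env k L X σ) (hC : Cur l lo σ) :
    Runs ps markInit σ (6 * l.length + 3) fun τ =>
      (∀ y, Sum.inl y ∈ l → τ.arr 12 y = 0) ∧ (∀ c, Sum.inr c ∈ l → τ.arr 12 (n + c) = 1) ∧
      Frame [12, 13, 14, 15, 16, 17, 18] [12] σ τ := by
  refine (runs_forSeg (body := .ite (.lt 13 1) (st 12 13 7) (st 12 13 8)) rfl (by decide)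
    (by decide) l (fun pre τ => ∀ v ∈ pre, τ.arr 12 (vid v) = if vid v < n then 0 else 1)
    hC.first hC.last ?_ ?_ (by simp) ?_).mono (by simp [Code.cost]) fun τ h =>
      ⟨fun y hy => ?_, fun c hc => ?_, h.2.mono (by decide) (by decide)⟩
  · intro pre τ τ' h _ ha
    simpa [ha] using h
  · intro pre τ _ hF
    rw [hF.arr 9 (by decide)]
    exact hC.seg
  · intro pre v post τ _ h hF h13
    have h1 := (hF.reg 1 (by decide)).trans hE.vars
    have h7 := (hF.reg 7 (by decide)).trans hE.zero
    have h8 := (hF.reg 8 (by decide)).trans hE.one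
    have key : ((Code.ite (.lt 13 1) (st 12 13 7) (st 12 13 8)).run τ).arr 12 =
        Function.update (τ.arr 12) (vid v) (if vid v < n then 0 else 1) := by
      by_cases hv : vid v < n <;> simp [Code.run, Test.check, Instr.eval, h13, h1, h7, h8, hv]
    intro w hw
    rw [key]
    by_cases hwv : w = v
    · simp [hwv]
    · rw [Function.update_of_ne (by simpa [vid_inj] using hwv)]
      exact h w (by simpa [hwv] using hw)
  · have := h.1 _ hy
    simpa [vid] using this
  · have := h.1 _ hc
    simpa [vid] using this

theorem runs_markSatisfied (hK : ∀ c, (L c).length ≤ k) (hE : Env k L X σ) (hC : Cur l lo σ)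
    {x : Fin n} {s : Bool} (hx : σ.reg 22 = x) (hs : σ.reg 23 = s.toNat)
    (h₁ : ∀ y, Sum.inl y ∈ l → σ.arr 12 y = 0) (h₂ : ∀ c, Sum.inr c ∈ l → σ.arr 12 (n + c) = 1) :
    Runs ps markSatisfied σ ((k * 13 + 12) * l.length + 3) fun τ =>
      (∀ y, Sum.inl y ∈ l → τ.arr 12 y = 0) ∧
      (∀ c, Sum.inr c ∈ l → τ.arr 12 (n + c) = if (c, x, s) ∈ edges L X l then 0 else 1) ∧
      Frame [12, 13, 14, 15, 16, 17, 18, 19] [12] σ τ := by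
  set body : Code := .ite (.eq 16 22) (block [ld 19 2 14, .ite (.eq 19 23) (st 12 13 7) .skip])
    .skip with hbody
  refine (runs_forEdges (body := body) rfl (by decide) (by decide) (by decide) hK l
    (fun pre τ => (∀ y, Sum.inl y ∈ l → τ.arr 12 y = 0) ∧
      (∀ c, Sum.inr c ∈ l → τ.arr 12 (n + c) = if (c, x, s) ∈ pre then 0 else 1))
    hC.first hC.last hE.vars hE.zero hE.loaded hE.assigned hC.seg ?_ ?_ ?_).mono
      (by simp [hbody, block, Code.cost]) fun τ h =>
      ⟨h.1.1, h.1.2, h.2.mono (by decide) (by decide)⟩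
  · intro pre τ τ' h _ ha
    simpa [ha] using h
  · exact ⟨h₁, by simpa using h₂⟩
  · intro pre c y b τ _ h hF h13 h16 hb
    have h7 := (hF.reg 7 (by decide)).trans hE.zero
    have h22 := (hF.reg 22 (by decide)).trans hx
    have h23 := (hF.reg 23 (by decide)).trans hs
    have h2 := hF.arr 2 (by decide)
    have key : (body.run τ).arr 12 = if y = x ∧ b = s then Function.update (τ.arr 12) (n + c) 0
        else τ.arr 12 := by
      by_cases hyx : y = x
      · subst hyx
        have hbs : b.toNat = s.toNat ↔ b = s := by cases b <;> cases s <;> simp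
        by_cases h' : b = s <;>
          simp [hbody, block, Code.run, Test.check, Instr.eval, h13, h16, h7, h22, h23, h2, hb,
            hbs, h']
      · have hyx' : ¬ (y : ℕ) = x := fun h => hyx (Fin.ext h)
        simp [hbody, block, Code.run, Test.check, h16, h22, hyx, hyx']
    rw [key]
    split_ifs with hcase
    · obtain ⟨rfl, rfl⟩ := hcase
      refine ⟨fun z hz => ?_, fun d hd => ?_⟩
      · rw [Function.update_of_ne (by omega)]
        exact h.1 z hz
      · by_cases hdc : d = c
        · simp [hdc]
        · rw [Function.update_of_ne (by have := Fin.val_ne_of_ne hdc; omega), h.2 d hd]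
          simp [hdc]
    · refine ⟨h.1, fun d hd => ?_⟩
      rw [h.2 d hd]
      have : (d, x, s) ≠ (c, y, b) := by
        rintro h
        simp only [Prod.mk.injEq] at h
        exact hcase ⟨h.2.1.symm, h.2.2.symm⟩
      simp [this]

/-- Here `D` stands for the satisfied clauses. The marks of the clauses are not disturbed, because
variables have numbers below `n`. -/
theorem runs_markOccurring (hK : ∀ c, (L c).length ≤ k) (hE : Env k L X σ) (hC : Cur l lo σ)
    {D : Set (Fin m)} [DecidablePred (· ∈ D)] (h₁ : ∀ y, Sum.inl y ∈ l → σ.arr 12 y = 0)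
    (h₂ : ∀ c, Sum.inr c ∈ l → σ.arr 12 (n + c) = if c ∈ D then 0 else 1) :
    Runs ps markOccurring σ ((k * 12 + 12) * l.length + 3) fun τ =>
      (∀ y, Sum.inl y ∈ l → (τ.arr 12 y = 1 ↔ ∃ e ∈ edges L X l, e.1 ∉ D ∧ e.2.1 = y)) ∧
      (∀ c, Sum.inr c ∈ l → τ.arr 12 (n + c) = if c ∈ D then 0 else 1) ∧
      Frame [12, 13, 14, 15, 16, 17, 18, 19] [12] σ τ := by
  set body : Code := block [ld 19 12 13, .ite (.eq 19 8) (st 12 16 8) .skip] with hbody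
  refine (runs_forEdges (body := body) rfl (by decide) (by decide) (by decide) hK l
    (fun pre τ => (∀ y, Sum.inl y ∈ l → (τ.arr 12 y = 1 ↔ ∃ e ∈ pre, e.1 ∉ D ∧ e.2.1 = y)) ∧
      (∀ c, Sum.inr c ∈ l → τ.arr 12 (n + c) = if c ∈ D then 0 else 1))
    hC.first hC.last hE.vars hE.zero hE.loaded hE.assigned hC.seg ?_ ?_ ?_).mono
      (by simp [hbody, block, Code.cost]) fun τ h =>
      ⟨h.1.1, h.1.2, h.2.mono (by decide) (by decide)⟩
  · intro pre τ τ' h _ ha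
    simpa [ha] using h
  · exact ⟨fun y hy => by simp [h₁ y hy], h₂⟩
  · intro pre c y b τ he h hF h13 h16 hb
    have h8 := (hF.reg 8 (by decide)).trans hE.one
    have hc : τ.arr 12 (n + c) = if c ∈ D then 0 else 1 := h.2 c (mem_edges.1 he).1
    have key : (body.run τ).arr 12 = if c ∈ D then τ.arr 12 else
        Function.update (τ.arr 12) y 1 := by
      by_cases hD : c ∈ D <;>
        simp [hbody, block, Code.run, Test.check, Instr.eval, h13, h16, h8, hc, hD]
    rw [key]
    split_ifs with hD
    · refine ⟨fun z hz => ?_, h.2⟩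
      rw [h.1 z hz]
      simp [or_and_right, exists_or, hD]
    · refine ⟨fun z hz => ?_, fun d hd => ?_⟩
      · by_cases hzy : z = y
        · subst hzy
          simp only [Function.update_self, true_iff]
          exact ⟨(c, z, b), by simp, hD, rfl⟩
        · rw [Function.update_of_ne (by have := Fin.val_ne_of_ne hzy; omega), h.1 z hz]
          have : ¬ y = z := fun h => hzy h.symm
          constructor
          · rintro ⟨e, he, h'⟩
            exact ⟨e, by simp [he], h'⟩
          · rintro ⟨e, he, h', rfl⟩
            rw [List.mem_append, List.mem_singleton] at he
            rcases he with he | rfl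
            · exact ⟨e, he, h', rfl⟩
            · exact absurd rfl hzy
      · rw [Function.update_of_ne (by omega)]
        exact h.2 d hd

/-- The new list is written directly behind the current one in the same array, so the scanned part
stays intact. -/
theorem runs_pushMarked (hE : Env k L X σ) (hC : Cur l lo σ) (p : Fin n ⊕ Fin m → Bool)
    (hp : ∀ v ∈ l, σ.arr 12 (vid v) = 1 ↔ p v = true) :
    Runs ps pushMarked σ (10 * l.length + 5) fun τ =>
      τ.reg 27 = lo + l.length + (l.filter p).length ∧
      Seg (τ.arr 9) (lo + l.length) ((l.filter p).map vid) ∧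
      (∀ i < lo + l.length, τ.arr 9 i = σ.arr 9 i) ∧
      Frame [12, 13, 14, 15, 16, 17, 18, 19, 27] [9] σ τ := by
  set body : Code := block [ld 19 12 13,
    .ite (.eq 19 8) (block [st 9 27 13, addc 27 27 1]) .skip] with hbody
  refine (Runs.block_cons (T := 1) (P := fun τ => τ.reg 27 = lo + l.length ∧ Frame [27] [] σ τ)
    (Runs.straight (c := addc 27 11 0) rfl ⟨by simp [Code.run, Instr.eval, hC.last],
      frame_run (c := addc 27 11 0) rfl σ⟩) fun τ₁ ⟨h1, F1⟩ =>
    Runs.block_cons (runs_forSeg (body := body) rfl (by decide) (by decide) l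
      (fun pre τ => τ.reg 27 = lo + l.length + (pre.filter p).length ∧
      Seg (τ.arr 9) (lo + l.length) ((pre.filter p).map vid) ∧
      ∀ i < lo + l.length, τ.arr 9 i = σ.arr 9 i)
      (hC.frame F1 (by decide) (by decide)).first (hC.frame F1 (by decide) (by decide)).last
      ?_ ?_ ?_ ?_) fun τ h => Runs.block_nil ⟨h.1.1, h.1.2.1, h.1.2.2,
        (F1.mono (by decide) (by decide)).trans
        (h.2.mono (by decide) (by decide))⟩).mono (by simp [hbody, block, Code.cost]; omega)
        fun _ h => h
  · intro pre τ τ' h hr ha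
    rw [hr 27 (by simp), ha]
    exact h
  · intro pre τ h _
    exact hC.seg.congr fun i _ hi => h.2.2 i (by simpa using hi)
  · exact ⟨by simp [h1], by simp [seg_nil], fun i _ => by rw [F1.arr 9 (by decide)]⟩
  · intro pre v post τ hl ⟨i1, i2, i3⟩ hF h13
    have h8 := ((hF.reg 8 (by decide)).trans (F1.reg 8 (by decide))).trans hE.one
    have h12 : τ.arr 12 = σ.arr 12 := (hF.arr 12 (by decide)).trans (F1.arr 12 (by decide))
    have hv := hp v (by simp [hl])
    cases hpv : p v
    · have : ¬ σ.arr 12 (vid v) = 1 := by rw [hv, hpv]; simp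
      have k1 : body.run τ = Instr.eval (.load 19 12 13) τ := by
        simp [hbody, block, Code.run, Test.check, Instr.eval, h13, h8, h12, this]
      simp only [k1, List.filter_append, List.filter_cons, hpv, List.filter_nil]
      simpa [Instr.eval] using ⟨i1, i2, i3⟩
    · have : σ.arr 12 (vid v) = 1 := hv.2 hpv
      have k1 : (body.run τ).reg 27 = τ.reg 27 + 1 := by
        simp [hbody, block, Code.run, Test.check, Instr.eval, h13, h8, h12, this]
      have k2 : (body.run τ).arr 9 = Function.update (τ.arr 9) (τ.reg 27) (vid v) := by
        simp [hbody, block, Code.run, Test.check, Instr.eval, h13, h8, h12, this]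
      simp only [k1, k2, List.filter_append, List.filter_cons, hpv, List.filter_nil, if_true,
        List.map_append, List.map_cons, List.map_nil, List.length_append, List.length_singleton]
      refine ⟨by omega, i2.push (by simpa using i1), fun i hi => ?_⟩
      rw [Function.update_of_ne (by omega), i3 i hi]

open Classical in
/-- The vertices that remain in a list when `x` is set to `s`. -/
noncomputable def assignList (G : IncidenceGraph (Fin n) (Fin m)) (l : List (Fin n ⊕ Fin m))
    (x : Fin n) (s : Bool) : List (Fin n ⊕ Fin m) :=
  l.filter fun v => v ∈ G.assign {v | v ∈ l} x s

theorem setOf_mem_assignList (x : Fin n) (s : Bool) :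
    {v | v ∈ assignList G l x s} = G.assign {v | v ∈ l} x s := by
  ext v
  simp only [assignList, List.mem_filter, decide_eq_true_eq, Set.mem_ofPred_eq,
    and_iff_right_iff_imp]
  exact fun h => h.1

/-- The chosen value `s` itself witnesses that `x` is safe, since all clauses with the literal `x_s`
are gone. A variable of a remaining clause is kept because it occurs there. -/
theorem isResidual_assign {S : Set (Fin n ⊕ Fin m)} (hR : G.IsResidual X S) (x : Fin n)
    (s : Bool) : G.IsResidual (insert x X) (G.assign S x s) := by
  refine ⟨?_, ?_, ?_⟩
  · rintro y (rfl | hy) h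
    · exact h.2.1 rfl
    · exact hR.notMem y hy h.1
  · intro c y hc hyc hy
    rw [Set.mem_insert_iff, not_or] at hy
    obtain ⟨t, ht⟩ := hyc
    exact ⟨hR.closed c y hc.1 ⟨t, ht⟩ hy.2, hy.1, t, c, hc.1, hc.2, ht⟩
  · rintro y (rfl | hy)
    · exact ⟨s, fun c hc => hc.2⟩
    · obtain ⟨t, ht⟩ := hR.safe y hy
      exact ⟨t, fun c hc => ht c hc.1⟩

/-- The order of the passes matters. The satisfied clauses are found while `x` still counts as
unassigned, so that its edges are visited. The occurring variables are marked after `x` has been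
entered in the array `4`, so that `x` is not marked again. -/
theorem runs_assignVar (hA : G.IsAdjList L) (hK : ∀ c, (L c).length ≤ k)
    (hR : G.IsResidual X {v | v ∈ l}) (hE : Env k L X σ) (hC : Cur l lo σ)
    {x : Fin n} {s : Bool} (hx : σ.reg 22 = x) (hs : σ.reg 23 = s.toNat) (hxl : Sum.inl x ∈ l) :
    Runs ps assignVar σ (60 * ((k + 1) * (l.length + 1))) fun τ =>
      τ.reg 27 = lo + l.length + (assignList G l x s).length ∧
      Seg (τ.arr 9) (lo + l.length) ((assignList G l x s).map vid) ∧
      (∀ i < lo + l.length, τ.arr 9 i = σ.arr 9 i) ∧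
      τ.arr 4 = Function.update (σ.arr 4) x 1 ∧
      Env k L (insert x X) τ ∧
      Frame [12, 13, 14, 15, 16, 17, 18, 19, 27] [4, 9, 12] σ τ := by
  classical
  have hxX : x ∉ X := fun h => hR.notMem x h hxl
  refine (Runs.block_cons (runs_markInit hE hC) fun τ₁ ⟨a1, a2, F1⟩ => Runs.block_cons
    (runs_markSatisfied hK (hE.frame F1 (by decide) (by decide))
      (hC.frame F1 (by decide) (by decide)) (x := x) (s := s)
      ((F1.reg 22 (by decide)).trans hx) ((F1.reg 23 (by decide)).trans hs) a1 a2)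
    fun τ₂ ⟨b1, b2, F2⟩ => Runs.block_cons (T := 1)
    (P := fun τ => (∀ y, Sum.inl y ∈ l → τ.arr 12 y = 0) ∧
      (∀ c, Sum.inr c ∈ l → τ.arr 12 (n + c) = if c ∈ {c | (c, x, s) ∈ edges L X l} then 0 else 1) ∧
      τ.arr 4 = Function.update (σ.arr 4) x 1 ∧ Env k L (insert x X) τ ∧ Cur l lo τ ∧
      Frame [12, 13, 14, 15, 16, 17, 18, 19] [4, 12] σ τ)
    (Runs.straight (c := st 4 22 8) rfl ?_) fun τ₃ ⟨c1, c2, c3, E3, C3, F3⟩ =>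
    Runs.block_cons (runs_markOccurring hK E3 C3 c1 c2) fun τ₄ ⟨d1, d2, F4⟩ => Runs.block_cons
    (runs_pushMarked (E3.frame F4 (by decide) (by decide)) (C3.frame F4 (by decide) (by decide))
      (fun v => v ∈ G.assign {v | v ∈ l} x s) ?_) fun τ₅ ⟨e1, e2, e3, F5⟩ => Runs.block_nil
    ⟨e1, e2, ?_, ?_, ?_, ?_⟩).mono ?_ fun _ h => h
  · have F12 := (F1.mono (R' := [12, 13, 14, 15, 16, 17, 18, 19]) (A' := [12]) (by decide)
      (by decide)).trans F2
    have h22 := (F12.reg 22 (by decide)).trans hx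
    have h8 := (F12.reg 8 (by decide)).trans hE.one
    have e4 : ((st 4 22 8).run τ₂).arr 4 = Function.update (σ.arr 4) x 1 := by
      simp [Code.run, Instr.eval, h22, h8, F12.arr 4]
    have e12 : ((st 4 22 8).run τ₂).arr 12 = τ₂.arr 12 := by simp [Code.run, Instr.eval]
    have F3 := frame_run (c := st 4 22 8) rfl τ₂
    have F : Frame [12, 13, 14, 15, 16, 17, 18, 19] [4, 12] σ ((st 4 22 8).run τ₂) :=
      (F12.mono (by decide) (by decide)).trans (F3.mono (by decide) (by decide))
    refine ⟨by rw [e12]; exact b1, by rw [e12]; exact b2, e4, ?_,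
      hC.frame F (by decide) (by decide), F⟩
    have hE2 := hE.frame F12 (by decide) (by decide)
    refine ⟨hE2.vars, hE2.zero, hE2.one, hE2.rounds, ⟨?_, ?_, ?_⟩, fun y => ?_⟩
    · rw [F3.arr 0 (by decide)]; exact hE2.loaded.off
    · rw [F3.arr 0 (by decide), F3.arr 1 (by decide)]; exact hE2.loaded.var
    · rw [F3.arr 0 (by decide), F3.arr 2 (by decide)]; exact hE2.loaded.pol
    · rw [e4]
      by_cases hyx : y = x
      · simp [hyx]
      · rw [Function.update_of_ne (by simpa [Fin.ext_iff] using hyx), hE.assigned]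
        simp [hyx]
  · have hD : ∀ c, Sum.inr c ∈ l → ((c, x, s) ∈ edges L X l ↔ G.Edge s x c) := fun c hc => by
      rw [mem_edges_iff hA]; simp [hc, hxX]
    rintro (y | c) hv
    · simp only [vid, decide_eq_true_eq]
      rw [d1 y hv]
      constructor
      · rintro ⟨⟨c, y, t⟩, he, hc, rfl⟩
        obtain ⟨h1, h2, h3⟩ := (mem_edges_iff hA).1 he
        rw [Set.mem_insert_iff, not_or] at h3
        exact ⟨hv, h3.1, t, c, h1, fun h => hc ((hD c h1).2 h), h2⟩
      · rintro ⟨-, hyx, t, c, h1, h2, h3⟩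
        refine ⟨(c, y, t), (mem_edges_iff hA).2 ⟨h1, h3, ?_⟩, fun h => h2 ((hD c h1).1 h), rfl⟩
        rintro (h | h)
        · exact hyx h
        · exact hR.notMem y h hv
    · simp only [vid, decide_eq_true_eq]
      rw [d2 c hv]
      have : Sum.inr c ∈ G.assign {v | v ∈ l} x s ↔ ¬ G.Edge s x c :=
        ⟨fun h => h.2, fun h => ⟨hv, h⟩⟩
      rw [this, ← hD c hv]
      by_cases h : (c, x, s) ∈ edges L X l <;> simp [h]
  · generalize l.length = N at *
    ring_nf
    omega
  · intro i hi
    rw [e3 i hi, F4.arr 9 (by decide), F3.arr 9 (by decide)]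
  · rw [F5.arr 4 (by decide), F4.arr 4 (by decide), c3]
  · exact (E3.frame F4 (by decide) (by decide)).frame F5 (by decide) (by decide)
  · refine Frame.trans (τ := τ₄) (Frame.trans (τ := τ₃) (F3.mono ?_ ?_) (F4.mono ?_ ?_))
      (F5.mono ?_ ?_) <;> decide

/-! #### Lists of components -/

/-- `w` is the linked list with successors `next` that starts at the code `a`
(`0` for the end of the list, `u + 1` for the element `u`). -/
inductive Chain (next : ℕ → ℕ) : ℕ → List ℕ → Prop
  | nil : Chain next 0 []
  | cons {u w} (h : Chain next (next u) w) : Chain next (u + 1) (u :: w)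

theorem Chain.congr {next next' : ℕ → ℕ} {a : ℕ} {w : List ℕ} (h : Chain next a w)
    (h' : ∀ u ∈ w, next' u = next u) : Chain next' a w := by
  induction h with
  | nil => exact .nil
  | @cons u w _ ih =>
    refine .cons ?_
    rw [h' u (by simp)]
    exact ih fun v hv => h' v (by simp [hv])

/-- Link the vertices of every component, and push the roots. -/
def linkComponents : Code :=
  block [addc 27 11 0, forSeg 10 11 9 (block [ld 19 5 13, ld 20 7 19, st 8 13 20, addc 20 13 1,
    st 7 19 20, .ite (.eq 19 13) (block [st 9 27 13, addc 27 27 1]) .skip])]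

/-- Every vertex is prepended to the list of its root, which explains the reversed order. This takes
linear time for all components together, and only the entries of vertices in `l` are changed. -/
theorem runs_linkComponents (hC : Cur l lo σ) (hl : l.Nodup)
    (hroot : ∀ v ∈ l, ∃ ρ ∈ l, σ.arr 5 (vid v) = vid ρ) (h7 : ∀ v ∈ l, σ.arr 7 (vid v) = 0) :
    Runs ps linkComponents σ (14 * l.length + 5) fun τ =>
      (∀ ρ ∈ l, Chain (τ.arr 8) (τ.arr 7 (vid ρ))
        ((l.filter fun v => σ.arr 5 (vid v) = vid ρ).reverse.map vid)) ∧
      τ.reg 27 = lo + l.length + (l.filter fun v => σ.arr 5 (vid v) = vid v).length ∧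
      Seg (τ.arr 9) (lo + l.length) ((l.filter fun v => σ.arr 5 (vid v) = vid v).map vid) ∧
      (∀ i < lo + l.length, τ.arr 9 i = σ.arr 9 i) ∧
      (∀ v ∉ l, τ.arr 7 (vid v) = σ.arr 7 (vid v) ∧ τ.arr 8 (vid v) = σ.arr 8 (vid v)) ∧
      Frame [12, 13, 14, 15, 16, 17, 18, 19, 20, 27] [7, 8, 9] σ τ := by
  set body : Code := block [ld 19 5 13, ld 20 7 19, st 8 13 20, addc 20 13 1,
    st 7 19 20, .ite (.eq 19 13) (block [st 9 27 13, addc 27 27 1]) .skip] with hbody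
  refine (Runs.block_cons (T := 1) (P := fun τ => τ.reg 27 = lo + l.length ∧ Frame [27] [] σ τ)
    (Runs.straight (c := addc 27 11 0) rfl ⟨by simp [Code.run, Instr.eval, hC.last],
      frame_run (c := addc 27 11 0) rfl σ⟩) fun τ₁ ⟨h1, F1⟩ =>
    Runs.block_cons (runs_forSeg (body := body) rfl (by decide) (by decide) l
      (fun pre τ => (∀ ρ ∈ l, Chain (τ.arr 8) (τ.arr 7 (vid ρ))
        ((pre.filter fun v => σ.arr 5 (vid v) = vid ρ).reverse.map vid)) ∧
      τ.reg 27 = lo + l.length + (pre.filter fun v => σ.arr 5 (vid v) = vid v).length ∧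
      Seg (τ.arr 9) (lo + l.length) ((pre.filter fun v => σ.arr 5 (vid v) = vid v).map vid) ∧
      (∀ i < lo + l.length, τ.arr 9 i = σ.arr 9 i) ∧
      (∀ v ∉ l, τ.arr 7 (vid v) = σ.arr 7 (vid v) ∧ τ.arr 8 (vid v) = σ.arr 8 (vid v)))
      (hC.frame F1 (by decide) (by decide)).first (hC.frame F1 (by decide) (by decide)).last
      ?_ ?_ ?_ ?_) fun τ ⟨⟨i1, i2, i3, i4, i5⟩, F2⟩ => Runs.block_nil ⟨i1, i2, i3, i4, i5,
        (F1.mono (by decide) (by decide)).trans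
        (F2.mono (by decide) (by decide))⟩).mono (by simp [hbody, block, Code.cost]; omega)
        fun _ h => h
  · intro pre τ τ' h hr ha
    simp only [hr 27 (by simp), ha]
    exact h
  · intro pre τ h _
    exact hC.seg.congr fun i _ hi => h.2.2.2.1 i (by simpa using hi)
  · refine ⟨fun ρ hρ => ?_, by simp [h1], by simp [seg_nil], fun i _ => by
      rw [F1.arr 9 (by decide)], fun v _ => by rw [F1.arr 7 (by decide), F1.arr 8 (by decide)]; simp⟩
    rw [F1.arr 7 (by decide), h7 ρ hρ]
    exact .nil
  · intro pre v post τ hlv ⟨i1, i2, i3, i4, i5⟩ hF h13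
    have h5 : τ.arr 5 = σ.arr 5 := (hF.arr 5 (by decide)).trans (F1.arr 5 (by decide))
    have hv : v ∈ l := by simp [hlv]
    -- If `v` had been inserted before, overwriting its successor would destroy a list.
    have hvpre : v ∉ pre := by
      rw [hlv] at hl
      exact fun h => (List.nodup_append.1 hl).2.2 v h v (by simp) rfl
    obtain ⟨ρ₀, hρ₀, hfv⟩ := hroot v hv
    have k8 : (body.run τ).arr 8 = Function.update (τ.arr 8) (vid v) (τ.arr 7 (vid ρ₀)) := by
      by_cases h : vid ρ₀ = vid v <;>
        simp [hbody, block, Code.run, Test.check, Instr.eval, h13, h5, hfv, h]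
    have k7 : (body.run τ).arr 7 = Function.update (τ.arr 7) (vid ρ₀) (vid v + 1) := by
      by_cases h : vid ρ₀ = vid v <;>
        simp [hbody, block, Code.run, Test.check, Instr.eval, h13, h5, hfv, h]
    rw [k8, k7]
    refine ⟨fun ρ hρ => ?_, ?_⟩
    · have hch : ∀ ρ ∈ l, Chain (Function.update (τ.arr 8) (vid v) (τ.arr 7 (vid ρ₀)))
          (τ.arr 7 (vid ρ)) ((pre.filter fun v => σ.arr 5 (vid v) = vid ρ).reverse.map vid) :=
        fun ρ hρ => (i1 ρ hρ).congr fun u hu => by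
          simp only [List.mem_map, List.mem_reverse, List.mem_filter] at hu
          obtain ⟨w, hw, rfl⟩ := hu
          refine Function.update_of_ne (fun h => hvpre ?_) _ _
          rw [vid_inj] at h
          rw [← h]; exact hw.1
      by_cases hρ' : ρ = ρ₀
      · subst hρ'
        simp only [Function.update_self, List.filter_append, List.filter_cons, hfv, decide_true,
          if_true, List.filter_nil, List.reverse_append, List.reverse_singleton,
          List.singleton_append, List.map_cons]
        refine .cons ?_
        rw [Function.update_self]
        exact hch ρ hρ
      · have hne : ¬ vid ρ₀ = vid ρ := fun h => hρ' (vid_injective h.symm)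
        rw [Function.update_of_ne fun h => hne h.symm]
        simp only [List.filter_append, List.filter_cons, hfv, hne, decide_false, List.filter_nil]
        simpa using hch ρ hρ
    · have hout : ∀ w ∉ l, Function.update (τ.arr 7) (vid ρ₀) (vid v + 1) (vid w) =
          σ.arr 7 (vid w) ∧ Function.update (τ.arr 8) (vid v) (τ.arr 7 (vid ρ₀)) (vid w) =
          σ.arr 8 (vid w) := fun w hw => by
        rw [Function.update_of_ne, Function.update_of_ne]
        · exact i5 w hw
        · rw [Ne, vid_inj]; rintro rfl; exact hw hv
        · rw [Ne, vid_inj]; rintro rfl; exact hw hρ₀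
      by_cases h : vid ρ₀ = vid v
      · have k27 : (body.run τ).reg 27 = τ.reg 27 + 1 := by
          simp [hbody, block, Code.run, Test.check, Instr.eval, h13, h5, hfv, h]
        have k9 : (body.run τ).arr 9 = Function.update (τ.arr 9) (τ.reg 27) (vid v) := by
          simp [hbody, block, Code.run, Test.check, Instr.eval, h13, h5, hfv, h]
        simp only [k27, k9, List.filter_append, List.filter_cons, hfv, h, decide_true, if_true,
          List.filter_nil, List.map_append, List.map_cons, List.map_nil, List.length_append,
          List.length_singleton]
        refine ⟨by omega, i3.push (by simpa using i2), fun i hi => ?_, by rw [h] at hout; exact hout⟩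
        rw [Function.update_of_ne (by omega), i4 i hi]
      · have k27 : (body.run τ).reg 27 = τ.reg 27 := by
          simp [hbody, block, Code.run, Test.check, Instr.eval, h13, h5, hfv, h]
        have k9 : (body.run τ).arr 9 = τ.arr 9 := by
          simp [hbody, block, Code.run, Test.check, Instr.eval, h13, h5, hfv, h]
        simp only [k27, k9, List.filter_append, List.filter_cons, hfv, h, decide_false,
          List.filter_nil]
        exact ⟨by simpa using i2, by simpa using i3, i4, hout⟩

/-- Push the linked list that starts at the code in the register `20`. -/
def pushChain : Code :=
  .while (.lt 7 20) (block [sb 13 20 8, st 9 27 13, addc 27 27 1, ld 20 8 13])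

theorem runs_pushChain {w : List ℕ} : ∀ {σ : State} {a t : ℕ}, σ.reg 7 = 0 → σ.reg 8 = 1 →
    σ.reg 20 = a → σ.reg 27 = t → Chain (σ.arr 8) a w →
    Runs ps pushChain σ (6 * w.length + 1) fun τ =>
      τ.reg 27 = t + w.length ∧ Seg (τ.arr 9) t w ∧ (∀ i < t, τ.arr 9 i = σ.arr 9 i) ∧
      Frame [13, 20, 27] [9] σ τ := by
  induction w with
  | nil =>
    intro σ a t h7 h8 h20 h27 h
    cases h
    exact Runs.while_done (by simp [Test.Holds, h7, h20])
      ⟨by simp [h27], seg_nil _ _, fun _ _ => rfl, .refl _ _ _⟩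
  | cons u w ih =>
    intro σ a t h7 h8 h20 h27 h
    cases h with
    | cons h =>
    set body : Code := block [sb 13 20 8, st 9 27 13, addc 27 27 1, ld 20 8 13] with hbody
    have F := frame_run (c := body) rfl σ
    have k20 : (body.run σ).reg 20 = σ.arr 8 u := by
      simp [hbody, block, Code.run, Instr.eval, h20, h8]
    have k27 : (body.run σ).reg 27 = t + 1 := by
      simp [hbody, block, Code.run, Instr.eval, h27]
    have k9 : (body.run σ).arr 9 = Function.update (σ.arr 9) t u := by
      simp [hbody, block, Code.run, Instr.eval, h20, h8, h27]
    refine (Runs.while_step (T := 5) (T' := 6 * w.length + 1) (P := fun τ => τ = body.run σ)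
      (by simp [Test.Holds, h7, h20]) (Runs.straight (c := body) rfl rfl) ?_).mono
      (by simp; omega) fun _ h => h
    rintro _ rfl
    refine (ih ((F.reg 7 (by decide)).trans h7) ((F.reg 8 (by decide)).trans h8) k20 k27
      (by rw [F.arr 8 (by decide)]; exact h)).mono le_rfl fun τ ⟨j1, j2, j3, j4⟩ =>
      ⟨by rw [j1, List.length_cons]; omega, seg_cons.2 ⟨?_, j2⟩, fun i hi => ?_,
        (F.mono (by decide) (by decide)).trans j4⟩
    · rw [j3 t (by omega), k9, Function.update_self]
    · rw [j3 i (by omega), k9, Function.update_of_ne (by omega)]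

/-! #### Obstructions -/

/-- Push the variables of the clauses in the array `11` from the position in the register `34` on
to the position in the register `29` of the array `10` and the positions after that. -/
def pushNeighbours : Code :=
  block [addc 27 29 0, forEdges 34 4 11 (block [st 10 27 16, addc 27 27 1])]

/-- A variable is pushed once for every edge and may be repeated. This is harmless, since a pending
variable that is no longer in the graph is skipped. -/
theorem runs_pushNeighbours (hK : ∀ c, (L c).length ≤ k) (hE : Env k L X σ) {O : List (Fin m)}
    {b yh : ℕ} (h34 : σ.reg 34 = b) (h4 : σ.reg 4 = b + O.length) (h29 : σ.reg 29 = yh)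
    (hO : Seg (σ.arr 11) b (O.map fun c : Fin m => n + (c : ℕ))) :
    Runs ps pushNeighbours σ ((k * 11 + 12) * O.length + 5) fun τ =>
      τ.reg 27 = yh + (edges L X (O.map .inr)).length ∧
      Seg (τ.arr 10) yh ((edges L X (O.map .inr)).map fun e => (e.2.1 : ℕ)) ∧
      (∀ i < yh, τ.arr 10 i = σ.arr 10 i) ∧
      Frame [12, 13, 14, 15, 16, 17, 18, 27] [10] σ τ := by
  set body : Code := block [st 10 27 16, addc 27 27 1] with hbody
  refine (Runs.block_cons (T := 1) (P := fun τ => τ.reg 27 = yh ∧ Frame [27] [] σ τ)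
    (Runs.straight (c := addc 27 29 0) rfl ⟨by simp [Code.run, Instr.eval, h29],
      frame_run (c := addc 27 29 0) rfl σ⟩) fun τ₁ ⟨h1, F1⟩ =>
    Runs.block_cons (runs_forEdges (body := body) rfl (by decide) (by decide) (by decide)
      hK (O.map Sum.inr) (fun pre τ => τ.reg 27 = yh + pre.length ∧
        Seg (τ.arr 10) yh (pre.map fun e => (e.2.1 : ℕ)) ∧ ∀ i < yh, τ.arr 10 i = σ.arr 10 i)
      ((F1.reg 34 (by decide)).trans h34) (by simpa using (F1.reg 4 (by decide)).trans h4)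
      (hE.frame F1 (by decide) (by decide)).vars (hE.frame F1 (by decide) (by decide)).zero
      (hE.frame F1 (by decide) (by decide)).loaded
      (hE.frame F1 (by decide) (by decide)).assigned
      (by rw [F1.arr 11 (by decide), List.map_map]; exact hO)
      ?_ ?_ ?_) fun τ h => Runs.block_nil ⟨h.1.1, h.1.2.1, h.1.2.2,
        (F1.mono (by decide) (by decide)).trans (h.2.mono (by decide) (by decide))⟩).mono
        (by simp [hbody, block, Code.cost]; omega) fun _ h => h
  · intro pre τ τ' h hr ha
    rw [hr 27 (by simp), ha]
    exact h
  · exact ⟨by simp [h1], by simp [seg_nil], fun i _ => by rw [F1.arr 10 (by decide)]⟩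
  · intro pre c x b τ _ ⟨i1, i2, i3⟩ hF h13 h16 _
    have k27 : (body.run τ).reg 27 = τ.reg 27 + 1 := by
      simp [hbody, block, Code.run, Instr.eval]
    have k10 : (body.run τ).arr 10 = Function.update (τ.arr 10) (τ.reg 27) x := by
      simp [hbody, block, Code.run, Instr.eval, h16]
    rw [k27, k10, List.map_append]
    refine ⟨by simp; omega, i2.push (by simpa using i1), fun i hi => ?_⟩
    rw [Function.update_of_ne (by omega), i3 i hi]

/-- Push the clauses on the path of parents from the vertex in the register `13` to the root. -/
def pushPath : Code :=
  block [ld 19 5 13, .while (.lt 19 13) (block [ld 13 6 13,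
    .ite (.lt 13 1) .skip (block [st 11 4 13, addc 4 4 1]), ld 19 5 13])]

/-- Only the clauses on the path are pushed: its variables outside `X` belong to the span of the
neighbouring clauses. The starting vertex is omitted, as it will be in the obstruction already.
Connectivity is claimed for every `O` that contains the path, because the final obstruction is
composed only later. -/
theorem runs_pushPath (hR : G.IsResidual X {v | v ∈ l}) {f g : Fin n ⊕ Fin m → ℕ}
    {ρ : Fin n ⊕ Fin m} (hfρ : f ρ = vid ρ) (hle : ∀ u ∈ l, f u ≤ vid u) {t : ℕ}
    {u : Fin n ⊕ Fin m} (hu : u ∈ l) (hch : ParChain (G.restrict {v | v ∈ l}) f g ρ t u)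
    (hE : Env k L X σ) (hf : ∀ v, σ.arr 5 (vid v) = f v) (hg : ∀ v, σ.arr 6 (vid v) = g v)
    (h13 : σ.reg 13 = vid u) :
    Runs ps pushPath σ (8 * t + 3) fun τ => ∃ P : List (Fin m),
      P.length ≤ t ∧ τ.reg 4 = σ.reg 4 + P.length ∧
      Seg (τ.arr 11) (σ.reg 4) (P.map fun c : Fin m => n + (c : ℕ)) ∧
      (∀ i < σ.reg 4, τ.arr 11 i = σ.arr 11 i) ∧ (∀ c ∈ P, Sum.inr c ∈ l) ∧
      (∀ O : Set (Fin m), (∀ c ∈ P, c ∈ O) → u ∈ G.span O X →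
        (G.restrict (G.span O X)).Reachable u ρ ∧
        ∀ c ∈ P, (G.restrict (G.span O X)).Reachable u (.inr c)) ∧
      Frame [4, 13, 19] [11] σ τ := by
  set body : Code := block [ld 13 6 13,
    .ite (.lt 13 1) .skip (block [st 11 4 13, addc 4 4 1]), ld 19 5 13] with hbody
  have key : ∀ {t : ℕ} {u : Fin n ⊕ Fin m}, ParChain (G.restrict {v | v ∈ l}) f g ρ t u → u ∈ l →
      ∀ τ : State, Frame [4, 13, 19] [11] σ τ → τ.reg 13 = vid u → τ.reg 19 = f u →
      Runs ps (.while (.lt 19 13) body) τ (8 * t + 1) fun τ' => ∃ P : List (Fin m),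
        P.length ≤ t ∧ τ'.reg 4 = τ.reg 4 + P.length ∧
        Seg (τ'.arr 11) (τ.reg 4) (P.map fun c : Fin m => n + (c : ℕ)) ∧
        (∀ i < τ.reg 4, τ'.arr 11 i = τ.arr 11 i) ∧ (∀ c ∈ P, Sum.inr c ∈ l) ∧
        (∀ O : Set (Fin m), (∀ c ∈ P, c ∈ O) → u ∈ G.span O X →
          (G.restrict (G.span O X)).Reachable u ρ ∧
          ∀ c ∈ P, (G.restrict (G.span O X)).Reachable u (.inr c)) ∧
        Frame [4, 13, 19] [11] σ τ' := by
    have hroot : ∀ {t : ℕ} (τ : State), Frame [4, 13, 19] [11] σ τ → τ.reg 13 = vid ρ →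
        τ.reg 19 = f ρ → Runs ps (.while (.lt 19 13) body) τ (8 * t + 1) fun τ' =>
        ∃ P : List (Fin m),
        P.length ≤ t ∧ τ'.reg 4 = τ.reg 4 + P.length ∧
        Seg (τ'.arr 11) (τ.reg 4) (P.map fun c : Fin m => n + (c : ℕ)) ∧
        (∀ i < τ.reg 4, τ'.arr 11 i = τ.arr 11 i) ∧ (∀ c ∈ P, Sum.inr c ∈ l) ∧
        (∀ O : Set (Fin m), (∀ c ∈ P, c ∈ O) → ρ ∈ G.span O X →
          (G.restrict (G.span O X)).Reachable ρ ρ ∧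
          ∀ c ∈ P, (G.restrict (G.span O X)).Reachable ρ (.inr c)) ∧
        Frame [4, 13, 19] [11] σ τ' := by
      intro t τ F k13 k19
      refine (Runs.while_done ?_ ⟨[], by simp, by simp, by simp [seg_nil], by simp, by simp,
        fun _ _ _ => ⟨.refl _, by simp⟩, F⟩).mono (by omega) fun _ h => h
      simp [Test.Holds, k13, k19, hfρ]
    intro t u hch
    induction hch with
    | root => exact fun _ => hroot
    | @step t u w hfu hadj hgu hc ih =>
      intro hu τ F k13 k19
      by_cases huρ : u = ρ
      · subst huρ
        exact hroot τ F k13 k19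
      -- Along the chain all labels equal the number of `ρ`, so `ρ` is the only vertex whose label
      -- is its own number; this is the test of the loop.
      have hlt : f u < vid u := by
        have := hle u hu
        have : vid u ≠ vid ρ := fun h => huρ (vid_injective h)
        omega
      have e6 : τ.arr 6 (τ.reg 13) = vid w := by
        rw [k13, F.arr 6 (by decide), hg, hgu]
      have e5 : τ.arr 5 (vid w) = f w := by rw [F.arr 5 (by decide), hf]
      have e1 : τ.reg 1 = n := (F.reg 1 (by decide)).trans hE.vars
      have F' := frame_run (c := body) rfl τ
      have hw : w ∈ l := hadj.2.1
      have q13 : (body.run τ).reg 13 = vid w := by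
        by_cases h : vid w < n <;>
          simp [hbody, block, Code.run, Test.check, Instr.eval, e6, e1, h]
      have q19 : (body.run τ).reg 19 = f w := by
        by_cases h : vid w < n <;>
          simp [hbody, block, Code.run, Test.check, Instr.eval, e6, e1, e5, h]
      refine (Runs.while_step (T := 7) (T' := 8 * t + 1) (P := fun ρ => ρ = body.run τ)
        (by simp only [Test.Holds, k13, k19]; exact hlt)
        ((Runs.straight (c := body) (Q := fun ρ => ρ = body.run τ) rfl rfl).mono (by simp [hbody, block, Code.cost])
          fun _ h => h) ?_).mono (by omega) fun _ h => h
      rintro _ rfl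
      refine (ih hw _ (F.trans (F'.mono (by decide) (by decide))) q13 q19).mono le_rfl ?_
      rintro τ' ⟨P, j1, j2, j3, j4, j5, j6, j7⟩
      rcases w with x | c
      · have h : vid (.inl x : Fin n ⊕ Fin m) < n := x.2
        have q4 : (body.run τ).reg 4 = τ.reg 4 := by
          simp [hbody, block, Code.run, Test.check, Instr.eval, e6, e1, h]
        have q11 : (body.run τ).arr 11 = τ.arr 11 := by
          simp [hbody, block, Code.run, Test.check, Instr.eval, e6, e1, h]
        rw [q4] at j2 j3 j4
        rw [q11] at j4
        refine ⟨P, by omega, j2, j3, j4, j5, fun O hO huO => ?_, j7⟩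
        rcases u with y | c
        · exact absurd hadj.2.2 (not_graph_adj_inl_inl G)
        -- The clause before `x` on the path lies in `O`, and this puts `x` into the span.
        have hx : (Sum.inl x : Fin n ⊕ Fin m) ∈ G.span O X :=
          ⟨fun h => hR.notMem x h hw, c, huO, (graph_adj_inr_inl G).1 hadj.2.2⟩
        have hr : (G.restrict (G.span O X)).Reachable (.inr c) (.inl x) :=
          SimpleGraph.Adj.reachable ⟨huO, hx, hadj.2.2⟩
        obtain ⟨r1, r2⟩ := j6 O hO hx
        exact ⟨hr.trans r1, fun d hd => hr.trans (r2 d hd)⟩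
      · have h : ¬ vid (.inr c : Fin n ⊕ Fin m) < n := by simp [vid]
        have q4 : (body.run τ).reg 4 = τ.reg 4 + 1 := by
          simp [hbody, block, Code.run, Test.check, Instr.eval, e6, e1, h]
        have q11 : (body.run τ).arr 11 = Function.update (τ.arr 11) (τ.reg 4) (n + c) := by
          simp [hbody, block, Code.run, Test.check, Instr.eval, e6, e1, vid]
        rw [q4] at j2 j3 j4
        rw [q11] at j4
        refine ⟨c :: P, by simp; omega, by simp; omega, ?_, fun i hi => ?_, ?_, fun O hO huO => ?_,
          j7⟩
        · rw [List.map_cons, seg_cons]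
          exact ⟨by rw [j4 _ (by omega), Function.update_self], j3⟩
        · rw [j4 i (by omega), Function.update_of_ne (by omega)]
        · simp only [List.mem_cons, forall_eq_or_imp]
          exact ⟨hw, j5⟩
        · have hcO : (Sum.inr c : Fin n ⊕ Fin m) ∈ G.span O X := hO c (by simp)
          have hr : (G.restrict (G.span O X)).Reachable u (.inr c) :=
            SimpleGraph.Adj.reachable ⟨huO, hcO, hadj.2.2⟩
          obtain ⟨r1, r2⟩ := j6 O (fun d hd => hO d (by simp [hd])) hcO
          refine ⟨hr.trans r1, fun d hd => ?_⟩
          rcases List.mem_cons.1 hd with rfl | hd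
          · exact hr
          · exact hr.trans (r2 d hd)
  have F0 := frame_run (c := ld 19 5 13) rfl σ
  refine (Runs.block_cons (T := 1) (P := fun τ => τ = (ld 19 5 13).run σ)
    (Runs.straight (c := ld 19 5 13) rfl rfl) ?_ (T' := 8 * t + 1 + 1)).mono (by omega)
    fun _ h => h
  rintro _ rfl
  exact Runs.block_cons (key hch hu _ (F0.mono (by decide) (by decide))
    (by simp [Code.run, Instr.eval, h13]) (by simp [Code.run, Instr.eval, h13, hf]))
    fun τ h => Runs.block_nil (by
      obtain ⟨P, h⟩ := h
      exact ⟨P, by simpa [Code.run, Instr.eval] using h⟩)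

end RAM

/-! ### The program -/

namespace RAM

open IncidenceGraph BackdoorTree

/-- Load the current frame. -/
def loadFrame : Code := block [ld 10 13 6, ld 11 14 6, ld 28 15 6, ld 29 16 6, ld 30 17 6]

/-- Store a new frame. -/
def storeFrame : Code :=
  block [addc 6 6 1, st 13 6 34, st 14 6 35, st 15 6 28, st 16 6 29, st 17 6 30]

/-- Call the subroutine `p` with a new frame. -/
def invoke (p : ℕ) : Code := block [storeFrame, .call p, sb 6 6 8]

/-- The vertices of a component are copied from its linked list to the top of the stack only when
its turn comes. Registers do not survive a nested call, so the position and the end of the loop are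
kept in the arrays `18` and `22` of the frame. A result other than a tree moves the position to the
end and so stops the loop. -/
def splitBody : Code :=
  block [block [ld 13 9 32, ld 20 7 13, addc 32 32 1, addc 27 33 0], pushChain,
    block [st 18 6 32, st 22 6 33, ld 28 15 6, ld 29 16 6, ld 30 17 6, addc 34 33 0, addc 35 27 0],
    invoke 1, block [ld 32 18 6, ld 33 22 6, .ite (.eq 5 7) .skip (addc 32 33 0)]]

/-- The subroutine for arbitrary graphs: split into components. -/
def solve : Code :=
  block [loadFrame, label, .ite (.lt 7 24) (cst 5 2) (block [linkComponents, addc 32 11 1,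
    .ite (.lt 32 27)
      (block [emitHeader, sb 26 27 11, emit 26, block [addc 32 11 0, addc 33 27 0, cst 5 0],
        .while (.lt 32 33) splitBody])
      (.call 1)])]

/-- After the call the variable is recovered from the frame and becomes unassigned again, so that
the other value can be tried from the same state. -/
def branchOn (s : ℕ) : Code :=
  block [cst 23 s, assignVar, block [addc 34 11 0, addc 35 27 0], invoke 0,
    block [ld 22 18 6, st 4 22 7], loadFrame]

/-- The first pending variable is removed from the frame. It is skipped if it has left the graph in
the meantime, and the second value is tried only if the first one has led to a tree. -/
def branchCode : Code :=
  block [block [ld 22 10 28, addc 28 28 1, st 15 6 28], isMember,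
    .ite (.eq 24 7) (.call 1)
      (block [st 18 6 22, emitHeader, emit 8, emit 8, emit 22, cst 20 2, emit 20, branchOn 1,
        .ite (.eq 5 7) (branchOn 0) .skip])]

/-- The nested calls have overwritten labels and parents, so the graph is labelled anew. The paths
start at the first clauses of the two obstructions, whose positions were saved in the arrays `20`
and `21`. -/
def joinCode : Code :=
  block [loadFrame, label, .ite (.eq 24 7)
    (block [block [ld 20 20 6, ld 13 11 20], pushPath, block [ld 20 21 6, ld 13 11 20], pushPath,
      cst 5 1])
    (cst 5 2)]

/-- The output of the failed attempt is discarded by restoring the output position. If branching on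
the neighbours produces a tree, the first obstruction is discarded in the same way. -/
def secondCode : Code :=
  block [block [ld 3 19 6, st 21 6 4, ld 34 20 6], loadFrame, pushNeighbours,
    block [addc 28 29 0, addc 29 27 0, sb 30 30 8, addc 34 10 0, addc 35 11 0], invoke 1,
    .ite (.eq 5 7) (ld 4 20 6) (.ite (.eq 5 8) joinCode .skip)]

/-- The first attempt is made one level lower on the same graph and with no pending variables; the
positions of the output and of the obstructions are saved for a possible second attempt. -/
def levelCode : Code :=
  block [block [st 19 6 3, st 20 6 4, sb 30 30 8, addc 28 29 0, addc 34 10 0, addc 35 11 0],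
    invoke 1, .ite (.eq 5 8) secondCode .skip]

/-- The subroutine for connected graphs: branch on a pending variable or look for an
obstruction. -/
def solveConn : Code :=
  block [loadFrame, findEdge,
    .ite (.eq 24 7) (block [emitHeader, emit 7, cst 5 0])
      (.ite (.lt 28 29) branchCode
        (.ite (.eq 30 7) (block [st 11 4 24, addc 4 4 1, cst 5 1]) levelCode))]

/-- The subroutines of the program. -/
def procs : List Code := [solve, solveConn]

/-! ### Specification of the subroutines -/

variable {n m : ℕ} {k : ℕ} {L : Fin m → List (Fin n × Bool)} {G : IncidenceGraph (Fin n) (Fin m)}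

/-- What a subroutine preserves: registers with global information, the input, the frames below
`d`, and the stacks below given positions. -/
structure Pres (d hi yh o b : ℕ) (S : Set (Fin n ⊕ Fin m)) (σ τ : State) : Prop where
  reg : ∀ r ∈ [0, 1, 2, 6, 7, 8, 9], τ.reg r = σ.reg r
  input : ∀ a ∈ [0, 1, 2], τ.arr a = σ.arr a
  frames : ∀ a ∈ [13, 14, 15, 16, 17, 18, 19, 20, 21, 22], ∀ i < d, τ.arr a i = σ.arr a i
  stack : ∀ i < hi, τ.arr 9 i = σ.arr 9 i
  pending : ∀ i < yh, τ.arr 10 i = σ.arr 10 i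
  out : ∀ i < o, τ.arr 3 i = σ.arr 3 i
  obs : ∀ i < b, τ.arr 11 i = σ.arr 11 i
  keys : ∀ v ∉ S, τ.arr 7 (vid v) = σ.arr 7 (vid v) ∧ τ.arr 8 (vid v) = σ.arr 8 (vid v)

theorem Pres.trans {d hi yh o b : ℕ} {S : Set (Fin n ⊕ Fin m)} {σ τ ρ : State}
    (h : Pres d hi yh o b S σ τ) (h' : Pres d hi yh o b S τ ρ) : Pres d hi yh o b S σ ρ :=
  ⟨fun r hr => (h'.reg r hr).trans (h.reg r hr),
    fun r hr => (h'.input r hr).trans (h.input r hr),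
    fun a ha i hi => (h'.frames a ha i hi).trans (h.frames a ha i hi),
    fun i hi => (h'.stack i hi).trans (h.stack i hi),
    fun i hi => (h'.pending i hi).trans (h.pending i hi),
    fun i hi => (h'.out i hi).trans (h.out i hi),
    fun i hi => (h'.obs i hi).trans (h.obs i hi),
    fun v hv => ⟨(h'.keys v hv).1.trans (h.keys v hv).1, (h'.keys v hv).2.trans (h.keys v hv).2⟩⟩

theorem Pres.mono {d hi yh o b d' hi' yh' o' b' : ℕ} {S S' : Set (Fin n ⊕ Fin m)} {σ τ : State}
    (h : Pres d hi yh o b S σ τ) (hd : d' ≤ d) (hhi : hi' ≤ hi) (hyh : yh' ≤ yh) (ho : o' ≤ o)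
    (hb : b' ≤ b) (hS : S ⊆ S') : Pres d' hi' yh' o' b' S' σ τ :=
  ⟨h.reg, h.input, fun a ha i hi => h.frames a ha i (by omega), fun i hi => h.stack i (by omega),
    fun i hi => h.pending i (by omega), fun i hi => h.out i (by omega),
    fun i hi => h.obs i (by omega), fun v hv => h.keys v fun hh => hv (hS hh)⟩

/-- Code that does not write to the global registers and to the shared arrays preserves
everything. -/
theorem Frame.pres {R A : List ℕ} {σ τ : State} (h : Frame R A σ τ)
    (hR : ∀ r ∈ [0, 1, 2, 6, 7, 8, 9], r ∉ R)
    (hA : ∀ a ∈ [0, 1, 2, 3, 7, 8, 9, 10, 11, 13, 14, 15, 16, 17, 18, 19, 20, 21, 22], a ∉ A)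
    (d hi yh o b : ℕ) (S : Set (Fin n ⊕ Fin m)) : Pres d hi yh o b S σ τ := by
  have h1 : ∀ a ∈ [0, 1, 2], a ∈ [0, 1, 2, 3, 7, 8, 9, 10, 11, 13, 14, 15, 16, 17, 18, 19, 20,
      21, 22] := by decide
  have h2 : ∀ a ∈ [13, 14, 15, 16, 17, 18, 19, 20, 21, 22], a ∈ [0, 1, 2, 3, 7, 8, 9, 10, 11, 13,
      14, 15, 16, 17, 18, 19, 20, 21, 22] := by decide
  exact ⟨fun r hr => h.reg r (hR r hr), fun a ha => h.arr a (hA a (h1 a ha)),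
    fun a ha i _ => by rw [h.arr a (hA a (h2 a ha))], fun i _ => by rw [h.arr 9 (hA 9 (by simp))],
    fun i _ => by rw [h.arr 10 (hA 10 (by simp))], fun i _ => by rw [h.arr 3 (hA 3 (by simp))],
    fun i _ => by rw [h.arr 11 (hA 11 (by simp))],
    fun v _ => by rw [h.arr 7 (hA 7 (by simp)), h.arr 8 (hA 8 (by simp))]; simp⟩

/-- The current frame describes the graph `l`, the pending variables `Y` and the level `j`. -/
structure Ready (k : ℕ) (L : Fin m → List (Fin n × Bool)) (X : Set (Fin n)) (d lo yl j : ℕ)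
    (l : List (Fin n ⊕ Fin m)) (Y : List (Fin n)) (σ : State) : Prop where
  env : Env k L X σ
  depth : σ.reg 6 = d
  first : σ.arr 13 d = lo
  last : σ.arr 14 d = lo + l.length
  yfirst : σ.arr 15 d = yl
  ylast : σ.arr 16 d = yl + Y.length
  level : σ.arr 17 d = j
  seg : Seg (σ.arr 9) lo (l.map vid)
  pend : Seg (σ.arr 10) yl (Y.map Fin.val)

/-- A bound for the size of obstructions. -/
def obsSize (k : ℕ) : ℕ → ℕ
  | 0 => 1
  | j + 1 => 2 * obsSize k j + 4 * 2 ^ (k + 2)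

/-- A bound for the size of those obstructions whose neighbours are branched on. -/
def maxObs (k : ℕ) : ℕ := 4 * 6 ^ k

/-- The list of clauses `O` forces the depth `j` in every graph that contains it. -/
structure Obstruction (G : IncidenceGraph (Fin n) (Fin m)) (k : ℕ) (X : Set (Fin n)) (j : ℕ)
    (l : List (Fin n ⊕ Fin m)) (Y : List (Fin n)) (O : List (Fin m)) : Prop where
  size : O.length ≤ obsSize k j
  sub : ∀ c ∈ O, Sum.inr c ∈ l
  forces : ∃ X', X ⊆ X' ∧ G.Safe {c | c ∈ O} X' ∧ G.Linked {c | c ∈ O} X' ∧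
    G.Forces {c | c ∈ O} X' j ∧ ∀ y ∈ Y, y ∈ X' ∨ ∀ c ∈ O, ¬ G.Occurs y c

/-- The result of a subroutine: a tree, an obstruction, or the certainty that the depth of the
whole graph exceeds the parameter. -/
inductive Outcome (G : IncidenceGraph (Fin n) (Fin m)) (k : ℕ) (X : Set (Fin n)) (j : ℕ)
    (l : List (Fin n ⊕ Fin m)) (Y : List (Fin n)) (σ τ : State) : Prop
  | tree (w : List ℕ) (hflag : τ.reg 5 = 0) (hw : Wrote w σ τ) (hobs : τ.reg 4 = σ.reg 4)
      (htree : HasTree G {v | v ∈ l} (Y.length + j * (k * maxObs k)) w)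
  | obstruction (O : List (Fin m)) (hflag : τ.reg 5 = 1) (hO : Obstruction G k X j l Y O)
      (hpos : τ.reg 4 = σ.reg 4 + O.length)
      (hseg : Seg (τ.arr 11) (σ.reg 4) (O.map fun c : Fin m => n + (c : ℕ)))
  | reject (hflag : τ.reg 5 = 2) (h : (k : ℕ∞) < G.srbd G.edgeless)

theorem Outcome.congr_left {X : Set (Fin n)} {j : ℕ} {l : List (Fin n ⊕ Fin m)} {Y : List (Fin n)}
    {σ σ' τ : State} (h : Outcome G k X j l Y σ τ) (h3 : σ'.reg 3 = σ.reg 3)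
    (h4 : σ'.reg 4 = σ.reg 4) (ha : σ'.arr 3 = σ.arr 3) : Outcome G k X j l Y σ' τ := by
  cases h with
  | tree w h1 h2 h3' h4' => exact .tree w h1 (h2.congr_left h3 ha) (by rw [h3', h4]) h4'
  | obstruction O h1 h2 h3' h4' => exact .obstruction O h1 h2 (by rw [h3', h4]) (by rw [h4]; exact h4')
  | reject h1 h2 => exact .reject h1 h2

theorem Outcome.congr_right {X : Set (Fin n)} {j : ℕ} {l : List (Fin n ⊕ Fin m)}
    {Y : List (Fin n)} {σ τ τ' : State} (h : Outcome G k X j l Y σ τ)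
    (hr : ∀ r ∈ [3, 4, 5], τ'.reg r = τ.reg r) (ha : ∀ a ∈ [3, 11], τ'.arr a = τ.arr a) :
    Outcome G k X j l Y σ τ' := by
  have r3 := hr 3 (by simp)
  have r4 := hr 4 (by simp)
  have r5 := hr 5 (by simp)
  cases h with
  | tree w h1 h2 h3 h4 =>
    exact .tree w (r5.trans h1) (h2.congr r3 (ha 3 (by simp))) (r4.trans h3) h4
  | obstruction O h1 h2 h3 h4 =>
    exact .obstruction O (r5.trans h1) h2 (r4.trans h3) (by rw [ha 11 (by simp)]; exact h4)
  | reject h1 h2 => exact .reject (r5.trans h1) h2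

/-- A bound for the work in a call, apart from nested calls, per vertex. -/
def unit (k : ℕ) : ℕ := 600 * ((k + 1) * 2 ^ (k + 2) * (maxObs k + 1))

/-- A bound for the steps of `solveConn`, with `y` pending variables, at level `j`, for `s`
vertices. -/
def time (k y j s : ℕ) : ℕ := unit k * 8 ^ (y + j * (k * maxObs k + 1) + 1) * (s + 1)

/-- The postcondition of the subroutines. -/
def Returns (G : IncidenceGraph (Fin n) (Fin m)) (k : ℕ) (X : Set (Fin n)) (d hi yh j : ℕ)
    (l : List (Fin n ⊕ Fin m)) (Y : List (Fin n)) (σ τ : State) : Prop :=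
  Pres d hi yh (σ.reg 3) (σ.reg 4) {v | v ∈ l} σ τ ∧ τ.arr 4 = σ.arr 4 ∧ Outcome G k X j l Y σ τ

/-- The specification of `solve`. -/
def SpecSolve (G : IncidenceGraph (Fin n) (Fin m)) (k : ℕ) (L : Fin m → List (Fin n × Bool))
    (y j : ℕ) : Prop :=
  ∀ (X : Set (Fin n)) (d lo yl : ℕ) (l : List (Fin n ⊕ Fin m)) (Y : List (Fin n)) (σ : State),
    Ready k L X d lo yl j l Y σ → l.Nodup → G.IsResidual X {v | v ∈ l} → Y.length = y →
    Runs procs solve σ (3 * time k y j l.length)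
      (Returns G k X d (lo + l.length) (yl + Y.length) j l Y σ)

/-- The specification of `solveConn`. -/
def SpecConn (G : IncidenceGraph (Fin n) (Fin m)) (k : ℕ) (L : Fin m → List (Fin n × Bool))
    (y j : ℕ) : Prop :=
  ∀ (X : Set (Fin n)) (d lo yl : ℕ) (l : List (Fin n ⊕ Fin m)) (Y : List (Fin n)) (σ : State),
    Ready k L X d lo yl j l Y σ → l.Nodup → G.IsResidual X {v | v ∈ l} → Y.length = y →
    G.IsConn {v | v ∈ l} →
    Runs procs solveConn σ (time k y j l.length)
      (Returns G k X d (lo + l.length) (yl + Y.length) j l Y σ)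

theorem runs_loadFrame {ps : List Code} {X : Set (Fin n)} {d lo yl j : ℕ}
    {l : List (Fin n ⊕ Fin m)} {Y : List (Fin n)} {σ : State} (h : Ready k L X d lo yl j l Y σ) :
    Runs ps loadFrame σ 6 fun τ => Cur l lo τ ∧ τ.reg 28 = yl ∧ τ.reg 29 = yl + Y.length ∧
      τ.reg 30 = j ∧ Ready k L X d lo yl j l Y τ ∧ Frame [10, 11, 28, 29, 30] [] σ τ := by
  have F := frame_run (c := loadFrame) rfl σ
  have hE := h.env.frame F (by decide) (by decide)
  refine Runs.straight (c := loadFrame) rfl ⟨⟨?_, ?_, h.seg⟩, ?_, ?_, ?_,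
    ⟨hE, (F.reg 6 (by decide)).trans h.depth, h.first, h.last, h.yfirst, h.ylast, h.level, h.seg,
      h.pend⟩, F.mono (by decide) (by decide)⟩
  · simp [loadFrame, block, Code.run, Instr.eval, h.depth, h.first]
  · simp [loadFrame, block, Code.run, Instr.eval, h.depth, h.last]
  · simp [loadFrame, block, Code.run, Instr.eval, h.depth, h.yfirst]
  · simp [loadFrame, block, Code.run, Instr.eval, h.depth, h.ylast]
  · simp [loadFrame, block, Code.run, Instr.eval, h.depth, h.level]

/-- Calling a subroutine that meets its specification. -/
theorem runs_invoke {p : ℕ} {code : Code} (hp : procs[p]? = some code) {X : Set (Fin n)}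
    {d lo yl j T : ℕ} {l : List (Fin n ⊕ Fin m)} {Y : List (Fin n)} {σ : State}
    (hspec : ∀ τ, Ready k L X (d + 1) lo yl j l Y τ → Runs procs code τ T
      (Returns G k X (d + 1) (lo + l.length) (yl + Y.length) j l Y τ))
    (hE : Env k L X σ) (h6 : σ.reg 6 = d) (h34 : σ.reg 34 = lo) (h35 : σ.reg 35 = lo + l.length)
    (h28 : σ.reg 28 = yl) (h29 : σ.reg 29 = yl + Y.length) (h30 : σ.reg 30 = j)
    (hseg : Seg (σ.arr 9) lo (l.map vid)) (hpend : Seg (σ.arr 10) yl (Y.map Fin.val)) :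
    Runs procs (invoke p) σ (T + 10)
      (Returns G k X (d + 1) (lo + l.length) (yl + Y.length) j l Y σ) := by
  have F := frame_run (c := storeFrame) rfl σ
  have e6 : (storeFrame.run σ).reg 6 = d + 1 := by
    simp [storeFrame, block, Code.run, Instr.eval, h6]
  have hR : Ready k L X (d + 1) lo yl j l Y (storeFrame.run σ) := by
    refine ⟨hE.frame F (by decide) (by decide), e6, ?_, ?_, ?_, ?_, ?_, ?_, ?_⟩
    · simp [storeFrame, block, Code.run, Instr.eval, h6, h34]
    · simp [storeFrame, block, Code.run, Instr.eval, h6, h35]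
    · simp [storeFrame, block, Code.run, Instr.eval, h6, h28]
    · simp [storeFrame, block, Code.run, Instr.eval, h6, h29]
    · simp [storeFrame, block, Code.run, Instr.eval, h6, h30]
    · rw [F.arr 9 (by decide)]; exact hseg
    · rw [F.arr 10 (by decide)]; exact hpend
  have hframes : ∀ a ∈ [13, 14, 15, 16, 17, 18, 19, 20, 21, 22], ∀ i < d + 1,
      (storeFrame.run σ).arr a i = σ.arr a i := by
    intro a ha i hi
    have hne : i ≠ d + 1 := by omega
    simp only [List.mem_cons, List.not_mem_nil, or_false] at ha
    rcases ha with rfl | rfl | rfl | rfl | rfl | rfl | rfl | rfl | rfl | rfl <;>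
      simp [storeFrame, block, Code.run, Instr.eval, h6, hne]
  refine (Runs.block_cons (T := 7) (P := fun τ => τ = storeFrame.run σ)
    (Runs.straight (c := storeFrame) rfl rfl) (T' := T + 1 + 2) ?_).mono (by omega) fun _ h => h
  rintro _ rfl
  refine Runs.block_cons (Runs.call hp (hspec _ hR)) fun τ ⟨hP, h4, hO⟩ => ?_
  have F' := frame_run (c := sb 6 6 8) rfl τ
  refine Runs.straight (ps := procs) (c := block [sb 6 6 8]) rfl ⟨⟨?_, ?_, ?_, ?_, ?_, ?_, ?_, ?_⟩,
    h4.trans (F.arr 4 (by decide)), (hO.congr_left (F.reg 3 (by decide)).symm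
      (F.reg 4 (by decide)).symm (F.arr 3 (by decide)).symm).congr_right (fun r hr => ?_)
      fun _ _ => rfl⟩
  · intro r hr
    by_cases hr6 : r = 6
    · subst hr6
      simp [block, Code.run, Instr.eval, hP.reg 6, e6, hP.reg 8, F.reg 8 (by decide), hE.one, h6]
    · have hr' : r ∉ storeFrame.wregs := by
        simp [storeFrame, block, Code.wregs, hr6]
      simp only [block, Code.run, Instr.eval]
      rw [Function.update_of_ne hr6, hP.reg r hr, F.reg r hr']
  · intro a ha
    refine (hP.input a ha).trans (F.arr a ?_)
    revert a; decide
  · exact fun a ha i hi => (hP.frames a ha i hi).trans (hframes a ha i hi)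
  · exact fun i hi => (hP.stack i hi).trans (by rw [F.arr 9 (by decide)])
  · exact fun i hi => (hP.pending i hi).trans (by rw [F.arr 10 (by decide)])
  · exact fun i hi => (hP.out i (by rw [F.reg 3 (by decide)]; exact hi)).trans
      (by rw [F.arr 3 (by decide)])
  · exact fun i hi => (hP.obs i (by rw [F.reg 4 (by decide)]; exact hi)).trans
      (by rw [F.arr 11 (by decide)])
  · intro v hv
    rw [← F.arr 7 (by decide), ← F.arr 8 (by decide)]
    exact hP.keys v hv
  · refine (frame_run (c := block [sb 6 6 8]) rfl τ).reg r ?_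
    revert r; decide

end RAM

/-! ### The subroutine for arbitrary graphs -/

namespace IncidenceGraph

variable {n m : ℕ} {G : IncidenceGraph (Fin n) (Fin m)} {X : Set (Fin n)}

/-- Paths do not leave a set that is closed under adjacency. -/
theorem reachable_restrict_of_closed {V C : Type} {G : IncidenceGraph V C} {S K : Set (V ⊕ C)}
    (hcl : ∀ u ∈ K, ∀ v, (G.restrict S).Adj u v → v ∈ K) {u v : V ⊕ C} (hu : u ∈ K)
    (h : (G.restrict S).Reachable u v) : (G.restrict K).Reachable u v ∧ v ∈ K := by
  rw [SimpleGraph.reachable_iff_reflTransGen] at h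
  induction h with
  | refl => exact ⟨.refl _, hu⟩
  | tail _ hbc ih =>
    have hc := hcl _ ih.2 _ hbc
    exact ⟨ih.1.trans (SimpleGraph.Adj.reachable ⟨ih.2, hc, hbc.2.2⟩), hc⟩

/-- The vertices with a given label. -/
def labelClass (l : List (Fin n ⊕ Fin m)) (f : Fin n ⊕ Fin m → ℕ) (ρ : Fin n ⊕ Fin m) :
    List (Fin n ⊕ Fin m) :=
  (l.filter fun v => f v = RAM.vid ρ).reverse

variable {l : List (Fin n ⊕ Fin m)} {f g : Fin n ⊕ Fin m → ℕ} {t : ℕ}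

theorem mem_labelClass {ρ v : Fin n ⊕ Fin m} :
    v ∈ labelClass l f ρ ↔ v ∈ l ∧ f v = RAM.vid ρ := by
  simp [labelClass]

theorem nodup_labelClass (hl : l.Nodup) (ρ : Fin n ⊕ Fin m) : (labelClass l f ρ).Nodup :=
  List.nodup_reverse.2 (hl.filter _)

section

variable (hS : RAM.StableLabels {v | v ∈ l} (G.restrict {v | v ∈ l}) t f g)
include hS

theorem labelClass_closed {ρ : Fin n ⊕ Fin m} :
    ∀ u ∈ {v | v ∈ labelClass l f ρ}, ∀ v, (G.restrict {v | v ∈ l}).Adj u v →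
      v ∈ {v | v ∈ labelClass l f ρ} := by
  intro u hu v huv
  have hu' := mem_labelClass.1 hu
  refine mem_labelClass.2 ⟨huv.2.1, ?_⟩
  rw [← (hS.reachable_iff u huv.1 v huv.2.1).1 huv.reachable, hu'.2]

theorem isConn_labelClass (ρ : Fin n ⊕ Fin m) : G.IsConn {v | v ∈ labelClass l f ρ} := by
  refine isConn_iff.2 fun u hu v hv => ?_
  have hu' := mem_labelClass.1 hu
  have hv' := mem_labelClass.1 hv
  exact (reachable_restrict_of_closed (labelClass_closed hS) hu
    ((hS.reachable_iff u hu'.1 v hv'.1).2 (hu'.2.trans hv'.2.symm))).1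

theorem isResidual_labelClass (hR : G.IsResidual X {v | v ∈ l}) (ρ : Fin n ⊕ Fin m) :
    G.IsResidual X {v | v ∈ labelClass l f ρ} := by
  refine ⟨fun x hx h => hR.notMem x hx (mem_labelClass.1 h).1, fun c x hc hx hX => ?_,
    fun x hx => ?_⟩
  · have hc' := (mem_labelClass.1 hc).1
    exact labelClass_closed hS _ hc _ ⟨hc', hR.closed c x hc' hx hX, (graph_adj_inr_inl G).2 hx⟩
  · obtain ⟨s, hs⟩ := hR.safe x hx
    exact ⟨s, fun c hc => hs c (mem_labelClass.1 hc).1⟩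

/-- Components correspond to the vertices that carry their own number, since the label of each
component is the number of one such vertex. -/
theorem isComponent_iff_labelClass {K : Set (Fin n ⊕ Fin m)} :
    K ∈ (l.filter fun v => f v = RAM.vid v).map (fun ρ => {v | v ∈ labelClass l f ρ}) ↔
      G.IsComponent {v | v ∈ l} K := by
  rw [isComponent_iff]
  simp only [List.mem_map, List.mem_filter, decide_eq_true_eq]
  constructor
  · rintro ⟨ρ, ⟨h1, h2⟩, rfl⟩
    refine ⟨ρ, h1, ?_⟩
    ext v
    simp only [Set.mem_ofPred_eq, mem_labelClass]
    refine and_congr_right fun hv => ?_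
    rw [hS.reachable_iff ρ h1 v hv, h2]
    exact eq_comm
  · rintro ⟨u, hu, rfl⟩
    obtain ⟨ρ, hρ, h1, h2⟩ := hS.root u hu
    refine ⟨ρ, ⟨hρ, h2⟩, ?_⟩
    ext v
    simp only [Set.mem_ofPred_eq, mem_labelClass]
    refine and_congr_right fun hv => ?_
    rw [hS.reachable_iff u hu v hv, h1]
    exact eq_comm

/-- The graph is connected if and only if there is at most one root. -/
theorem isConn_iff_length_roots (hl : l.Nodup) :
    G.IsConn {v | v ∈ l} ↔ (l.filter fun v => f v = RAM.vid v).length ≤ 1 := by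
  rw [isConn_iff]
  constructor
  · intro h
    by_contra! hlt
    have hnd := hl.filter (fun v => f v = RAM.vid v)
    have h0 := List.getElem_mem (l := l.filter fun v => f v = RAM.vid v) (n := 0) (by omega)
    have h1 := List.getElem_mem (l := l.filter fun v => f v = RAM.vid v) (n := 1) (by omega)
    rw [List.mem_filter, decide_eq_true_eq] at h0 h1
    have := (hS.reachable_iff _ h0.1 _ h1.1).1 (h _ h0.1 _ h1.1)
    rw [h0.2, h1.2, RAM.vid_inj, hnd.getElem_inj_iff] at this
    omega
  · intro hle u hu v hv
    obtain ⟨ρ, h1, h2, h3⟩ := hS.root u hu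
    obtain ⟨ρ', h1', h2', h3'⟩ := hS.root v hv
    have hρ : ρ ∈ l.filter fun v => f v = RAM.vid v := by simpa using ⟨h1, h3⟩
    have hρ' : ρ' ∈ l.filter fun v => f v = RAM.vid v := by simpa using ⟨h1', h3'⟩
    have : ρ = ρ' := by
      obtain ⟨i, hi, rfl⟩ := List.getElem_of_mem hρ
      obtain ⟨i', hi', rfl⟩ := List.getElem_of_mem hρ'
      have : i = i' := by omega
      subst this; rfl
    rw [hS.reachable_iff u hu v hv, h2, h2', this]

end

theorem nodup_labelClasses (hl : l.Nodup) :
    ((l.filter fun v => f v = RAM.vid v).map fun ρ => {v | v ∈ labelClass l f ρ}).Nodup := by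
  refine List.Nodup.map_on ?_ (hl.filter _)
  intro ρ hρ ρ' _ h
  simp only [List.mem_filter, decide_eq_true_eq] at hρ
  have : ρ ∈ {v | v ∈ labelClass l f ρ'} := h ▸ mem_labelClass.2 hρ
  exact RAM.vid_injective (hρ.2.symm.trans (mem_labelClass.1 this).2)

/-- The classes of different roots are disjoint. The induction removes the class of the first root
from `l`, which does not affect the other classes. -/
theorem sum_length_labelClass_le {rs : List (Fin n ⊕ Fin m)} (hrs : rs.Nodup) :
    ∀ l : List (Fin n ⊕ Fin m),
      (rs.map fun ρ => (labelClass l f ρ).length).sum ≤ l.length := by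
  induction rs with
  | nil => simp
  | cons ρ rs ih =>
    intro l
    obtain ⟨h1, h2⟩ := List.nodup_cons.1 hrs
    have h3 := ih h2 (l.filter fun v => ¬ f v = RAM.vid ρ)
    have h4 : (rs.map fun ρ' => (labelClass (l.filter fun v => ¬ f v = RAM.vid ρ) f ρ').length) =
        rs.map fun ρ' => (labelClass l f ρ').length := by
      refine List.map_congr_left fun ρ' hρ' => ?_
      simp only [labelClass, List.length_reverse, List.filter_filter]
      congr 2
      ext v
      by_cases hv : f v = RAM.vid ρ'
      · have : ¬ ρ' = ρ := fun h => h1 (h ▸ hρ')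
        simp [hv, RAM.vid_inj, this]
      · simp [hv]
    rw [h4] at h3
    have h5 := List.length_eq_length_filter_add (l := l) fun v => decide (f v = RAM.vid ρ)
    have h6 : (l.filter fun v => ! decide (f v = RAM.vid ρ)) =
        l.filter fun v => ¬ f v = RAM.vid ρ := by simp
    rw [h6] at h5
    simp only [List.map_cons, List.sum_cons]
    rw [labelClass, List.length_reverse]
    omega

end IncidenceGraph

-- Running through the components.

namespace RAM

open IncidenceGraph BackdoorTree

variable {n m : ℕ} {k : ℕ} {L : Fin m → List (Fin n × Bool)} {G : IncidenceGraph (Fin n) (Fin m)}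

theorem Pres.refl (d hi yh o b : ℕ) (S : Set (Fin n ⊕ Fin m)) (σ : State) :
    Pres d hi yh o b S σ σ :=
  ⟨fun _ _ => rfl, fun _ _ => rfl, fun _ _ _ _ => rfl, fun _ _ => rfl, fun _ _ => rfl,
    fun _ _ => rfl, fun _ _ => rfl, fun _ _ => ⟨rfl, rfl⟩⟩

theorem Wrote.nil {σ τ : State} (h3 : τ.reg 3 = σ.reg 3) (ha : τ.arr 3 = σ.arr 3) :
    Wrote [] σ τ :=
  ⟨by simpa using h3, seg_nil _ _, fun _ _ => by rw [ha]⟩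

theorem Ready.frame {X : Set (Fin n)} {d lo yl j : ℕ} {l : List (Fin n ⊕ Fin m)}
    {Y : List (Fin n)} {σ τ : State} {R A : List ℕ} (h : Ready k L X d lo yl j l Y σ)
    (hF : Frame R A σ τ) (hr : ∀ r ∈ [1, 6, 7, 8, 9], r ∉ R)
    (ha : ∀ a ∈ [0, 1, 2, 4, 10, 13, 14, 15, 16, 17], a ∉ A)
    (h9 : ∀ i < lo + l.length, τ.arr 9 i = σ.arr 9 i) : Ready k L X d lo yl j l Y τ := by
  refine ⟨h.env.frame hF (fun r hr' => hr r ?_) (fun a ha' => ha a ?_),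
    (hF.reg 6 (hr 6 (by simp))).trans h.depth, ?_, ?_, ?_, ?_, ?_,
    h.seg.congr fun i _ hi => h9 i (by simpa using hi), ?_⟩
  · revert r; decide
  · revert a; decide
  · rw [hF.arr 13 (ha 13 (by simp)), h.first]
  · rw [hF.arr 14 (ha 14 (by simp)), h.last]
  · rw [hF.arr 15 (ha 15 (by simp)), h.yfirst]
  · rw [hF.arr 16 (ha 16 (by simp)), h.ylast]
  · rw [hF.arr 17 (ha 17 (by simp)), h.level]
  · rw [hF.arr 10 (ha 10 (by simp))]; exact h.pend

theorem Ready.pres {X : Set (Fin n)} {d lo yl j : ℕ} {l : List (Fin n ⊕ Fin m)}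
    {Y : List (Fin n)} {σ τ : State} {hi yh o b : ℕ} {S : Set (Fin n ⊕ Fin m)}
    (h : Ready k L X d lo yl j l Y σ) (hP : Pres (d + 1) hi yh o b S σ τ)
    (h4 : τ.arr 4 = σ.arr 4) (hhi : lo + l.length ≤ hi) (hyh : yl + Y.length ≤ yh) :
    Ready k L X d lo yl j l Y τ := by
  refine ⟨h.env.congr (fun r hr => hP.reg r ?_) (fun a ha => ?_),
    (hP.reg 6 (by simp)).trans h.depth, ?_, ?_, ?_, ?_, ?_,
    h.seg.congr fun i _ hi => hP.stack i (by simp at hi; omega),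
    h.pend.congr fun i _ hi => hP.pending i (by simp at hi; omega)⟩
  · revert r; decide
  · by_cases ha4 : a = 4
    · rw [ha4, h4]
    · refine hP.input a ?_
      revert a; decide
  · rw [hP.frames 13 (by simp) d (by omega), h.first]
  · rw [hP.frames 14 (by simp) d (by omega), h.last]
  · rw [hP.frames 15 (by simp) d (by omega), h.yfirst]
  · rw [hP.frames 16 (by simp) d (by omega), h.ylast]
  · rw [hP.frames 17 (by simp) d (by omega), h.level]

theorem Obstruction.mono_list {X : Set (Fin n)} {j : ℕ} {l l' : List (Fin n ⊕ Fin m)}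
    {Y : List (Fin n)} {O : List (Fin m)} (h : Obstruction G k X j l Y O) (hl : l ⊆ l') :
    Obstruction G k X j l' Y O :=
  ⟨h.size, fun c hc => hl (h.sub c hc), h.forces⟩

/-- A result that is not a tree only depends on the position in the array of obstructions. -/
theorem Outcome.of_flag_ne_zero {X : Set (Fin n)} {j : ℕ} {l l' : List (Fin n ⊕ Fin m)}
    {Y : List (Fin n)} {σ σ' τ : State} (h : Outcome G k X j l Y σ τ) (hτ : τ.reg 5 ≠ 0)
    (h4 : σ'.reg 4 = σ.reg 4) (hl : l ⊆ l') : Outcome G k X j l' Y σ' τ := by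
  cases h with
  | tree w h1 => exact absurd h1 hτ
  | obstruction O h1 h2 h3 h5 =>
    exact .obstruction O h1 (h2.mono_list hl) (by rw [h3, h4]) (by rw [h4]; exact h5)
  | reject h1 h2 => exact .reject h1 h2

/-- The roots lie on the stack above the current graph, and each component is pushed above all roots
at the fixed position `e`, so nested calls cannot damage the roots. The time is charged separately
for every component. -/
theorem runs_splitLoop {y j : ℕ} (hspec : SpecConn G k L y j) {X : Set (Fin n)} {d lo yl e : ℕ}
    {l : List (Fin n ⊕ Fin m)} {Y : List (Fin n)} (hY : Y.length = y)
    {K : Fin n ⊕ Fin m → List (Fin n ⊕ Fin m)} :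
    ∀ (rs : List (Fin n ⊕ Fin m)) (p : ℕ) (σ : State), e = p + rs.length → lo + l.length ≤ p →
      (∀ ρ ∈ rs, ρ ∈ K ρ ∧ (K ρ).Nodup ∧ G.IsResidual X {v | v ∈ K ρ} ∧ G.IsConn {v | v ∈ K ρ} ∧
        K ρ ⊆ l) →
      rs.Pairwise (fun ρ ρ' => ∀ v ∈ K ρ', v ∉ K ρ) →
      Ready k L X d lo yl j l Y σ → Seg (σ.arr 9) p (rs.map vid) →
      (∀ ρ ∈ rs, Chain (σ.arr 8) (σ.arr 7 (vid ρ)) ((K ρ).map vid)) →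
      σ.reg 32 = p → σ.reg 33 = e → σ.reg 5 = 0 →
      Runs procs (.while (.lt 32 33) splitBody) σ
        ((rs.map fun ρ => time k y j (K ρ).length + 6 * (K ρ).length + 40).sum + 1)
        fun τ => Pres d (lo + l.length) (yl + Y.length) (σ.reg 3) (σ.reg 4) {v | v ∈ l} σ τ ∧
          τ.arr 4 = σ.arr 4 ∧
          ((τ.reg 5 = 0 ∧ τ.reg 4 = σ.reg 4 ∧ ∃ ws, Wrote ws.flatten σ τ ∧
            List.Forall₂ (fun K w => HasTree G K (Y.length + j * (k * maxObs k)) w)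
              (rs.map fun ρ => {v | v ∈ K ρ}) ws) ∨
          (τ.reg 5 ≠ 0 ∧ Outcome G k X j l Y σ τ)) := by
  intro rs
  induction rs with
  | nil =>
    intro p σ he _ _ _ _ _ _ h32 h33 h5
    refine (Runs.while_done ?_ ⟨Pres.refl _ _ _ _ _ _ _, rfl, .inl ⟨h5, rfl, [],
      Wrote.nil rfl rfl, by simp⟩⟩).mono (by simp) fun _ h => h
    simp [Test.Holds, h32, h33, he]
  | cons ρ rs ih =>
    intro p σ he hlp hK hpw hready hseg hch h32 h33 h5
    simp only [List.length_cons] at he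
    obtain ⟨hρK, hnd, hres, hconn, hsub⟩ := hK ρ (by simp)
    obtain ⟨hpw1, hpw2⟩ := List.pairwise_cons.1 hpw
    rw [List.map_cons, seg_cons] at hseg
    set c1 : Code := block [ld 13 9 32, ld 20 7 13, addc 32 32 1, addc 27 33 0] with hc1
    have F1 := frame_run (c := c1) rfl σ
    have A1 : (c1.run σ).arr = σ.arr := rfl
    have q20 : (c1.run σ).reg 20 = σ.arr 7 (vid ρ) := by
      simp [hc1, block, Code.run, Instr.eval, h32, hseg.1]
    have q32 : (c1.run σ).reg 32 = p + 1 := by simp [hc1, block, Code.run, Instr.eval, h32]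
    have q27 : (c1.run σ).reg 27 = e := by simp [hc1, block, Code.run, Instr.eval, h33]
    have q33 : (c1.run σ).reg 33 = e := (F1.reg 33 (by decide)).trans h33
    have E1 := hready.env.frame F1 (by decide) (by decide)
    refine (Runs.while_step
      (T := 5 + (6 * ((K ρ).map vid).length + 1 + (8 + (time k y j (K ρ).length + 10 + (5 + 1)))))
      (T' := (rs.map fun ρ => time k y j (K ρ).length + 6 * (K ρ).length + 40).sum + 1)
      (P := fun τ => Pres d p (yl + Y.length) (σ.reg 3) (σ.reg 4) {v | v ∈ K ρ} σ τ ∧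
          τ.arr 4 = σ.arr 4 ∧ Ready k L X d lo yl j l Y τ ∧ τ.reg 33 = e ∧
          (∀ i < e, τ.arr 9 i = σ.arr 9 i) ∧
          τ.reg 32 = (if τ.reg 5 = 0 then p + 1 else e) ∧ Outcome G k X j (K ρ) Y σ τ)
      ?_ ?_ ?_).mono (by simp only [List.length_map, List.map_cons, List.sum_cons]; omega)
        fun _ h => h
    · simp only [Test.Holds, h32, h33]; omega
    · refine Runs.block_cons (T := 5) (P := fun τ => τ = c1.run σ)
        (Runs.straight (c := c1) rfl rfl) ?_
      rintro _ rfl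
      refine Runs.block_cons (runs_pushChain E1.zero E1.one q20 q27 (hch ρ (by simp))) ?_
      rintro τ₂ ⟨i27, iseg, i9, F2⟩
      rw [List.length_map] at i27
      set c3 : Code := block [st 18 6 32, st 22 6 33, ld 28 15 6, ld 29 16 6, ld 30 17 6,
        addc 34 33 0, addc 35 27 0] with hc3
      have F3 := frame_run (c := c3) rfl τ₂
      have R2 : Ready k L X d lo yl j l Y τ₂ :=
        (hready.frame F1 (by decide) (by decide) fun i _ => by rw [A1]).frame F2
          (by decide) (by decide) fun i hi => i9 i (by omega)
      have R3 : Ready k L X d lo yl j l Y (c3.run τ₂) :=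
        R2.frame F3 (by decide) (by decide) fun i _ => by rw [F3.arr 9 (by decide)]
      have q18 : (c3.run τ₂).arr 18 d = p + 1 := by
        simp [hc3, block, Code.run, Instr.eval, R2.depth, F2.reg 32 (by decide), q32]
      have q22 : (c3.run τ₂).arr 22 d = e := by
        simp [hc3, block, Code.run, Instr.eval, R2.depth, F2.reg 33 (by decide), q33]
      have P3 : Pres d e (yl + Y.length) (σ.reg 3) (σ.reg 4) {v | v ∈ K ρ} σ (c3.run τ₂) := by
        have P2 : Pres d e (yl + Y.length) (σ.reg 3) (σ.reg 4) {v | v ∈ K ρ} σ τ₂ := by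
          have F12 := (F1.mono (R' := [13, 20, 27, 32]) (A' := [9]) (by decide) (by decide)).trans
            (F2.mono (by decide) (by decide))
          refine ⟨fun r hr => F12.reg r ?_, fun a ha => F12.arr a ?_, fun a ha i _ => ?_, i9,
            fun i _ => by rw [F12.arr 10 (by decide)], fun i _ => by rw [F12.arr 3 (by decide)],
            fun i _ => by rw [F12.arr 11 (by decide)],
            fun v _ => by rw [F12.arr 7 (by decide), F12.arr 8 (by decide)]; simp⟩
          · revert r; decide
          · revert a; decide
          · rw [F12.arr a]
            revert a; decide
        refine P2.trans ⟨fun r hr => F3.reg r ?_, fun a ha => F3.arr a ?_, fun a ha i hi => ?_,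
            fun i _ => by rw [F3.arr 9 (by decide)],
            fun i _ => by rw [F3.arr 10 (by decide)], fun i _ => by rw [F3.arr 3 (by decide)],
            fun i _ => by rw [F3.arr 11 (by decide)],
            fun v _ => by rw [F3.arr 7 (by decide), F3.arr 8 (by decide)]; simp⟩
        · revert r; decide
        · revert a; decide
        · have hne : i ≠ d := by omega
          simp only [List.mem_cons, List.not_mem_nil, or_false] at ha
          rcases ha with rfl | rfl | rfl | rfl | rfl | rfl | rfl | rfl | rfl | rfl <;>
            simp [hc3, block, Code.run, Instr.eval, R2.depth, hne]
      refine Runs.block_cons (T := 8) (P := fun τ => τ = c3.run τ₂)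
        (Runs.straight (c := c3) rfl rfl) ?_
      rintro _ rfl
      refine Runs.block_cons (runs_invoke (d := d) (lo := e) (yl := yl) (j := j)
        (l := K ρ) (Y := Y) (X := X) (p := 1) (code := solveConn) rfl
        (fun τ hτ => hspec X (d + 1) e yl (K ρ) Y τ hτ hnd hres hY hconn) R3.env R3.depth
        ?_ ?_ ?_ ?_ ?_ ?_ R3.pend) ?_
      · simp [hc3, block, Code.run, Instr.eval, F2.reg 33 (by decide), q33]
      · simp [hc3, block, Code.run, Instr.eval, i27]
      · simp [hc3, block, Code.run, Instr.eval, R2.depth, R2.yfirst]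
      · simp [hc3, block, Code.run, Instr.eval, R2.depth, R2.ylast]
      · simp [hc3, block, Code.run, Instr.eval, R2.depth, R2.level]
      · rw [F3.arr 9 (by decide)]; exact iseg
      rintro τ₄ ⟨P4, h4, hO⟩
      have r3 : (c3.run τ₂).reg 3 = σ.reg 3 :=
        ((F3.reg 3 (by decide)).trans (F2.reg 3 (by decide))).trans (F1.reg 3 (by decide))
      have r4 : (c3.run τ₂).reg 4 = σ.reg 4 :=
        ((F3.reg 4 (by decide)).trans (F2.reg 4 (by decide))).trans (F1.reg 4 (by decide))
      have a3 : (c3.run τ₂).arr 3 = σ.arr 3 :=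
        (F3.arr 3 (by decide)).trans (F2.arr 3 (by decide))
      have a4 : (c3.run τ₂).arr 4 = σ.arr 4 :=
        (F3.arr 4 (by decide)).trans (F2.arr 4 (by decide))
      rw [r3, r4] at P4
      have R4 := R3.pres P4 h4 (by omega) le_rfl
      have hO' := hO.congr_left (σ' := σ) r3.symm r4.symm a3.symm
      set c5 : Code := block [ld 32 18 6, ld 33 22 6, .ite (.eq 5 7) .skip (addc 32 33 0)] with hc5
      have F5 := frame_run (c := c5) rfl τ₄
      have q18' : τ₄.arr 18 d = p + 1 := (P4.frames 18 (by simp) d (by omega)).trans q18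
      have q22' : τ₄.arr 22 d = e := (P4.frames 22 (by simp) d (by omega)).trans q22
      have P5 : Pres d e (yl + Y.length) (σ.reg 3) (σ.reg 4) {v | v ∈ K ρ} τ₄ (c5.run τ₄) :=
        F5.pres (by decide) (by decide) _ _ _ _ _ _
      have P45 := (P3.trans (P4.mono (by omega) (by omega) le_rfl le_rfl le_rfl
        (le_refl _))).trans P5
      refine Runs.block_cons (T := 5) (Runs.straight (c := c5) rfl
        (Q := fun τ => Pres d p (yl + Y.length) (σ.reg 3) (σ.reg 4) {v | v ∈ K ρ} σ τ ∧
          τ.arr 4 = σ.arr 4 ∧ Ready k L X d lo yl j l Y τ ∧ τ.reg 33 = e ∧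
          (∀ i < e, τ.arr 9 i = σ.arr 9 i) ∧
          τ.reg 32 = (if τ.reg 5 = 0 then p + 1 else e) ∧ Outcome G k X j (K ρ) Y σ τ)
        ⟨P45.mono le_rfl (by omega) le_rfl le_rfl le_rfl (le_refl _),
        (F5.arr 4 (by decide)).trans (h4.trans a4),
        R4.frame F5 (by decide) (by decide) fun i _ => by rw [F5.arr 9 (by decide)], ?_,
        P45.stack, ?_, hO'.congr_right (fun r hr => F5.reg r ?_) fun a ha => F5.arr a ?_⟩)
        fun _ h => Runs.block_nil h
      · by_cases h5' : τ₄.reg 5 = 0 <;>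
          simp [hc5, block, Code.run, Instr.eval, R4.depth, q22', Test.check, R4.env.zero, h5']
      · by_cases h5' : τ₄.reg 5 = 0 <;>
          simp [hc5, block, Code.run, Instr.eval, R4.depth, q18', q22', Test.check, R4.env.zero,
            h5']
      · revert r; decide
      · revert a; decide
    · rintro τ ⟨hP, h4, hR, h33', h9, h32', hO⟩
      have hPl : Pres d (lo + l.length) (yl + Y.length) (σ.reg 3) (σ.reg 4) {v | v ∈ l} σ τ :=
        hP.mono le_rfl hlp le_rfl le_rfl le_rfl fun v hv => hsub hv
      by_cases hf : τ.reg 5 = 0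
      · rw [if_pos hf] at h32'
        cases hO with
        | tree w g1 g2 g3 g4 =>
          refine (ih (p + 1) τ (by omega) (by omega) (fun ρ' hρ' => hK ρ' (by simp [hρ'])) hpw2
            hR (hseg.2.congr fun i _ hi => h9 i ?_) (fun ρ' hρ' => ?_) h32' h33' hf).mono le_rfl
            fun τ' ⟨j1, j2, j3⟩ => ⟨hPl.trans (j1.mono le_rfl le_rfl le_rfl (by rw [g2.pos]; omega)
              (by rw [g3]) (le_refl _)), j2.trans h4, ?_⟩
          · rw [List.length_map] at hi; omega
          · have hdis := hpw1 ρ' hρ'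
            -- The call has changed list entries only inside `K ρ`; the lists of the remaining
            -- components are disjoint from it and therefore intact.
            rw [(hP.keys ρ' (hdis ρ' (hK ρ' (by simp [hρ'])).1)).1]
            refine (hch ρ' (by simp [hρ'])).congr fun u hu => ?_
            obtain ⟨v, hv, rfl⟩ := List.mem_map.1 hu
            exact (hP.keys v (hdis v hv)).2
          · rcases j3 with ⟨k1, k2, ws, k3, k4⟩ | ⟨k1, k2⟩
            · exact .inl ⟨k1, k2.trans g3, w :: ws, by simpa using g2.trans k3,
                .cons g4 k4⟩
            · exact .inr ⟨k1, k2.of_flag_ne_zero k1 g3.symm fun _ h => h⟩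
        | obstruction O g1 => rw [hf] at g1; simp at g1
        | reject g1 => rw [hf] at g1; simp at g1
      -- After a result that is not a tree the position equals the end, and the loop stops with this
      -- result.
      · rw [if_neg hf] at h32'
        refine (Runs.while_done ?_ ⟨hPl, h4, .inr ⟨hf, hO.of_flag_ne_zero hf rfl hsub⟩⟩).mono
          (by omega) fun _ h => h
        simp [Test.Holds, h32', h33']

/-- The bound `time` is a multiple of `s + 1`; summation turns the extra `1` of each component into
the number of components. -/
theorem sum_time_le {k y j : ℕ} (xs : List ℕ) :
    (xs.map fun s => time k y j s + 6 * s + 40).sum ≤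
      time k y j (xs.sum + xs.length) + 6 * xs.sum + 40 * xs.length := by
  induction xs with
  | nil => simp
  | cons s xs ih =>
    simp only [List.map_cons, List.sum_cons, List.length_cons, time] at ih ⊢
    generalize unit k * 8 ^ (y + j * (k * maxObs k + 1) + 1) = U at *
    nlinarith

/-- The bound leaves room for several labellings of the current graph. -/
theorem mul_le_time (k y j s : ℕ) : 600 * ((k + 1) * 2 ^ (k + 2) * (s + 1)) ≤ time k y j s := by
  rw [time, unit]
  have : 1 ≤ 8 ^ (y + j * (k * maxObs k + 1) + 1) := Nat.one_le_pow _ _ (by norm_num)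
  calc 600 * ((k + 1) * 2 ^ (k + 2) * (s + 1))
      = 600 * ((k + 1) * 2 ^ (k + 2) * 1) * 1 * (s + 1) := by ring
    _ ≤ _ := by gcongr; omega

/-- After labelling, either a large distance is known, or the components are. There are at most as
many components as vertices, so solving all of them costs at most twice the bound for a connected
graph of the same size; the third multiple pays for the local work. -/
theorem specSolve_of_specConn (hA : G.IsAdjList L) (hK : ∀ c, (L c).length ≤ k) {y j : ℕ}
    (hspec : SpecConn G k L y j) : SpecSolve G k L y j := by
  intro X d lo yl l Y σ hready hl hR hY
  have hlocal := mul_le_time k y j l.length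
  have hlocal' : 600 * (l.length + 1) ≤ time k y j l.length := by
    refine le_trans ?_ hlocal
    have h1 : 1 ≤ (k + 1) * 2 ^ (k + 2) := Nat.mul_pos (by omega) (by positivity)
    nlinarith
  refine (Runs.block_cons (runs_loadFrame hready) fun τ₁ ⟨C1, _, _, _, R1, F1⟩ =>
    Runs.block_cons (runs_label hA hK hR R1.env C1) (T' := 2 * time k y j l.length + 100 *
      (l.length + 1)) fun τ₂ ⟨hst, hun, h7, h7', F2⟩ => ?_).mono (by omega) fun _ h => h
  have P1 : Pres d (lo + l.length) (yl + Y.length) (σ.reg 3) (σ.reg 4) {v | v ∈ l} σ τ₁ :=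
    F1.pres (by decide) (by decide) _ _ _ _ _ _
  have P2 : Pres d (lo + l.length) (yl + Y.length) (σ.reg 3) (σ.reg 4) {v | v ∈ l} τ₁ τ₂ := by
    refine ⟨fun r hr => F2.reg r ?_, fun a ha => F2.arr a ?_, fun a ha i hi => ?_,
      fun i _ => by rw [F2.arr 9 (by decide)],
      fun i _ => by rw [F2.arr 10 (by decide)], fun i _ => by rw [F2.arr 3 (by decide)],
      fun i _ => by rw [F2.arr 11 (by decide)],
      fun v hv => ⟨h7' v hv, by rw [F2.arr 8 (by decide)]⟩⟩
    · revert r; decide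
    · revert a; decide
    · rw [F2.arr a]; revert a; decide
  have C2 := C1.frame F2 (by decide) (by decide)
  have R2 := R1.frame F2 (by decide) (by decide) fun i _ => by rw [F2.arr 9 (by decide)]
  refine (Runs.block_cons (T' := 1) (P := Returns G k X d (lo + l.length) (yl + Y.length) j l Y σ)
    (Runs.ite (T := 2 * time k y j l.length + 100 * (l.length + 1) - 2) (fun hb => ?_)
      fun hb => ?_) fun τ h => Runs.block_nil h).mono (by omega) fun _ h => h
  · have hne : τ₂.reg 24 ≠ 0 := by
      simp only [Test.Holds, R2.env.zero] at hb; omega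
    have F3 := frame_run (c := cst 5 2) rfl τ₂
    refine (Runs.straight (c := cst 5 2) rfl ⟨(P1.trans P2).trans
      (F3.pres (by decide) (by decide) _ _ _ _ _ _), ?_, .reject ?_ (hun hne)⟩).mono ?_ fun _ h => h
    · simp only [Code.cost]; omega
    · rw [F3.arr 4 (by decide), F2.arr 4 (by decide), F1.arr 4 (by decide)]
    · simp [Code.run, Instr.eval]
  have h24 : τ₂.reg 24 = 0 := by simp only [Test.Holds, R2.env.zero] at hb; omega
  have hS := hst h24
  set f : Fin n ⊕ Fin m → ℕ := fun v => τ₂.arr 5 (vid v) with hf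
  set roots := l.filter fun v => f v = vid v with hroots
  have hrl : roots.length ≤ l.length := List.length_filter_le _ _
  refine (Runs.block_cons (runs_linkComponents C2 hl (fun v hv => ?_) h7)
    (T' := 2 * time k y j l.length + 80 * (l.length + 1))
    fun τ₃ ⟨hch, h27, hseg, h9, hkeys, F3⟩ => ?_).mono (by omega) fun _ h => h
  · obtain ⟨ρ, h1, h2, -⟩ := hS.root v hv
    exact ⟨ρ, h1, h2⟩
  have P3 : Pres d (lo + l.length) (yl + Y.length) (σ.reg 3) (σ.reg 4) {v | v ∈ l} τ₂ τ₃ := by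
    refine ⟨fun r hr => F3.reg r ?_, fun a ha => F3.arr a ?_, fun a ha i hi => ?_, h9,
      fun i _ => by rw [F3.arr 10 (by decide)], fun i _ => by rw [F3.arr 3 (by decide)],
      fun i _ => by rw [F3.arr 11 (by decide)], fun v hv => hkeys v hv⟩
    · revert r; decide
    · revert a; decide
    · rw [F3.arr a]; revert a; decide
  have R3 := R2.frame F3 (by decide) (by decide) h9
  have C3 : Cur l lo τ₃ := by
    refine C2.congr (fun r hr => F3.reg r ?_) fun i _ hi => h9 i hi
    revert r; decide
  have F4 := frame_run (c := addc 32 11 1) rfl τ₃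
  have A4 : ((addc 32 11 1).run τ₃).arr = τ₃.arr := rfl
  have C4 := C3.frame F4 (by decide) (by decide)
  have R4 := R3.frame F4 (by decide) (by decide) fun i _ => by rw [A4]
  have P4 : Pres d (lo + l.length) (yl + Y.length) (σ.reg 3) (σ.reg 4) {v | v ∈ l} σ
      ((addc 32 11 1).run τ₃) :=
    ((P1.trans P2).trans P3).trans (F4.pres (by decide) (by decide) _ _ _ _ _ _)
  have q32 : ((addc 32 11 1).run τ₃).reg 32 = lo + l.length + 1 := by
    simp [Code.run, Instr.eval, C3.last]
  have q27 : ((addc 32 11 1).run τ₃).reg 27 = lo + l.length + roots.length :=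
    (F4.reg 27 (by decide)).trans h27
  have eq3 : ((addc 32 11 1).run τ₃).reg 3 = σ.reg 3 := by
    rw [F4.reg 3 (by decide), F3.reg 3 (by decide), F2.reg 3 (by decide), F1.reg 3 (by decide)]
  have eq4 : ((addc 32 11 1).run τ₃).reg 4 = σ.reg 4 := by
    rw [F4.reg 4 (by decide), F3.reg 4 (by decide), F2.reg 4 (by decide), F1.reg 4 (by decide)]
  have ea3 : ((addc 32 11 1).run τ₃).arr 3 = σ.arr 3 := by
    rw [A4, F3.arr 3 (by decide), F2.arr 3 (by decide), F1.arr 3 (by decide)]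
  have ea4 : ((addc 32 11 1).run τ₃).arr 4 = σ.arr 4 := by
    rw [A4, F3.arr 4 (by decide), F2.arr 4 (by decide), F1.arr 4 (by decide)]
  refine (Runs.block_cons (T := 1) (T' := 2 * time k y j l.length + 80 * (l.length + 1) - 1)
    (P := fun τ => τ = (addc 32 11 1).run τ₃)
    (Runs.straight (c := addc 32 11 1) rfl rfl) ?_).mono (by omega) fun _ h => h
  rintro _ rfl
  generalize (addc 32 11 1).run τ₃ = τ₄ at *
  refine (Runs.block_cons (T' := 1) (P := Returns G k X d (lo + l.length) (yl + Y.length) j l Y σ)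
    (Runs.ite (T := 2 * time k y j l.length + 80 * (l.length + 1) - 3) (fun hb => ?_)
      fun hb => ?_) fun τ h => Runs.block_nil h).mono (by omega) fun _ h => h
  -- The register `32` is one more than the start of the list of roots, so the test asks for at
  -- least two roots.
  · have h2 : 2 ≤ roots.length := by
      simp only [Test.Holds, q32, q27] at hb
      omega
    have hconn : ¬ G.IsConn {v | v ∈ l} := by
      rw [isConn_iff_length_roots hS hl]
      exact (by omega : ¬ roots.length ≤ 1)
    have hsum : (roots.map fun ρ => time k y j (labelClass l f ρ).length +
        6 * (labelClass l f ρ).length + 40).sum ≤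
        2 * time k y j l.length + 46 * l.length := by
      have h3 := sum_length_labelClass_le (f := f) (show roots.Nodup from hl.filter _) l
      have h4 := sum_time_le (k := k) (y := y) (j := j)
        (roots.map fun ρ => (labelClass l f ρ).length)
      rw [List.map_map, List.length_map] at h4
      refine h4.trans ?_
      -- Both the total size of the classes and the number of roots are at most `l.length`.
      have h5 : time k y j ((roots.map fun ρ => (labelClass l f ρ).length).sum + roots.length) ≤
          2 * time k y j l.length := by
        rw [time, time, ← mul_assoc, mul_comm 2, mul_assoc _ 2]
        gcongr
        omega
      omega
    refine (Runs.block_cons (runs_emitHeader R4.env C4) fun τ₅ ⟨W5, F5⟩ => Runs.block_cons (T := 1)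
      (P := fun τ => τ = (sb 26 27 11).run τ₅) (Runs.straight (c := sb 26 27 11) rfl rfl) ?_
      (T' := 2 * time k y j l.length + 46 * l.length + 12)).mono (by omega) fun _ h => h
    rintro _ rfl
    have F6 := frame_run (c := sb 26 27 11) rfl τ₅
    have q26 : ((sb 26 27 11).run τ₅).reg 26 = roots.length := by
      simp [Code.run, Instr.eval, F5.reg 27 (by decide), F5.reg 11 (by decide), q27, C4.last]
    have A6 : ((sb 26 27 11).run τ₅).arr = τ₅.arr := rfl
    generalize (sb 26 27 11).run τ₅ = τ₆ at *
    refine (Runs.block_cons (T' := 2 * time k y j l.length + 46 * l.length + 9) runs_emit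
      fun τ₇ ⟨W7, F7⟩ => ?_).mono (by omega) fun _ h => h
    set c8 : Code := block [addc 32 11 0, addc 33 27 0, cst 5 0] with hc8
    have F8 := frame_run (c := c8) rfl τ₇
    have A8 : (c8.run τ₇).arr = τ₇.arr := rfl
    have F58 : Frame [3, 5, 12, 13, 14, 15, 16, 17, 18, 19, 26, 31, 32, 33] [3] τ₄
        (c8.run τ₇) :=
      (((F5.mono (by decide) (by decide)).trans (F6.mono (by decide) (by decide))).trans
        (F7.mono (by decide) (by decide))).trans (F8.mono (by decide) (by decide))
    have F57 : Frame [3, 5, 12, 13, 14, 15, 16, 17, 18, 19, 26, 31, 32, 33] [3] τ₄ τ₇ :=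
      ((F5.mono (by decide) (by decide)).trans (F6.mono (by decide) (by decide))).trans
        (F7.mono (by decide) (by decide))
    refine (Runs.block_cons (T := 4) (P := fun τ => τ = c8.run τ₇)
      (T' := 2 * time k y j l.length + 46 * l.length + 2)
      (Runs.straight (c := c8) rfl rfl) ?_).mono (by omega) fun _ h => h
    rintro _ rfl
    have R8 := R4.frame F58 (by decide) (by decide) fun i _ => by rw [F58.arr 9 (by decide)]
    have q32' : (c8.run τ₇).reg 32 = lo + l.length := by
      simp [hc8, block, Code.run, Instr.eval, F57.reg 11 (by decide), C4.last]
    have q33' : (c8.run τ₇).reg 33 = lo + l.length + roots.length := by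
      simp [hc8, block, Code.run, Instr.eval, F57.reg 27 (by decide), q27]
    have q5 : (c8.run τ₇).reg 5 = 0 := by simp [hc8, block, Code.run, Instr.eval]
    have W8 : Wrote (header l ++ [roots.length]) σ (c8.run τ₇) := by
      refine Wrote.congr (τ := τ₇) ?_ (F8.reg 3 (by decide)) (F8.arr 3 (by decide))
      rw [← q26]
      exact ((W5.congr_left eq3.symm ea3.symm).congr (F6.reg 3 (by decide))
        (F6.arr 3 (by decide))).trans W7
    have e4 : (c8.run τ₇).reg 4 = σ.reg 4 := (F58.reg 4 (by decide)).trans eq4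
    have P8 : Pres d (lo + l.length) (yl + Y.length) (σ.reg 3) (σ.reg 4) {v | v ∈ l} σ
        (c8.run τ₇) := by
      refine P4.trans ⟨fun r hr => F58.reg r ?_, fun a ha => F58.arr a ?_, fun a ha i hi => ?_,
        fun i _ => by rw [F58.arr 9 (by decide)], fun i _ => by rw [F58.arr 10 (by decide)],
        fun i hi => by rw [W8.below i hi, ea3],
        fun i _ => by rw [F58.arr 11 (by decide)],
        fun v hv => by rw [F58.arr 7 (by decide), F58.arr 8 (by decide)]; simp⟩
      · revert r; decide
      · revert a; decide
      · rw [F58.arr a]; revert a; decide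
    have e7 : (c8.run τ₇).arr 7 = τ₃.arr 7 := by rw [F58.arr 7 (by decide), A4]
    have e8 : (c8.run τ₇).arr 8 = τ₃.arr 8 := by rw [F58.arr 8 (by decide), A4]
    have e9 : (c8.run τ₇).arr 9 = τ₃.arr 9 := by rw [F58.arr 9 (by decide), A4]
    refine (Runs.block_cons (T' := 1) (runs_splitLoop hspec (e := lo + l.length + roots.length) hY
      (K := labelClass l f) roots (lo + l.length) (c8.run τ₇) rfl le_rfl (fun ρ hρ => ?_) ?_ R8
      (by rw [e9]; exact hseg) (fun ρ hρ => ?_) q32' q33' q5)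
      fun τ ⟨hP, h4, hO⟩ => Runs.block_nil ⟨P8.trans (hP.mono le_rfl le_rfl le_rfl
        (by rw [W8.pos]; omega) (by rw [e4]) (le_refl _)), h4.trans
        ((F58.arr 4 (by decide)).trans ea4), ?_⟩).mono (by omega) fun _ h => h
    · have hρ' := List.mem_filter.1 hρ
      simp only [decide_eq_true_eq] at hρ'
      exact ⟨mem_labelClass.2 hρ', nodup_labelClass hl ρ, isResidual_labelClass hS hR ρ,
        isConn_labelClass hS ρ, fun v hv => (mem_labelClass.1 hv).1⟩
    · refine (hl.filter _).imp fun {ρ ρ'} hne v hv hv' => hne ?_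
      rw [← vid_inj, ← (mem_labelClass.1 hv).2, ← (mem_labelClass.1 hv').2]
    · rw [e7, e8]
      exact hch ρ (List.mem_filter.1 hρ).1
    · rcases hO with ⟨g1, g2, ws, g3, g4⟩ | ⟨g1, g2⟩
      · refine .tree _ g1 (W8.trans g3) (g2.trans e4) ?_
        have := hasTree_split hl hconn (nodup_labelClasses hl)
          (fun K => isComponent_iff_labelClass hS) g4
        rwa [List.length_map] at this
      · exact g2.of_flag_ne_zero g1 e4.symm fun _ h => h
  · have hconn : G.IsConn {v | v ∈ l} := by
      rw [isConn_iff_length_roots hS hl]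
      simp only [Test.Holds, q32, q27] at hb
      exact (by omega : roots.length ≤ 1)
    refine (Runs.call (ps := procs) (p := 1) (body := solveConn) rfl
      (hspec X d lo yl l Y τ₄ R4 hl hR hY hconn)).mono (by omega) fun τ ⟨hP, h4, hO⟩ => ?_
    rw [eq3, eq4] at hP
    exact ⟨P4.trans hP, h4.trans ea4, hO.congr_left eq3.symm eq4.symm ea3.symm⟩

end RAM

/-! ### The subroutine for connected graphs -/

namespace RAM

open IncidenceGraph BackdoorTree

variable {n m : ℕ} {k : ℕ} {L : Fin m → List (Fin n × Bool)} {G : IncidenceGraph (Fin n) (Fin m)}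
  {X : Set (Fin n)} {d lo yl j : ℕ} {l : List (Fin n ⊕ Fin m)} {Y : List (Fin n)} {σ : State}

/-- The frames below `d` are not affected by writing to the frame `d`. -/
theorem Frame.pres_of {R A : List ℕ} {σ τ : State} (h : Frame R A σ τ)
    (hR : ∀ r ∈ [0, 1, 2, 6, 7, 8, 9], r ∉ R) (hA : ∀ a ∈ [0, 1, 2], a ∉ A)
    {d hi yh o b : ℕ} {S : Set (Fin n ⊕ Fin m)}
    (hframes : ∀ a ∈ [13, 14, 15, 16, 17, 18, 19, 20, 21, 22], ∀ i < d, τ.arr a i = σ.arr a i)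
    (h9 : ∀ i < hi, τ.arr 9 i = σ.arr 9 i) (h10 : ∀ i < yh, τ.arr 10 i = σ.arr 10 i)
    (h3 : ∀ i < o, τ.arr 3 i = σ.arr 3 i) (h11 : ∀ i < b, τ.arr 11 i = σ.arr 11 i)
    (h7 : ∀ v ∉ S, τ.arr 7 (vid v) = σ.arr 7 (vid v)) (h8 : τ.arr 8 = σ.arr 8) :
    Pres d hi yh o b S σ τ :=
  ⟨fun r hr => h.reg r (hR r hr), fun a ha => h.arr a (hA a ha), hframes, h9, h10, h3, h11,
    fun v hv => ⟨h7 v hv, by rw [h8]⟩⟩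

theorem Frame.frames {R A : List ℕ} {σ τ : State} (h : Frame R A σ τ)
    (hA : ∀ a ∈ [13, 14, 15, 16, 17, 18, 19, 20, 21, 22], a ∉ A) (d : ℕ) :
    ∀ a ∈ [13, 14, 15, 16, 17, 18, 19, 20, 21, 22], ∀ i < d, τ.arr a i = σ.arr a i :=
  fun a ha i _ => by rw [h.arr a (hA a ha)]

/-- The start of `solveConn`: nothing remains to be done for graphs without edges. -/
theorem runs_solveConn (hA : G.IsAdjList L) (hK : ∀ c, (L c).length ≤ k)
    (h : Ready k L X d lo yl j l Y σ) (hl : l.Nodup) (hR : G.IsResidual X {v | v ∈ l}) {T : ℕ}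
    (hT : ∀ τ, Ready k L X d lo yl j l Y τ → Cur l lo τ → τ.reg 28 = yl →
      τ.reg 29 = yl + Y.length → τ.reg 30 = j → (∃ e ∈ edges L X l, τ.reg 24 = n + e.1) →
      Frame [10, 11, 12, 13, 14, 15, 16, 17, 18, 24, 28, 29, 30] [] σ τ →
      Runs procs (.ite (.lt 28 29) branchCode
        (.ite (.eq 30 7) (block [st 11 4 24, addc 4 4 1, cst 5 1]) levelCode)) τ T
        (Returns G k X d (lo + l.length) (yl + Y.length) j l Y σ)) :
    Runs procs solveConn σ (T + 60 * ((k + 1) * (l.length + 1)))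
      (Returns G k X d (lo + l.length) (yl + Y.length) j l Y σ) := by
  refine (Runs.block_cons (runs_loadFrame h) fun τ₁ ⟨C1, h28, h29, h30, R1, F1⟩ =>
    Runs.block_cons (runs_findEdge hK R1.env C1) fun τ₂ ⟨hedge, F2⟩ => Runs.block_cons
      (T := T + (21 * l.length + 30) + 1) (T' := 1)
      (P := Returns G k X d (lo + l.length) (yl + Y.length) j l Y σ)
      (Runs.ite (fun hb => ?_) fun hb => ?_) fun τ h => Runs.block_nil h).mono ?_ fun _ h => h
  · have R2 := R1.frame F2 (by decide) (by decide) fun i _ => by rw [F2.arr 9 (by decide)]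
    have C2 := C1.frame F2 (by decide) (by decide)
    have h24 : τ₂.reg 24 = 0 := by simpa [Test.Holds, R2.env.zero] using hb
    have hnil : edges L X l = [] := by
      rcases hedge with ⟨-, h⟩ | ⟨e, -, -, h⟩
      · exact h
      · exact absurd h24 h
    have hleaf : {v | v ∈ l} ∈ G.edgeless := by
      intro s x c hx hc hs
      have : (c, x, s) ∈ edges L X l :=
        (mem_edges_iff hA).2 ⟨hc, hs, fun hX => hR.notMem x hX hx⟩
      rw [hnil] at this
      simp at this
    refine (Runs.block_cons (runs_emitHeader R2.env C2) fun τ₃ ⟨W3, F3⟩ =>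
      Runs.block_cons runs_emit fun τ₄ ⟨W4, F4⟩ =>
      Runs.straight (c := block [cst 5 0]) rfl ?_).mono (by simp [block, Code.cost]; omega)
        fun _ h => h
    have F5 := frame_run (c := block [cst 5 0]) rfl τ₄
    have F := ((((F1.mono (R' := [3, 5, 10, 11, 12, 13, 14, 15, 16, 17, 18, 19, 24, 26, 28, 29, 30,
      31]) (A' := [3]) (by decide) (by decide)).trans (F2.mono (by decide) (by decide))).trans
        (F3.mono (by decide) (by decide))).trans
        (F4.mono (by decide) (by decide))).trans (F5.mono (by decide) (by decide))
    have h7 : τ₃.reg 7 = 0 := by rw [F3.reg 7 (by decide), R2.env.zero]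
    rw [h7] at W4
    have W : Wrote (header l ++ [0]) σ ((block [cst 5 0]).run τ₄) :=
      ((W3.congr_left (by rw [F2.reg 3 (by decide), F1.reg 3 (by decide)])
        (by rw [F2.arr 3 (by decide), F1.arr 3 (by decide)])).trans W4).congr
          (F5.reg 3 (by decide)) (F5.arr 3 (by decide))
    exact ⟨F.pres_of (by decide) (by decide) (F.frames (by decide) d)
      (fun i _ => by rw [F.arr 9 (by decide)]) (fun i _ => by rw [F.arr 10 (by decide)]) W.below
      (fun i _ => by rw [F.arr 11 (by decide)]) (fun i _ => by rw [F.arr 7 (by decide)])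
      (F.arr 8 (by decide)), F.arr 4 (by decide), .tree _ (by simp [block, Code.run, Instr.eval])
      W (F.reg 4 (by decide)) (hasTree_leaf hl hleaf _)⟩
  · have R2 := R1.frame F2 (by decide) (by decide) fun i _ => by rw [F2.arr 9 (by decide)]
    have C2 := C1.frame F2 (by decide) (by decide)
    have h24 : τ₂.reg 24 ≠ 0 := by simpa [Test.Holds, R2.env.zero] using hb
    refine (hT τ₂ R2 C2 ((F2.reg 28 (by decide)).trans h28) ((F2.reg 29 (by decide)).trans h29)
      ((F2.reg 30 (by decide)).trans h30) ?_
      ((F1.mono (by decide) (by decide)).trans (F2.mono (by decide) (by decide)))).mono (by omega)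
      fun _ h => h
    rcases hedge with ⟨h, -⟩ | ⟨e, he, h, -⟩
    · exact absurd h h24
    · exact ⟨e, he, h⟩
  · nlinarith [Nat.zero_le (k * l.length)]

/-- The state between the two branches. -/
structure Branching (k : ℕ) (L : Fin m → List (Fin n × Bool)) (X : Set (Fin n)) (d lo yl j : ℕ)
    (l : List (Fin n ⊕ Fin m)) (Y : List (Fin n)) (x : Fin n) (σ : State) : Prop where
  ready : Ready k L X d lo yl j l Y σ
  cur : Cur l lo σ
  yfirst : σ.reg 28 = yl
  ylast : σ.reg 29 = yl + Y.length
  level : σ.reg 30 = j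
  var : σ.reg 22 = x
  saved : σ.arr 18 d = x

theorem time_mono_right {y s s' : ℕ} (h : s ≤ s') : time k y j s ≤ time k y j s' := by
  rw [time, time]; gcongr

/-- The state `Branching` holds before and after, so the same lemma serves for both values of the
variable. Only the outcome speaks about the graph in which `x` is assigned. -/
theorem runs_branchOn (hA : G.IsAdjList L) (hK : ∀ c, (L c).length ≤ k) {y : ℕ}
    (hspec : SpecSolve G k L y j) {x : Fin n} (h : Branching k L X d lo yl j l Y x σ)
    (hl : l.Nodup) (hR : G.IsResidual X {v | v ∈ l}) (hx : Sum.inl x ∈ l) (hY : Y.length = y)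
    (s : Bool) :
    Runs procs (branchOn s.toNat) σ (60 * ((k + 1) * (l.length + 1)) + 3 * time k y j l.length + 30)
      fun τ => Pres d (lo + l.length) (yl + Y.length) (σ.reg 3) (σ.reg 4) {v | v ∈ l} σ τ ∧
        τ.arr 4 = σ.arr 4 ∧ Branching k L X d lo yl j l Y x τ ∧
        Outcome G k (insert x X) j (assignList G l x s) Y σ τ := by
  have hxX : x ∉ X := fun hX => hR.notMem x hX hx
  have F1 : Frame [23] [] σ ((cst 23 s.toNat).run σ) :=
    frame_run (c := cst 23 s.toNat) rfl σ
  have R1 := h.ready.frame F1 (by decide) (by decide) fun i _ => by rw [F1.arr 9 (by decide)]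
  refine (Runs.block_cons (T := 1) (P := fun τ => τ = (cst 23 s.toNat).run σ)
    (Runs.straight (c := cst 23 s.toNat) rfl rfl)
    (T' := 60 * ((k + 1) * (l.length + 1)) + 3 * time k y j l.length + 29) ?_).mono (by omega)
    fun _ h => h
  rintro _ rfl
  refine (Runs.block_cons (runs_assignVar hA hK hR R1.env (h.cur.frame F1 (by decide) (by decide))
    (s := s) ((F1.reg 22 (by decide)).trans h.var) (by simp [Code.run, Instr.eval]) hx)
    (T' := 3 * time k y j l.length + 29) fun τ₂ ⟨h27, hseg, h9, ha4, E2, F2⟩ => ?_).mono (by omega)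
    fun _ h => h
  have R2 : ∀ {Z τ}, Env k L Z τ → (∀ r ∈ [6], τ.reg r = τ₂.reg r) →
      (∀ a ∈ [9, 10, 13, 14, 15, 16, 17], τ.arr a = τ₂.arr a) →
      Ready k L Z d lo yl j l Y τ := by
    intro Z τ hE hr ha
    have ha' : ∀ a ∈ [10, 13, 14, 15, 16, 17], τ.arr a = σ.arr a := by
      intro a h
      rw [ha a (by revert a; decide), F2.arr a (by revert a; decide),
        F1.arr a (by revert a; decide)]
    refine ⟨hE, ?_, ?_, ?_, ?_, ?_, ?_, ?_, ?_⟩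
    · rw [hr 6 (by simp), F2.reg 6 (by decide), R1.depth]
    · rw [ha' 13 (by simp), h.ready.first]
    · rw [ha' 14 (by simp), h.ready.last]
    · rw [ha' 15 (by simp), h.ready.yfirst]
    · rw [ha' 16 (by simp), h.ready.ylast]
    · rw [ha' 17 (by simp), h.ready.level]
    · rw [ha 9 (by simp)]
      exact R1.seg.congr fun i _ hi => h9 i (by simpa using hi)
    · rw [ha' 10 (by simp)]; exact h.ready.pend
  set c3 : Code := block [addc 34 11 0, addc 35 27 0] with hc3
  have F3 := frame_run (c := c3) rfl τ₂
  have A3 : (c3.run τ₂).arr = τ₂.arr := rfl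
  have R3 : Ready k L (insert x X) d lo yl j l Y (c3.run τ₂) :=
    R2 (E2.frame F3 (by decide) (by decide)) (fun r hr => F3.reg r (by revert r; decide))
      fun a _ => by rw [A3]
  have F12 := (F1.mono (R' := [12, 13, 14, 15, 16, 17, 18, 19, 23, 27, 34, 35]) (A' := [4, 9, 12])
    (by decide) (by decide)).trans (F2.mono (by decide) (by decide))
  have F13 := F12.trans (F3.mono (by decide) (by decide))
  refine (Runs.block_cons (T := 3) (P := fun τ => τ = c3.run τ₂) (Runs.straight (c := c3) rfl rfl)
    (T' := 3 * time k y j l.length + 25) ?_).mono (by omega) fun _ h => h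
  rintro _ rfl
  have hlen : (assignList G l x s).length ≤ l.length := List.length_filter_le _ _
  have htime := time_mono_right (k := k) (y := y) (j := j) hlen
  refine (Runs.block_cons (T' := 12) (runs_invoke (d := d) (lo := lo + l.length) (yl := yl) (j := j)
    (l := assignList G l x s) (Y := Y) (X := insert x X) (p := 0) (code := solve) rfl
    (fun τ hτ => hspec (insert x X) (d + 1) _ yl (assignList G l x s) Y τ hτ
      (hl.filter _) ?_ hY) R3.env R3.depth
    ?_ ?_ ?_ ?_ ?_ ?_ R3.pend) ?_).mono (by omega) fun _ h => h
  · rw [setOf_mem_assignList]; exact isResidual_assign hR x s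
  · simp [hc3, block, Code.run, Instr.eval, F12.reg 11 (by decide), h.cur.last]
  · simp [hc3, block, Code.run, Instr.eval, h27]
  · rw [F13.reg 28 (by decide), h.yfirst]
  · rw [F13.reg 29 (by decide), h.ylast]
  · rw [F13.reg 30 (by decide), h.level]
  · rw [A3]; exact hseg
  rintro τ₄ ⟨P4, h4, hO⟩
  have P3 : Pres d (lo + l.length) (yl + Y.length) (σ.reg 3) (σ.reg 4) {v | v ∈ l} σ
      (c3.run τ₂) :=
    F13.pres_of (by decide) (by decide) (F13.frames (by decide) d) (fun i hi => by
      rw [A3, h9 i hi, F1.arr 9 (by decide)]) (fun i _ => by rw [F13.arr 10 (by decide)])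
      (fun i _ => by rw [F13.arr 3 (by decide)]) (fun i _ => by rw [F13.arr 11 (by decide)])
      (fun i _ => by rw [F13.arr 7 (by decide)]) (F13.arr 8 (by decide))
  rw [F13.reg 3 (by decide), F13.reg 4 (by decide)] at P4
  have R4 := R3.pres P4 h4 (by omega) le_rfl
  have hsub : {v | v ∈ assignList G l x s} ⊆ {v | v ∈ l} := fun v hv => List.mem_of_mem_filter hv
  set c5 : Code := block [ld 22 18 6, st 4 22 7] with hc5
  have F5 := frame_run (c := c5) rfl τ₄
  have q18 : τ₄.arr 18 d = x := by
    rw [P4.frames 18 (by simp) d (by omega), F13.arr 18 (by decide), h.saved]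
  -- A variable of the graph is not in `X`, so its previous entry was `0` and writing `0` restores
  -- the array exactly.
  have ea4 : (c5.run τ₄).arr 4 = σ.arr 4 := by
    have hσx : σ.arr 4 x = 0 := (h.ready.env.assigned x).2 hxX
    have e2 : τ₂.arr 4 = Function.update (σ.arr 4) x 1 := by rw [ha4, F1.arr 4 (by decide)]
    simp only [hc5, block, Code.run, Instr.eval, R4.depth, q18, h4, A3, e2]
    simp [R4.env.zero, ← hσx]
  have P5 : Pres d (lo + l.length) (yl + Y.length) (σ.reg 3) (σ.reg 4) {v | v ∈ l} σ
      (c5.run τ₄) :=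
    (P3.trans (P4.mono (by omega) (by omega) le_rfl le_rfl le_rfl hsub)).trans
      (F5.pres (by decide) (by decide) _ _ _ _ _ _)
  have R5 : Ready k L X d lo yl j l Y (c5.run τ₄) := by
    refine ⟨h.ready.env.congr (fun r hr => P5.reg r ?_) fun a ha => ?_,
      (F5.reg 6 (by decide)).trans R4.depth, ?_, ?_, ?_, ?_, ?_, ?_, ?_⟩
    · revert r; decide
    · by_cases ha4 : a = 4
      · rw [ha4, ea4]
      · refine P5.input a ?_
        revert a; decide
    · rw [F5.arr 13 (by decide), R4.first]
    · rw [F5.arr 14 (by decide), R4.last]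
    · rw [F5.arr 15 (by decide), R4.yfirst]
    · rw [F5.arr 16 (by decide), R4.ylast]
    · rw [F5.arr 17 (by decide), R4.level]
    · rw [F5.arr 9 (by decide)]; exact R4.seg
    · rw [F5.arr 10 (by decide)]; exact R4.pend
  refine (Runs.block_cons (T := 3) (P := fun τ => τ = c5.run τ₄) (Runs.straight (c := c5) rfl rfl)
    (T' := 7) ?_).mono (by omega) fun _ h => h
  rintro _ rfl
  refine Runs.block_cons (runs_loadFrame R5) fun τ₆ ⟨C6, i28, i29, i30, R6, F6⟩ =>
    Runs.block_nil ⟨P5.trans (F6.pres (by decide) (by decide) _ _ _ _ _ _),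
      (F6.arr 4 (by decide)).trans ea4, ⟨R6, C6, i28, i29, i30, ?_, ?_⟩, ?_⟩
  · rw [F6.reg 22 (by decide)]
    simp [hc5, block, Code.run, Instr.eval, R4.depth, q18]
  · rw [F6.arr 18 (by decide), F5.arr 18 (by decide), q18]
  · refine (hO.congr_left (F13.reg 3 (by decide)).symm (F13.reg 4 (by decide)).symm
      (F13.arr 3 (by decide)).symm).congr_right (fun r hr => ?_) fun a ha => ?_
    · rw [F6.reg r, F5.reg r] <;> (revert r; decide)
    · rw [F6.arr a, F5.arr a] <;> (revert a; decide)

/-- A pending variable outside the graph is either assigned already or occurs in none of the clauses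
of the graph, since the graph contains all unassigned variables of its clauses. -/
theorem Obstruction.of_notMem {x : Fin n} {O : List (Fin m)} (h : Obstruction G k X j l Y O)
    (hR : G.IsResidual X {v | v ∈ l}) (hx : Sum.inl x ∉ l) : Obstruction G k X j l (x :: Y) O := by
  obtain ⟨X', h1, h2, h3, h4, h5⟩ := h.forces
  refine ⟨h.size, h.sub, X', h1, h2, h3, h4, fun z hz => ?_⟩
  rcases List.mem_cons.1 hz with rfl | hz
  · by_cases hX : z ∈ X
    · exact .inl (h1 hX)
    · exact .inr fun c hc hzc => hx (hR.closed c z (h.sub c hc) hzc hX)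
  · exact h5 z hz

/-- The obstruction was found after `x` had been assigned, so `x` belongs to its set `X'`. Thus a
single failing branch suffices, and the value `s` plays no further role. -/
theorem Obstruction.of_assign {x : Fin n} {s : Bool} {O : List (Fin m)}
    (h : Obstruction G k (insert x X) j (assignList G l x s) Y O) :
    Obstruction G k X j l (x :: Y) O := by
  obtain ⟨X', h1, h2, h3, h4, h5⟩ := h.forces
  refine ⟨h.size, fun c hc => List.mem_of_mem_filter (h.sub c hc), X',
    (Set.subset_insert _ _).trans h1, h2, h3, h4, fun z hz => ?_⟩
  rcases List.mem_cons.1 hz with rfl | hz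
  · exact .inl (h1 (Set.mem_insert _ _))
  · exact h5 z hz

theorem Outcome.of_assign {x : Fin n} {s : Bool} {σ' τ : State}
    (h : Outcome G k (insert x X) j (assignList G l x s) Y σ τ) (hτ : τ.reg 5 ≠ 0)
    (h4 : σ'.reg 4 = σ.reg 4) : Outcome G k X j l (x :: Y) σ' τ := by
  cases h with
  | tree w h1 => exact absurd h1 hτ
  | obstruction O h1 h2 h3 h5 =>
    exact .obstruction O h1 h2.of_assign (by rw [h3, h4]) (by rw [h4]; exact h5)
  | reject h1 h2 => exact .reject h1 h2

theorem Outcome.of_notMem {x : Fin n} {τ : State} (h : Outcome G k X j l Y σ τ)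
    (hR : G.IsResidual X {v | v ∈ l}) (hx : Sum.inl x ∉ l) :
    Outcome G k X j l (x :: Y) σ τ := by
  cases h with
  | tree w h1 h2 h3 h4 => exact .tree w h1 h2 h3 (h4.mono (by simp))
  | obstruction O h1 h2 h3 h5 => exact .obstruction O h1 (h2.of_notMem hR hx) h3 h5
  | reject h1 h2 => exact .reject h1 h2

/-- The factor `8` for a pending variable covers two calls of `solve`, each worth three times the
bound for connected graphs, and leaves two such bounds for the local work. -/
theorem mul_time_le (k y j s : ℕ) : 8 * time k y j s = time k (y + 1) j s := by
  rw [time, time, show y + 1 + j * (k * maxObs k + 1) + 1 = (y + j * (k * maxObs k + 1) + 1) + 1 by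
    ring, pow_succ]
  ring

set_option maxRecDepth 4000 in
/-- The case of a pending variable. -/
theorem specConn_succ (hA : G.IsAdjList L) (hK : ∀ c, (L c).length ≤ k) {y : ℕ}
    (hsolve : SpecSolve G k L y j) (hconn : SpecConn G k L y j) : SpecConn G k L (y + 1) j := by
  intro X d lo yl l Y₀ σ hready hl hR hY hS
  obtain ⟨x, Y, rfl⟩ : ∃ x Y, Y₀ = x :: Y := by
    cases Y₀ with
    | nil => simp at hY
    | cons x Y => exact ⟨x, Y, rfl⟩
  have hY' : Y.length = y := by simpa using hY
  have hlocal : 300 * ((k + 1) * (l.length + 1)) ≤ time k y j l.length := by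
    refine le_trans ?_ (mul_le_time k y j l.length)
    have h1 : 1 ≤ 2 ^ (k + 2) := Nat.one_le_two_pow
    calc 300 * ((k + 1) * (l.length + 1)) ≤ 600 * ((k + 1) * 1 * (l.length + 1)) := by
          rw [mul_one]; omega
      _ ≤ _ := by gcongr
  have hlocal' : l.length + 1 ≤ (k + 1) * (l.length + 1) := Nat.le_mul_of_pos_left _ (by omega)
  -- The main term comes from the two values of `x`; skipping an absent variable costs only one call
  -- of `solveConn`.
  refine (runs_solveConn hA hK hready hl hR (T := 6 * time k y j l.length + 152 * ((k + 1) *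
    (l.length + 1)) + 110) fun τ₀ R0 C0 i28 i29 i30 _ F0 => ?_).mono
    (by rw [← mul_time_le]; omega) fun _ h => h
  refine (Runs.ite (T := 6 * time k y j l.length + 152 * ((k + 1) *
    (l.length + 1)) + 109) (fun _ => ?_) fun hb => absurd ?_ hb).mono (by omega) fun _ h => h
  swap
  · simp [Test.Holds, i28, i29]
  set c1 : Code := block [ld 22 10 28, addc 28 28 1, st 15 6 28] with hc1
  have F1 := frame_run (c := c1) rfl τ₀
  have hx10 : τ₀.arr 10 yl = x := by
    have := R0.pend
    rw [List.map_cons, seg_cons] at this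
    exact this.1
  have q22 : (c1.run τ₀).reg 22 = vid (.inl x : Fin n ⊕ Fin m) := by
    simp [hc1, block, Code.run, Instr.eval, i28, hx10, vid]
  have q28 : (c1.run τ₀).reg 28 = yl + 1 := by
    simp [hc1, block, Code.run, Instr.eval, i28]
  have ylen : yl + (x :: Y).length = yl + 1 + Y.length := by simp; omega
  have R1 : Ready k L X d lo (yl + 1) j l Y (c1.run τ₀) := by
    refine ⟨R0.env.frame F1 (by decide) (by decide), (F1.reg 6 (by decide)).trans R0.depth,
      ?_, ?_, ?_, ?_, ?_, ?_, ?_⟩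
    · rw [F1.arr 13 (by decide), R0.first]
    · rw [F1.arr 14 (by decide), R0.last]
    · simp [hc1, block, Code.run, Instr.eval, i28, R0.depth]
    · rw [F1.arr 16 (by decide), R0.ylast, ylen]
    · rw [F1.arr 17 (by decide), R0.level]
    · rw [F1.arr 9 (by decide)]; exact R0.seg
    · rw [F1.arr 10 (by decide)]
      have := R0.pend
      rw [List.map_cons, seg_cons] at this
      exact this.2
  have fr1 : ∀ a ∈ [13, 14, 15, 16, 17, 18, 19, 20, 21, 22], ∀ i < d,
      (c1.run τ₀).arr a i = τ₀.arr a i := by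
    intro a ha i hi
    by_cases h15 : a = 15
    · have : i ≠ d := by omega
      subst h15
      simp [hc1, block, Code.run, Instr.eval, R0.depth, this]
    · rw [F1.arr a]
      simp [hc1, block, Code.warrs, h15]
  have P1 : Pres d (lo + l.length) (yl + (x :: Y).length) (σ.reg 3) (σ.reg 4) {v | v ∈ l} σ
      (c1.run τ₀) :=
    (F0.pres (by decide) (by decide) _ _ _ _ _ _).trans (F1.pres_of (by decide) (by decide) fr1
      (fun i _ => by rw [F1.arr 9 (by decide)]) (fun i _ => by rw [F1.arr 10 (by decide)])
      (fun i _ => by rw [F1.arr 3 (by decide)]) (fun i _ => by rw [F1.arr 11 (by decide)])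
      (fun i _ => by rw [F1.arr 7 (by decide)]) (F1.arr 8 (by decide)))
  have C1 := C0.frame F1 (by decide) (by decide)
  refine (Runs.block_cons (T := 4) (P := fun τ => τ = c1.run τ₀) (Runs.straight (c := c1) rfl rfl)
    (T' := 6 * time k y j l.length + 152 * ((k + 1) * (l.length + 1)) + 105) ?_).mono (by omega)
    fun _ h => h
  rintro _ rfl
  refine (Runs.block_cons (runs_isMember C1 q22)
    (T' := 6 * time k y j l.length + 146 * ((k + 1) * (l.length + 1)) + 100)
    fun τ₂ ⟨hmem, hnmem, F2⟩ => ?_).mono (by omega) fun _ h => h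
  have R2 := R1.frame F2 (by decide) (by decide) fun i _ => by rw [F2.arr 9 (by decide)]
  have C2 := C1.frame F2 (by decide) (by decide)
  have P2 : Pres d (lo + l.length) (yl + (x :: Y).length) (σ.reg 3) (σ.reg 4) {v | v ∈ l} σ τ₂ :=
    P1.trans (F2.pres (by decide) (by decide) _ _ _ _ _ _)
  have F02 : Frame [10, 11, 12, 13, 14, 15, 16, 17, 18, 22, 24, 28, 29, 30] [15] σ τ₂ :=
    ((F0.mono (by decide) (by decide)).trans (F1.mono (by decide) (by decide))).trans
      (F2.mono (by decide) (by decide))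
  refine (Runs.block_cons (T' := 1)
    (P := Returns G k X d (lo + l.length) (yl + (x :: Y).length) j l (x :: Y) σ)
    (Runs.ite (T := 6 * time k y j l.length + 146 * ((k + 1) * (l.length + 1)) + 98) (fun hb => ?_)
      fun hb => ?_) fun τ h => Runs.block_nil h).mono (by omega) fun _ h => h
  · have hx : Sum.inl x ∉ l := fun hx => by
      have := hmem hx
      simp [Test.Holds, R2.env.zero, this] at hb
    refine (Runs.call (ps := procs) (p := 1) (body := solveConn) rfl
      (hconn X d lo (yl + 1) l Y τ₂ R2 hl hR hY' hS)).mono (by omega) fun τ ⟨hP, h4, hO⟩ => ?_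
    rw [F02.reg 3 (by decide), F02.reg 4 (by decide), ← ylen] at hP
    exact ⟨P2.trans hP, h4.trans (F02.arr 4 (by decide)),
      (hO.congr_left (F02.reg 3 (by decide)).symm (F02.reg 4 (by decide)).symm
        (F02.arr 3 (by decide)).symm).of_notMem hR hx⟩
  have hx : Sum.inl x ∈ l := by
    by_contra hx
    exact hb (by simp [Test.Holds, R2.env.zero, hnmem hx])
  have q22' : τ₂.reg 22 = x := (F2.reg 22 (by decide)).trans q22
  set c3 : Code := st 18 6 22 with hc3
  have F3 : Frame [] [18] τ₂ (c3.run τ₂) := frame_run (c := c3) rfl τ₂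
  have q18 : (c3.run τ₂).arr 18 d = x := by
    simp [hc3, Code.run, Instr.eval, R2.depth, q22']
  have fr3 : ∀ a ∈ [13, 14, 15, 16, 17, 18, 19, 20, 21, 22], ∀ i < d,
      (c3.run τ₂).arr a i = τ₂.arr a i := by
    intro a ha i hi
    by_cases h15 : a = 18
    · have : i ≠ d := by omega
      subst h15
      simp [hc3, Code.run, Instr.eval, R2.depth, this]
    · rw [F3.arr a (by simpa using h15)]
  have R3 := R2.frame F3 (by decide) (by decide) fun i _ => by rw [F3.arr 9 (by decide)]
  have C3 := C2.frame F3 (by decide) (by decide)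
  have P3 : Pres d (lo + l.length) (yl + (x :: Y).length) (σ.reg 3) (σ.reg 4) {v | v ∈ l} σ
      (c3.run τ₂) :=
    P2.trans (F3.pres_of (by decide) (by decide) fr3
      (fun i _ => by rw [F3.arr 9 (by decide)]) (fun i _ => by rw [F3.arr 10 (by decide)])
      (fun i _ => by rw [F3.arr 3 (by decide)]) (fun i _ => by rw [F3.arr 11 (by decide)])
      (fun i _ => by rw [F3.arr 7 (by decide)]) (F3.arr 8 (by decide)))
  refine (Runs.block_cons (T := 1) (P := fun τ => τ = c3.run τ₂) (Runs.straight (c := c3) rfl rfl)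
    (T' := 6 * time k y j l.length + 146 * ((k + 1) * (l.length + 1)) + 97) ?_).mono (by omega)
    fun _ h => h
  rintro _ rfl
  have F03 := (F02.mono (R' := [3, 10, 11, 12, 13, 14, 15, 16, 17, 18, 19, 20, 22, 24, 26, 28, 29,
    30, 31]) (A' := [3, 15, 18]) (by decide) (by decide)).trans (F3.mono (by decide) (by decide))
  generalize c3.run τ₂ = τ₃ at *
  refine (Runs.block_cons (runs_emitHeader R3.env C3) fun τ₄ ⟨W4, F4⟩ =>
    Runs.block_cons runs_emit fun τ₅ ⟨W5, F5⟩ => Runs.block_cons runs_emit fun τ₆ ⟨W6, F6⟩ =>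
    Runs.block_cons runs_emit fun τ₇ ⟨W7, F7⟩ =>
    Runs.block_cons (T := 1) (P := fun τ => τ.reg 20 = 2 ∧ Frame [20] [] τ₇ τ)
      (Runs.straight (c := cst 20 2) rfl ⟨by simp [Code.run, Instr.eval],
        frame_run (c := cst 20 2) rfl τ₇⟩) fun τ₈ ⟨i20, F8⟩ =>
    Runs.block_cons runs_emit fun τ₉ ⟨W9, F9⟩ =>
    (?_ : Runs _ _ _ (6 * time k y j l.length + 120 * ((k + 1) * (l.length + 1)) + 62) _)).mono
    (by omega) fun _ h => h
  have F39 : Frame [3, 12, 13, 14, 15, 16, 17, 18, 19, 20, 26, 31] [3] τ₃ τ₉ :=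
    (((((F4.mono (by decide) (by decide)).trans (F5.mono (by decide) (by decide))).trans
      (F6.mono (by decide) (by decide))).trans (F7.mono (by decide) (by decide))).trans
      (F8.mono (by decide) (by decide))).trans (F9.mono (by decide) (by decide))
  have e1 : τ₄.reg 8 = 1 := by rw [F4.reg 8 (by decide), R3.env.one]
  have e2 : τ₅.reg 8 = 1 := by rw [F5.reg 8 (by decide), e1]
  have e3 : τ₆.reg 22 = x := by
    rw [F6.reg 22 (by decide), F5.reg 22 (by decide), F4.reg 22 (by decide), F3.reg 22 (by decide),
      q22']
  rw [e1] at W5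
  rw [e2] at W6
  rw [e3] at W7
  rw [i20] at W9
  have W39 : Wrote (header l ++ [1] ++ [1, x.val, 2]) τ₃ τ₉ := by
    simpa using (((W4.trans W5).trans W6).trans W7).trans
      (W9.congr_left (F8.reg 3 (by decide)).symm (F8.arr 3 (by decide)).symm)
  have F09 := F03.trans (F39.mono (by decide) (by decide))
  have W : Wrote (header l ++ [1] ++ [1, x.val, 2]) σ τ₉ := W39.congr_left
    ((F3.reg 3 (by decide)).trans (F02.reg 3 (by decide))).symm
    ((F3.arr 3 (by decide)).trans (F02.arr 3 (by decide))).symm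
  have P9 : Pres d (lo + l.length) (yl + (x :: Y).length) (σ.reg 3) (σ.reg 4) {v | v ∈ l} σ τ₉ :=
    P3.trans (F39.pres_of (by decide) (by decide) (F39.frames (by decide) d)
      (fun i _ => by rw [F39.arr 9 (by decide)]) (fun i _ => by rw [F39.arr 10 (by decide)])
      (fun i hi => W39.below i (by
        rwa [F3.reg 3 (by decide), F02.reg 3 (by decide)]))
      (fun i _ => by rw [F39.arr 11 (by decide)])
      (fun i _ => by rw [F39.arr 7 (by decide)]) (F39.arr 8 (by decide)))
  have B9 : Branching k L X d lo (yl + 1) j l Y x τ₉ := by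
    refine ⟨R3.frame F39 (by decide) (by decide) fun i _ => by rw [F39.arr 9 (by decide)],
      C3.frame F39 (by decide) (by decide), ?_, ?_, ?_, ?_, ?_⟩
    · rw [F39.reg 28 (by decide), F3.reg 28 (by decide), F2.reg 28 (by decide), q28]
    · rw [F39.reg 29 (by decide), F3.reg 29 (by decide), F2.reg 29 (by decide),
        F1.reg 29 (by decide), i29, ylen]
    · rw [F39.reg 30 (by decide), F3.reg 30 (by decide), F2.reg 30 (by decide),
        F1.reg 30 (by decide), i30]
    · rw [F39.reg 22 (by decide), F3.reg 22 (by decide), q22']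
    · rw [F39.arr 18 (by decide), q18]
  have e4 : τ₉.reg 4 = σ.reg 4 := F09.reg 4 (by decide)
  have ea4 : τ₉.arr 4 = σ.arr 4 := F09.arr 4 (by decide)
  refine (Runs.block_cons (runs_branchOn hA hK hsolve B9 hl hR hx hY' true)
    (T' := 3 * time k y j l.length + 60 * ((k + 1) * (l.length + 1)) + 32)
    fun τ ⟨hP, h4, hB, hO⟩ => ?_).mono (by omega) fun _ h => h
  rw [← ylen, e4] at hP
  have P10 := P9.trans (hP.mono le_rfl le_rfl le_rfl (by rw [W.pos]; omega) le_rfl (le_refl _))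
  have hz : τ.reg 7 = 0 := hB.ready.env.zero
  refine (Runs.block_cons (T' := 1)
    (P := Returns G k X d (lo + l.length) (yl + (x :: Y).length) j l (x :: Y) σ)
    (Runs.ite (T := 3 * time k y j l.length + 60 * ((k + 1) * (l.length + 1)) + 30) (fun hb => ?_)
      fun hb => (Runs.skip ?_).mono (by omega) fun _ h => h) fun τ h => Runs.block_nil h).mono
      (by omega) fun _ h => h
  swap
  · have hf : τ.reg 5 ≠ 0 := by simpa [Test.Holds, hz] using hb
    exact ⟨P10, h4.trans ea4, hO.of_assign hf e4.symm⟩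
  have hf : τ.reg 5 = 0 := by simpa [Test.Holds, hz] using hb
  cases hO with
  | obstruction O g => rw [hf] at g; simp at g
  | reject g => rw [hf] at g; simp at g
  | tree w₁ g1 g2 g3 g4 =>
    refine (runs_branchOn hA hK hsolve hB hl hR hx hY' false).mono (by omega)
      fun τ' ⟨hP', h4', hB', hO'⟩ => ?_
    have W1 := W.trans g2
    rw [← ylen, g3, e4] at hP'
    refine ⟨P10.trans (hP'.mono le_rfl le_rfl le_rfl (by rw [W1.pos]; omega) le_rfl (le_refl _)),
      (h4'.trans h4).trans ea4, ?_⟩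
    by_cases hf' : τ'.reg 5 = 0
    · cases hO' with
      | obstruction O g => rw [hf'] at g; simp at g
      | reject g => rw [hf'] at g; simp at g
      | tree w₂ g1' g2' g3' g4' =>
        refine .tree _ g1' (W1.trans g2') (g3'.trans (g3.trans e4)) ?_
        rw [setOf_mem_assignList] at g4 g4'
        exact (hasTree_branch hl hS hx g4 g4').mono (by simp only [List.length_cons]; omega)
    · exact hO'.of_assign hf' (g3.trans e4).symm

/-- The case of level `0` without pending variables. -/
theorem specConn_zero (hA : G.IsAdjList L) (hK : ∀ c, (L c).length ≤ k) :
    SpecConn G k L 0 0 := by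
  intro X d lo yl l Y σ hready hl hR hY hS
  obtain rfl : Y = [] := List.length_eq_zero_iff.1 hY
  have hlocal : 300 * ((k + 1) * (l.length + 1)) ≤ time k 0 0 l.length := by
    refine le_trans ?_ (mul_le_time k 0 0 l.length)
    have h1 : 1 ≤ 2 ^ (k + 2) := Nat.one_le_two_pow
    calc 300 * ((k + 1) * (l.length + 1)) ≤ 600 * ((k + 1) * 1 * (l.length + 1)) := by
          rw [mul_one]; omega
      _ ≤ _ := by gcongr
  have hlocal' : l.length + 1 ≤ (k + 1) * (l.length + 1) := Nat.le_mul_of_pos_left _ (by omega)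
  refine (runs_solveConn hA hK hready hl hR (T := 10) fun τ₀ R0 C0 i28 i29 i30 he F0 => ?_).mono
    (by omega) fun _ h => h
  obtain ⟨⟨c, x, s⟩, he, i24⟩ := he
  refine (Runs.ite (T := 9) (fun hb => absurd hb ?_) fun _ => Runs.ite (T := 8) (fun _ => ?_)
    fun hb => absurd ?_ hb).mono (by omega) fun _ h => h
  · simp [Test.Holds, i28, i29]
  swap
  · simp [Test.Holds, i30, R0.env.zero]
  set c1 : Code := block [st 11 4 24, addc 4 4 1, cst 5 1] with hc1
  have F1 := frame_run (c := c1) rfl τ₀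
  have F := (F0.mono (R' := [4, 5, 10, 11, 12, 13, 14, 15, 16, 17, 18, 24, 28, 29, 30])
    (A' := [11]) (by decide) (by decide)).trans (F1.mono (by decide) (by decide))
  have e4 : τ₀.reg 4 = σ.reg 4 := F0.reg 4 (by decide)
  have e11 : (c1.run τ₀).arr 11 = Function.update (σ.arr 11) (σ.reg 4) (n + c) := by
    simp [hc1, block, Code.run, Instr.eval, i24, e4, F0.arr 11]
  -- Any clause that still has an unassigned variable is an obstruction of level `0`, with `X`
  -- itself as the set of assigned variables.
  obtain ⟨h1, h2, h3⟩ := (mem_edges_iff hA).1 he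
  refine (Runs.straight (c := c1) rfl ⟨F.pres_of (by decide) (by decide) (F.frames (by decide) d)
      (fun i _ => by rw [F.arr 9 (by decide)]) (fun i _ => by rw [F.arr 10 (by decide)])
      (fun i _ => by rw [F.arr 3 (by decide)])
      (fun i hi => by rw [e11, Function.update_of_ne (by omega)])
      (fun i _ => by rw [F.arr 7 (by decide)]) (F.arr 8 (by decide)), F.arr 4 (by decide),
      .obstruction [c] ?_ ⟨by simp [obsSize], by simpa using h1, X, le_refl _, ?_, ?_, ?_,
        by simp⟩ ?_ ?_⟩).mono (by simp [hc1, block, Code.cost]) fun _ h => h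
  · simp [hc1, block, Code.run, Instr.eval]
  · have : {c' | c' ∈ [c]} = {c} := by ext; simp
    rw [this]; exact safe_singleton c X
  · have : {c' | c' ∈ [c]} = {c} := by ext; simp
    rw [this]; exact linked_singleton c X
  · have : {c' | c' ∈ [c]} = {c} := by ext; simp
    rw [this]; exact forces_singleton ⟨s, h2⟩ h3
  · simp [hc1, block, Code.run, Instr.eval, e4]
  · rw [e11]; simp [Seg]

end RAM

/-! ### Obstructions of higher levels -/

namespace RAM

open IncidenceGraph BackdoorTree

variable {n m : ℕ} {k : ℕ} {L : Fin m → List (Fin n × Bool)} {G : IncidenceGraph (Fin n) (Fin m)}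
  {X : Set (Fin n)} {d lo yl j : ℕ} {l : List (Fin n ⊕ Fin m)} {Y : List (Fin n)} {σ : State}

/-- Adding the constant of the recursion turns it into pure doubling. -/
theorem obsSize_add (k j : ℕ) :
    obsSize k j + 4 * 2 ^ (k + 2) = 2 ^ j * (1 + 4 * 2 ^ (k + 2)) := by
  induction j with
  | zero => simp [obsSize]
  | succ j ih =>
    rw [obsSize, pow_succ 2 j, mul_comm (2 ^ j) 2, mul_assoc, ← ih]
    ring

/-- For `j < k` the closed form is at most `8 * 4 ^ k`, and `2 * 4 ^ k ≤ 6 ^ k` from `k = 2` on.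
Smaller `k` only allow a single clause. -/
theorem obsSize_le_maxObs (h : j < k) : obsSize k j ≤ maxObs k := by
  rcases Nat.lt_or_ge k 2 with hk | hk
  · obtain rfl : j = 0 := by omega
    exact Nat.mul_pos (by norm_num) (by positivity)
  · have h1 := obsSize_add k j
    have h2 : 2 ^ (j + 1) ≤ 2 ^ k := Nat.pow_le_pow_right (by norm_num) h
    have h3 : ∀ i, 2 ≤ i → 2 * 4 ^ i ≤ 6 ^ i := fun i hi => by
      induction i, hi using Nat.le_induction with
      | base => norm_num
      | succ i _ ih => rw [pow_succ, pow_succ]; omega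
    have h4 := h3 k hk
    have h5 : 2 ^ (j + 1) * (1 + 4 * 2 ^ (k + 2)) ≤ 2 ^ k * (1 + 4 * 2 ^ (k + 2)) :=
      Nat.mul_le_mul_right _ h2
    have h6 : 2 ^ k * 2 ^ k = 4 ^ k := by rw [← mul_pow]; norm_num
    rw [pow_succ, pow_add] at h5
    rw [pow_add 2 k] at h1
    rw [maxObs]
    generalize 2 ^ k = a at *
    generalize 2 ^ j = b at *
    nlinarith

/-- The combination of an obstruction with an obstruction that survives branching on the
neighbours of the first one. -/
theorem Obstruction.join (hR : G.IsResidual X {v | v ∈ l}) {O₁ O₂ P₁ P₂ : List (Fin m)}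
    (h₁ : Obstruction G k X j l [] O₁) (h₂ : Obstruction G k X j l Y O₂)
    (hY : ∀ x ∉ X, ∀ c ∈ O₁, G.Occurs x c → x ∈ Y) {c₁ c₂ : Fin m} {ρ : Fin n ⊕ Fin m}
    (hc₁ : c₁ ∈ O₁) (hc₂ : c₂ ∈ O₂) (hP₁ : P₁.length ≤ 2 * 2 ^ (k + 2))
    (hP₂ : P₂.length ≤ 2 * 2 ^ (k + 2)) (hl₁ : ∀ c ∈ P₁, Sum.inr c ∈ l)
    (hl₂ : ∀ c ∈ P₂, Sum.inr c ∈ l)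
    (hr₁ : ∀ O : Set (Fin m), (∀ c ∈ P₁, c ∈ O) → Sum.inr c₁ ∈ G.span O X →
      (G.restrict (G.span O X)).Reachable (.inr c₁) ρ ∧
        ∀ c ∈ P₁, (G.restrict (G.span O X)).Reachable (.inr c₁) (.inr c))
    (hr₂ : ∀ O : Set (Fin m), (∀ c ∈ P₂, c ∈ O) → Sum.inr c₂ ∈ G.span O X →
      (G.restrict (G.span O X)).Reachable (.inr c₂) ρ ∧
        ∀ c ∈ P₂, (G.restrict (G.span O X)).Reachable (.inr c₂) (.inr c)) :
    Obstruction G k X (j + 1) l [] (O₁ ++ O₂ ++ P₁ ++ P₂) := by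
  have hsub : ∀ c ∈ O₁ ++ O₂ ++ P₁ ++ P₂, Sum.inr c ∈ l := by
    intro c hc
    simp only [List.mem_append] at hc
    rcases hc with ((h | h) | h) | h
    exacts [h₁.sub c h, h₂.sub c h, hl₁ c h, hl₂ c h]
  obtain ⟨X₁, a1, a2, a3, a4, -⟩ := h₁.forces
  obtain ⟨X₂, b1, b2, b3, b4, b5⟩ := h₂.forces
  set O : Set (Fin m) := {c | c ∈ O₁ ++ O₂ ++ P₁ ++ P₂} with hO
  have s₁ : {c | c ∈ O₁} ⊆ O := fun c hc => by
    have hc' : c ∈ O₁ := hc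
    simp [hO, hc']
  have s₂ : {c | c ∈ O₂} ⊆ O := fun c hc => by
    have hc' : c ∈ O₂ := hc
    simp [hO, hc']
  have hsafe : G.Safe O X := fun x hx => by
    obtain ⟨s, hs⟩ := hR.safe x hx
    exact ⟨s, fun c hc => hs c (hsub c hc)⟩
  obtain ⟨q1, q2⟩ := hr₁ O (fun c hc => by simp [hO, hc]) (s₁ hc₁)
  obtain ⟨q3, q4⟩ := hr₂ O (fun c hc => by simp [hO, hc]) (s₂ hc₂)
  have hlink : G.Linked O X := by
    -- Both paths lead to `ρ`, so everything is reached from `c₁`. The links inside `O₁` and `O₂`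
    -- avoid larger sets of variables than `X` and hence remain available.
    have key : ∀ c ∈ O, (G.restrict (G.span O X)).Reachable (.inr c₁) (.inr c) := by
      intro c hc
      simp only [hO, Set.mem_ofPred_eq, List.mem_append] at hc
      have hmid := q1.trans q3.symm
      rcases hc with ((h | h) | h) | h
      · exact (a3 c₁ hc₁ c h).mono (restrict_mono (span_mono s₁ a1))
      · exact hmid.trans ((b3 c₂ hc₂ c h).mono (restrict_mono (span_mono s₂ b1)))
      · exact q2 c h
      · exact hmid.trans (q4 c h)
    exact fun a ha b hb => (key a ha).symm.trans (key b hb)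
  refine ⟨?_, hsub, X, le_refl _, hsafe, hlink, Forces.combine hsafe hlink s₁ s₂ a1 b1 a2 b2 a4 b4
    fun x => ?_, by simp⟩
  · have := h₁.size
    have := h₂.size
    simp only [List.length_append, obsSize]
    omega
  · by_cases hX : x ∈ X
    · exact .inl (a1 hX)
    -- An unassigned variable of `O₁` was pending when `O₂` was found, so it is in `X₂` or does not
    -- occur in `O₂`.
    by_cases hocc : ∃ c ∈ O₁, G.Occurs x c
    · obtain ⟨c, hc, hx⟩ := hocc
      rcases b5 x (hY x hX c hc hx) with h | h
      · exact .inr (.inl h)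
      · exact .inr (.inr (.inr h))
    · push Not at hocc
      exact .inr (.inr (.inl hocc))

/-- The graph is connected, so stable labels give the two starting clauses the same root and their
parent paths meet there. If the labels are not stable, the parameter is exceeded anyway. -/
theorem runs_joinCode (hA : G.IsAdjList L) (hK : ∀ c, (L c).length ≤ k)
    (hR : G.IsResidual X {v | v ∈ l}) (hS : G.IsConn {v | v ∈ l}) {τ : State}
    (hready : Ready k L X d lo yl (j + 1) l [] τ)
    (hP : Pres d (lo + l.length) (yl + ([] : List (Fin n)).length) (σ.reg 3) (σ.reg 4)
      {v | v ∈ l} σ τ)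
    (h4 : τ.arr 4 = σ.arr 4) {O₁ O₂ : List (Fin m)} (h20 : τ.arr 20 d = σ.reg 4)
    (h21 : τ.arr 21 d = σ.reg 4 + O₁.length) (hpos : τ.reg 4 = σ.reg 4 + O₁.length + O₂.length)
    (hseg : Seg (τ.arr 11) (σ.reg 4) ((O₁ ++ O₂).map fun c : Fin m => n + (c : ℕ)))
    (h₁ : Obstruction G k X j l [] O₁) (h₂ : Obstruction G k X j l Y O₂)
    (hY : ∀ x ∉ X, ∀ c ∈ O₁, G.Occurs x c → x ∈ Y) :
    Runs procs joinCode τ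
      (60 * ((k + 1) * 2 ^ (k + 2) * (l.length + 1)) + 32 * 2 ^ (k + 2) + 30)
      (Returns G k X d (lo + l.length) (yl + ([] : List (Fin n)).length) (j + 1) l [] σ) := by
  refine (Runs.block_cons (runs_loadFrame hready) fun τ₁ ⟨C1, _, _, _, R1, F1⟩ =>
    Runs.block_cons (runs_label hA hK hR R1.env C1) fun τ₂ ⟨hst, hun, _, h7', F2⟩ =>
    Runs.block_cons (T' := 1) (T := 32 * 2 ^ (k + 2) + 23)
    (P := Returns G k X d (lo + l.length) (yl + ([] : List (Fin n)).length) (j + 1) l [] σ)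
    ((Runs.ite (T := 32 * 2 ^ (k + 2) + 22) (fun hb => ?_) fun hb => ?_)) fun τ h =>
      Runs.block_nil h).mono (by omega) fun _ h => h
  all_goals
    have R2 := R1.frame F2 (by decide) (by decide) fun i _ => by rw [F2.arr 9 (by decide)]
    have F02 := (F1.mono (R' := [10, 11, 12, 13, 14, 15, 16, 17, 18, 19, 20, 24, 25, 28, 29, 30])
      (A' := [5, 6, 7]) (by decide) (by decide)).trans (F2.mono (by decide) (by decide))
    have P2 : Pres d (lo + l.length) (yl + ([] : List (Fin n)).length) (σ.reg 3) (σ.reg 4)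
        {v | v ∈ l} σ τ₂ :=
      hP.trans (F02.pres_of (by decide) (by decide) (F02.frames (by decide) d)
        (fun i _ => by rw [F02.arr 9 (by decide)]) (fun i _ => by rw [F02.arr 10 (by decide)])
        (fun i _ => by rw [F02.arr 3 (by decide)]) (fun i _ => by rw [F02.arr 11 (by decide)])
        (fun v hv => by rw [h7' v hv, F1.arr 7 (by decide)]) (F02.arr 8 (by decide)))
  swap
  · have h24 : τ₂.reg 24 ≠ 0 := by simpa [Test.Holds, R2.env.zero] using hb
    have F3 := frame_run (c := cst 5 2) rfl τ₂
    exact (Runs.straight (c := cst 5 2) rfl ⟨P2.trans (F3.pres (by decide) (by decide) _ _ _ _ _ _),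
      by rw [F3.arr 4 (by decide), F02.arr 4 (by decide), h4],
      .reject (by simp [Code.run, Instr.eval]) (hun h24)⟩).mono (by simp only [Code.cost]; omega)
        fun _ h => h
  have hst' := hst (by simpa [Test.Holds, R2.env.zero] using hb)
  -- Sets that force a depth are nonempty, so the saved positions do hold their first clauses.
  obtain ⟨c₁, hc₁⟩ : ∃ c, c ∈ O₁ := by
    obtain ⟨X₁, -, -, -, a4, -⟩ := h₁.forces
    obtain ⟨c, hc, -⟩ := a4.nonempty_edge
    exact ⟨c, hc⟩
  obtain ⟨c₂, hc₂⟩ : ∃ c, c ∈ O₂ := by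
    obtain ⟨X₂, -, -, -, a4, -⟩ := h₂.forces
    obtain ⟨c, hc, -⟩ := a4.nonempty_edge
    exact ⟨c, hc⟩
  obtain ⟨c₁, O₁', rfl⟩ := List.exists_cons_of_ne_nil (List.ne_nil_of_mem hc₁)
  obtain ⟨c₂, O₂', rfl⟩ := List.exists_cons_of_ne_nil (List.ne_nil_of_mem hc₂)
  have hl₁ : Sum.inr c₁ ∈ l := h₁.sub _ (by simp)
  have hl₂ : Sum.inr c₂ ∈ l := h₂.sub _ (by simp)
  obtain ⟨ρ, hρ, hf₁, hfρ⟩ := hst'.root _ hl₁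
  have hf₂ := hf₁.symm.trans ((hst'.reachable_iff _ hl₁ _ hl₂).1 (isConn_iff.1 hS _ hl₁ _ hl₂))
  have ch₁ := hst'.chain ρ hρ _ hl₁ hfρ hf₁
  have ch₂ := hst'.chain ρ hρ _ hl₂ hfρ hf₂.symm
  have hseg₂ : Seg (τ₂.arr 11) (σ.reg 4) ((c₁ :: O₁' ++ c₂ :: O₂').map fun c : Fin m =>
      n + (c : ℕ)) := by
    rw [F02.arr 11 (by decide)]; exact hseg
  set c3 : Code := block [ld 20 20 6, ld 13 11 20] with hc3
  have F3 := frame_run (c := c3) rfl τ₂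
  have q13 : (c3.run τ₂).reg 13 = vid (.inr c₁ : Fin n ⊕ Fin m) := by
    have h := hseg₂
    rw [List.cons_append, List.map_cons, seg_cons] at h
    simp [hc3, block, Code.run, Instr.eval, R2.depth, F02.arr 20 (by decide), h20, h.1, vid]
  refine (Runs.block_cons (T := 3) (P := fun τ => τ = c3.run τ₂) (Runs.straight (c := c3) rfl rfl)
    (T' := 32 * 2 ^ (k + 2) + 13) ?_).mono (by omega) fun _ h => h
  rintro _ rfl
  have R3 := R2.frame F3 (by decide) (by decide) fun i _ => by rw [F3.arr 9 (by decide)]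
  refine (Runs.block_cons (runs_pushPath hR hfρ hst'.le hl₁ ch₁ R3.env
    (fun v => by rw [F3.arr 5 (by decide)]) (fun v => by rw [F3.arr 6 (by decide)]) q13)
    (T' := 16 * 2 ^ (k + 2) + 10)
    fun τ₄ ⟨P₁, p1, p2, p3, p4, p5, p6, F4⟩ => ?_).mono (by omega) fun _ h => h
  have e4 : (c3.run τ₂).reg 4 = σ.reg 4 + (c₁ :: O₁').length + (c₂ :: O₂').length := by
    rw [F3.reg 4 (by decide), F02.reg 4 (by decide), hpos]
  have a11 : (c3.run τ₂).arr 11 = τ₂.arr 11 := F3.arr 11 (by decide)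
  rw [e4] at p2 p3 p4
  rw [a11] at p4
  have R4 := R3.frame F4 (by decide) (by decide) fun i _ => by rw [F4.arr 9 (by decide)]
  have hseg₄ : Seg (τ₄.arr 11) (σ.reg 4) ((c₁ :: O₁' ++ c₂ :: O₂').map fun c : Fin m =>
      n + (c : ℕ)) :=
    hseg₂.congr fun i _ hi => p4 i (by
      rw [List.length_map, List.length_append, ← add_assoc] at hi; exact hi)
  have q21 : τ₄.arr 21 d = σ.reg 4 + (c₁ :: O₁').length := by
    rw [F4.arr 21 (by decide), F3.arr 21 (by decide), F02.arr 21 (by decide), h21]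
  set c5 : Code := block [ld 20 21 6, ld 13 11 20] with hc5
  have F5 := frame_run (c := c5) rfl τ₄
  have q13' : (c5.run τ₄).reg 13 = vid (.inr c₂ : Fin n ⊕ Fin m) := by
    have h := hseg₄
    rw [List.map_append, seg_append, List.map_cons (l := O₂'), seg_cons, List.length_map] at h
    simp only [hc5, block, Code.run, Instr.eval, R4.depth, Function.update_self, q21, h.2.1, vid]
  refine (Runs.block_cons (T := 3) (P := fun τ => τ = c5.run τ₄) (Runs.straight (c := c5) rfl rfl)
    (T' := 16 * 2 ^ (k + 2) + 6) ?_).mono (by omega) fun _ h => h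
  rintro _ rfl
  have R5 := R4.frame F5 (by decide) (by decide) fun i _ => by rw [F5.arr 9 (by decide)]
  refine (Runs.block_cons (runs_pushPath hR hfρ hst'.le hl₂ ch₂ R5.env
    (fun v => by rw [F5.arr 5 (by decide), F4.arr 5 (by decide), F3.arr 5 (by decide)])
    (fun v => by rw [F5.arr 6 (by decide), F4.arr 6 (by decide), F3.arr 6 (by decide)]) q13')
    (T' := 2)
    fun τ₆ ⟨P₂, r1, r2, r3, r4, r5, r6, F6⟩ => Runs.straight (c := block [cst 5 1]) rfl ?_).mono
    (by omega) fun _ h => h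
  have e4' : (c5.run τ₄).reg 4 = σ.reg 4 + (c₁ :: O₁').length + (c₂ :: O₂').length + P₁.length := by
    rw [F5.reg 4 (by decide), p2]
  have a11' : (c5.run τ₄).arr 11 = τ₄.arr 11 := F5.arr 11 (by decide)
  rw [e4'] at r2 r3 r4
  rw [a11'] at r4
  have F7 := frame_run (c := block [cst 5 1]) rfl τ₆
  have F27 : Frame [4, 5, 13, 19, 20] [11] τ₂ ((block [cst 5 1]).run τ₆) :=
    ((((F3.mono (by decide) (by decide)).trans (F4.mono (by decide) (by decide))).trans
      (F5.mono (by decide) (by decide))).trans (F6.mono (by decide) (by decide))).trans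
      (F7.mono (by decide) (by decide))
  have a11'' : ((block [cst 5 1]).run τ₆).arr 11 = τ₆.arr 11 := F7.arr 11 (by decide)
  refine ⟨P2.trans (F27.pres_of (by decide) (by decide) (F27.frames (by decide) d)
      (fun i _ => by rw [F27.arr 9 (by decide)]) (fun i _ => by rw [F27.arr 10 (by decide)])
      (fun i _ => by rw [F27.arr 3 (by decide)])
      (fun i hi => by rw [a11'', r4 i (by omega), p4 i (by omega)])
      (fun i _ => by rw [F27.arr 7 (by decide)]) (F27.arr 8 (by decide))),
    by rw [F27.arr 4 (by decide), F02.arr 4 (by decide), h4],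
    .obstruction (c₁ :: O₁' ++ c₂ :: O₂' ++ P₁ ++ P₂) (by simp [block, Code.run, Instr.eval])
      (h₁.join hR h₂ hY (by simp) (by simp) p1 r1 p5 r5 p6 r6) ?_ ?_⟩
  · rw [F7.reg 4 (by decide), r2]
    simp only [List.length_append]
    omega
  · rw [a11'', List.map_append, seg_append, List.map_append, seg_append]
    refine ⟨⟨hseg₄.congr fun i _ hi => r4 i ?_, ?_⟩, ?_⟩
    · rw [List.length_map, List.length_append] at hi; omega
    · rw [List.length_map, List.length_append, ← add_assoc]
      exact p3.congr fun i _ hi => r4 i (by rw [List.length_map] at hi; exact hi)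
    · rw [List.length_append, List.length_map, List.length_map, List.length_append, ← add_assoc,
        ← add_assoc]
      exact r3

theorem time_mono_left {y y' s : ℕ} (h : y ≤ y') : time k y j s ≤ time k y' j s := by
  rw [time, time]
  gcongr
  norm_num

/-- This determines the exponent in `time`: one more level costs as much as `k * maxObs k` pending
variables, plus one further factor `8`. -/
theorem mul_time_maxObs (k j s : ℕ) :
    8 * time k (k * maxObs k) j s = time k 0 (j + 1) s := by
  rw [mul_time_le, time, time]
  ring_nf

/-- Branching on all neighbours of `O₁` adds at most `k * maxObs k` to the depth of a tree, which is
the allowance for one level. If an obstruction comes back instead, no variable attacks it together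
with `O₁`. -/
theorem runs_secondCode (hA : G.IsAdjList L) (hK : ∀ c, (L c).length ≤ k) (hj : j < k)
    (hspec : ∀ y ≤ k * maxObs k, SpecConn G k L y j) (hl : l.Nodup)
    (hR : G.IsResidual X {v | v ∈ l}) (hS : G.IsConn {v | v ∈ l}) {τ : State}
    (hready : Ready k L X d lo yl (j + 1) l [] τ)
    (hP : Pres d (lo + l.length) yl (σ.reg 3) (σ.reg 4) {v | v ∈ l} σ τ)
    (h4 : τ.arr 4 = σ.arr 4) {O₁ : List (Fin m)} (h19 : τ.arr 19 d = σ.reg 3)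
    (h20 : τ.arr 20 d = σ.reg 4) (hpos : τ.reg 4 = σ.reg 4 + O₁.length)
    (hseg : Seg (τ.arr 11) (σ.reg 4) (O₁.map fun c : Fin m => n + (c : ℕ)))
    (h₁ : Obstruction G k X j l [] O₁) :
    Runs procs secondCode τ (time k (k * maxObs k) j l.length + (k * 11 + 12) * maxObs k +
      60 * ((k + 1) * 2 ^ (k + 2) * (l.length + 1)) + 32 * 2 ^ (k + 2) + 70)
      (Returns G k X d (lo + l.length) yl (j + 1) l [] σ) := by
  have hO₁ : O₁.length ≤ maxObs k := h₁.size.trans (obsSize_le_maxObs hj)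
  set c1 : Code := block [ld 3 19 6, st 21 6 4, ld 34 20 6] with hc1
  have F1 := frame_run (c := c1) rfl τ
  have fr1 : ∀ a ∈ [13, 14, 15, 16, 17, 18, 19, 20, 21, 22], ∀ i < d,
      (c1.run τ).arr a i = τ.arr a i := by
    intro a ha i hi
    by_cases h21 : a = 21
    · have : i ≠ d := by omega
      subst h21
      simp [hc1, block, Code.run, Instr.eval, hready.depth, this]
    · rw [F1.arr a]
      simp [hc1, block, Code.warrs, h21]
  have q3 : (c1.run τ).reg 3 = σ.reg 3 := by
    simp [hc1, block, Code.run, Instr.eval, hready.depth, h19]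
  have q34 : (c1.run τ).reg 34 = σ.reg 4 := by
    simp [hc1, block, Code.run, Instr.eval, hready.depth, h20]
  have q21 : (c1.run τ).arr 21 d = σ.reg 4 + O₁.length := by
    simp [hc1, block, Code.run, Instr.eval, hready.depth, hpos]
  have R1 := hready.frame F1 (by decide) (by decide) fun i _ => by rw [F1.arr 9 (by decide)]
  have P1 : Pres d (lo + l.length) yl (σ.reg 3) (σ.reg 4) {v | v ∈ l} σ (c1.run τ) :=
    hP.trans (F1.pres_of (by decide) (by decide) fr1
      (fun i _ => by rw [F1.arr 9 (by decide)]) (fun i _ => by rw [F1.arr 10 (by decide)])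
      (fun i _ => by rw [F1.arr 3 (by decide)]) (fun i _ => by rw [F1.arr 11 (by decide)])
      (fun i _ => by rw [F1.arr 7 (by decide)]) (F1.arr 8 (by decide)))
  refine (Runs.block_cons (T := 4) (P := fun τ' => τ' = c1.run τ)
    (Runs.straight (c := c1) rfl rfl) (T' := time k (k * maxObs k) j l.length +
      (k * 11 + 12) * maxObs k + 60 * ((k + 1) * 2 ^ (k + 2) * (l.length + 1)) +
      32 * 2 ^ (k + 2) + 66) ?_).mono (by omega) fun _ h => h
  rintro _ rfl
  refine (Runs.block_cons (runs_loadFrame R1) (T' := time k (k * maxObs k) j l.length +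
      (k * 11 + 12) * maxObs k + 60 * ((k + 1) * 2 ^ (k + 2) * (l.length + 1)) +
      32 * 2 ^ (k + 2) + 60) fun τ₂ ⟨C2, _, i29, i30, R2, F2⟩ => ?_).mono (by omega)
      fun _ h => h
  have hseg₂ : Seg (τ₂.arr 11) (σ.reg 4) (O₁.map fun c : Fin m => n + (c : ℕ)) := by
    rw [F2.arr 11 (by decide), F1.arr 11 (by decide)]; exact hseg
  have hmul : (k * 11 + 12) * O₁.length ≤ (k * 11 + 12) * maxObs k := Nat.mul_le_mul_left _ hO₁
  refine (Runs.block_cons (runs_pushNeighbours hK R2.env ((F2.reg 34 (by decide)).trans q34)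
    (by rw [F2.reg 4 (by decide), F1.reg 4 (by decide), hpos]) i29 hseg₂)
    (T' := time k (k * maxObs k) j l.length + 60 * ((k + 1) * 2 ^ (k + 2) * (l.length + 1)) +
      32 * 2 ^ (k + 2) + 55) fun τ₃ ⟨i27, hpend, i10, F3⟩ => ?_).mono (by omega) fun _ h => h
  set Y : List (Fin n) := (edges L X (O₁.map .inr)).map fun e => e.2.1 with hYdef
  -- The set `O₁` has at most `maxObs k` clauses because its level is below `k`, and each clause has
  -- at most `k` literals.
  have hYlen : Y.length ≤ k * maxObs k := by
    have h := length_edges_le hK X (O₁.map .inr : List (Fin n ⊕ Fin m))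
    rw [List.length_map] at h
    rw [hYdef, List.length_map, mul_comm k]
    exact h.trans (Nat.mul_le_mul_right _ hO₁)
  have hY : ∀ x ∉ X, ∀ c ∈ O₁, G.Occurs x c → x ∈ Y := by
    rintro x hx c hc ⟨s, hs⟩
    exact List.mem_map.2 ⟨(c, x, s), (mem_edges_iff hA).2 ⟨List.mem_map_of_mem hc, hs, hx⟩, rfl⟩
  have hmap : (edges L X (O₁.map .inr)).map (fun e => (e.2.1 : ℕ)) = Y.map Fin.val := by
    rw [hYdef, List.map_map]; rfl
  rw [hmap] at hpend
  replace i27 : τ₃.reg 27 = yl + Y.length := by rw [i27, hYdef, List.length_map]; simp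
  rw [List.length_nil, add_zero] at hpend i10 i29
  have R3 : Ready k L X d lo yl (j + 1) l [] τ₃ := by
    refine ⟨R2.env.frame F3 (by decide) (by decide), (F3.reg 6 (by decide)).trans R2.depth,
      ?_, ?_, ?_, ?_, ?_, ?_, by simp [seg_nil]⟩
    · rw [F3.arr 13 (by decide), R2.first]
    · rw [F3.arr 14 (by decide), R2.last]
    · rw [F3.arr 15 (by decide), R2.yfirst]
    · rw [F3.arr 16 (by decide), R2.ylast]
    · rw [F3.arr 17 (by decide), R2.level]
    · rw [F3.arr 9 (by decide)]; exact R2.seg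
  set c4 : Code := block [addc 28 29 0, addc 29 27 0, sb 30 30 8, addc 34 10 0, addc 35 11 0]
    with hc4
  have F4 := frame_run (c := c4) rfl τ₃
  have A4 : (c4.run τ₃).arr = τ₃.arr := rfl
  have R4 := R3.frame F4 (by decide) (by decide) fun i _ => by rw [A4]
  have F24 : Frame [10, 11, 12, 13, 14, 15, 16, 17, 18, 27, 28, 29, 30, 34, 35] [10] (c1.run τ)
      (c4.run τ₃) :=
    ((F2.mono (by decide) (by decide)).trans (F3.mono (by decide) (by decide))).trans
      (F4.mono (by decide) (by decide))
  have P4 : Pres d (lo + l.length) yl (σ.reg 3) (σ.reg 4) {v | v ∈ l} σ (c4.run τ₃) :=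
    P1.trans (F24.pres_of (by decide) (by decide) (F24.frames (by decide) d)
      (fun i _ => by rw [F24.arr 9 (by decide)])
      (fun i hi => by rw [A4, i10 i hi, F2.arr 10 (by decide)])
      (fun i _ => by rw [F24.arr 3 (by decide)]) (fun i _ => by rw [F24.arr 11 (by decide)])
      (fun i _ => by rw [F24.arr 7 (by decide)]) (F24.arr 8 (by decide)))
  refine (Runs.block_cons (T := 6) (P := fun τ' => τ' = c4.run τ₃)
    (Runs.straight (c := c4) rfl rfl) (T' := time k (k * maxObs k) j l.length +
      60 * ((k + 1) * 2 ^ (k + 2) * (l.length + 1)) + 32 * 2 ^ (k + 2) + 46) ?_).mono (by omega)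
      fun _ h => h
  rintro _ rfl
  refine (Runs.block_cons ((runs_invoke (d := d) (lo := lo) (yl := yl) (j := j)
    (l := l) (Y := Y) (X := X) (p := 1) (code := solveConn) rfl
    (fun τ hτ => hspec Y.length hYlen X (d + 1) lo yl l Y τ hτ hl hR rfl hS) R4.env R4.depth
    ?_ ?_ ?_ ?_ ?_ R4.seg (by rw [A4]; exact hpend)).mono
      (Nat.add_le_add_right (time_mono_left hYlen) 10) fun _ h => h)
    (T' := 60 * ((k + 1) * 2 ^ (k + 2) * (l.length + 1)) + 32 * 2 ^ (k + 2) + 36)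
    fun τ₅ ⟨P5, h5, hO⟩ => ?_).mono (by omega) fun _ h => h
  · simp [hc4, block, Code.run, Instr.eval, F3.reg 10 (by decide), C2.first]
  · simp [hc4, block, Code.run, Instr.eval, F3.reg 11 (by decide), C2.last]
  · simp [hc4, block, Code.run, Instr.eval, F3.reg 29 (by decide), i29]
  · simp [hc4, block, Code.run, Instr.eval, i27]
  · simp [hc4, block, Code.run, Instr.eval, F3.reg 30 (by decide), i30, R3.env.one]
  have e3 : (c4.run τ₃).reg 3 = σ.reg 3 := by rw [F24.reg 3 (by decide), q3]
  have e4 : (c4.run τ₃).reg 4 = σ.reg 4 + O₁.length := by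
    rw [F24.reg 4 (by decide), F1.reg 4 (by decide), hpos]
  have ea4 : (c4.run τ₃).arr 4 = σ.arr 4 := by
    rw [F24.arr 4 (by decide), F1.arr 4 (by decide), h4]
  have R5 := R4.pres P5 h5 le_rfl (by simp)
  have P05 : Pres d (lo + l.length) yl (σ.reg 3) (σ.reg 4) {v | v ∈ l} σ τ₅ :=
    P4.trans (P5.mono (by omega) le_rfl (by omega) (by rw [e3]) (by rw [e4]; omega) (le_refl _))
  have j20 : τ₅.arr 20 d = σ.reg 4 := by
    rw [P5.frames 20 (by simp) d (by omega), F24.arr 20 (by decide), F1.arr 20 (by decide), h20]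
  have j21 : τ₅.arr 21 d = σ.reg 4 + O₁.length := by
    rw [P5.frames 21 (by simp) d (by omega), F24.arr 21 (by decide), q21]
  refine (Runs.block_cons (T' := 1) (P := Returns G k X d (lo + l.length) yl (j + 1) l [] σ)
    (Runs.ite (T := 60 * ((k + 1) * 2 ^ (k + 2) * (l.length + 1)) + 32 * 2 ^ (k + 2) + 32)
      (fun hb => ?_) fun hb => (Runs.ite (T := 60 * ((k + 1) * 2 ^ (k + 2) * (l.length + 1)) +
        32 * 2 ^ (k + 2) + 30) (fun hb' => ?_) fun hb' => (Runs.skip ?_).mono (by omega)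
        fun _ h => h).mono (by omega) fun _ h => h)
    fun τ h => Runs.block_nil h).mono (by omega) fun _ h => h
  · have hf : τ₅.reg 5 = 0 := by simpa [Test.Holds, R5.env.zero] using hb
    have F6 := frame_run (c := ld 4 20 6) rfl τ₅
    refine (Runs.straight (c := ld 4 20 6) rfl ⟨P05.trans (F6.pres (by decide) (by decide)
      _ _ _ _ _ _), by rw [F6.arr 4 (by decide), h5, ea4], ?_⟩).mono
      (by simp only [Code.cost]; omega) fun _ h => h
    cases hO with
    | obstruction O g => rw [hf] at g; simp at g
    | reject g => rw [hf] at g; simp at g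
    | tree w g1 g2 g3 g4 =>
      -- The tree was written from the restored output position on, over the remains of the first
      -- attempt; everything below is unchanged since `σ`.
      have W : Wrote w σ τ₅ := ⟨by rw [g2.pos, e3], by rw [← e3]; exact g2.seg, P05.out⟩
      refine .tree w ((F6.reg 5 (by decide)).trans hf) (W.congr (F6.reg 3 (by decide))
        (F6.arr 3 (by decide)))
        (by simp [Code.run, Instr.eval, R5.depth, j20]) (g4.mono ?_)
      rw [List.length_nil, zero_add, Nat.succ_mul]
      omega
  · have hf : τ₅.reg 5 = 1 := by simpa [Test.Holds, R5.env.one] using hb'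
    cases hO with
    | tree w g => rw [hf] at g; simp at g
    | reject g => rw [hf] at g; simp at g
    | obstruction O₂ g1 g2 g3 g4 =>
      refine runs_joinCode hA hK hR hS R5 P05 (h5.trans ea4) j20 j21 (by rw [g3, e4]) ?_ h₁ g2 hY
      rw [List.map_append, seg_append, List.length_map]
      rw [e4] at g4
      refine ⟨?_, g4⟩
      have : Seg ((c4.run τ₃).arr 11) (σ.reg 4) (O₁.map fun c : Fin m => n + (c : ℕ)) := by
        rw [F24.arr 11 (by decide), F1.arr 11 (by decide)]; exact hseg
      exact this.congr fun i _ hi => P5.obs i (by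
        rw [List.length_map] at hi; rw [e4]; exact hi)
  · have hf0 : τ₅.reg 5 ≠ 0 := by simpa [Test.Holds, R5.env.zero] using hb
    have hf1 : τ₅.reg 5 ≠ 1 := by simpa [Test.Holds, R5.env.one] using hb'
    refine ⟨P05, h5.trans ea4, ?_⟩
    cases hO with
    | tree w g => exact absurd g hf0
    | obstruction O g => exact absurd g hf1
    | reject g1 g2 => exact .reject g1 g2

/-- The case of positive level without pending variables. -/
theorem specConn_level (hA : G.IsAdjList L) (hK : ∀ c, (L c).length ≤ k) (hj : j < k)
    (hspec : ∀ y ≤ k * maxObs k, SpecConn G k L y j) : SpecConn G k L 0 (j + 1) := by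
  intro X d lo yl l Y σ hready hl hR hY hS
  obtain rfl : Y = [] := List.length_eq_zero_iff.1 hY
  rw [List.length_nil, add_zero]
  set W := (k + 1) * 2 ^ (k + 2) * (l.length + 1) with hW
  have hD : 1 ≤ 2 ^ (k + 2) := Nat.one_le_two_pow
  have b1 : (k + 1) * (l.length + 1) ≤ W := by
    rw [hW]
    calc (k + 1) * (l.length + 1) = (k + 1) * 1 * (l.length + 1) := by ring
      _ ≤ _ := by gcongr
  have b2 : 2 ^ (k + 2) ≤ W := by
    rw [hW]
    calc 2 ^ (k + 2) = 1 * 2 ^ (k + 2) * 1 := by ring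
      _ ≤ _ := by gcongr <;> omega
  -- The factor `maxObs k + 1` in `unit` is there to pay for listing the neighbours of an
  -- obstruction.
  have b3 : (k * 11 + 12) * maxObs k + W * 300 ≤ time k (k * maxObs k) j l.length := by
    have h1 : 1 ≤ 8 ^ (k * maxObs k + j * (k * maxObs k + 1) + 1) :=
      Nat.one_le_pow _ _ (by norm_num)
    have h2 : k + 1 ≤ (k + 1) * 2 ^ (k + 2) := Nat.le_mul_of_pos_right _ hD
    have h3 : (k + 1) * maxObs k ≤ W * maxObs k := by
      gcongr
      exact h2.trans (Nat.le_mul_of_pos_right _ (by omega))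
    calc (k * 11 + 12) * maxObs k + W * 300 ≤ 12 * ((k + 1) * maxObs k) + W * 300 := by
          nlinarith
      _ ≤ 600 * (W * maxObs k) + 600 * W := by omega
      _ = unit k * 1 * (l.length + 1) := by rw [unit, hW]; ring
      _ ≤ _ := by rw [time]; gcongr
  have b4 : time k 0 j l.length ≤ time k (k * maxObs k) j l.length := time_mono_left (by omega)
  have hW1 : 1 ≤ W := hD.trans b2
  -- There are two calls at the lower level: one without pending variables, and one with at most `k
  -- * maxObs k` of them.
  have key := runs_solveConn hA hK hready hl hR (T := 2 * time k (k * maxObs k) j l.length +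
    (k * 11 + 12) * maxObs k + 240 * W)
  rw [List.length_nil, add_zero] at key
  refine (key fun τ₀ R0 C0 i28 i29 i30 _ F0 => ?_).mono (by rw [← mul_time_maxObs]; omega)
    fun _ h => h
  refine (Runs.ite (T := time k 0 j l.length + time k (k * maxObs k) j l.length +
    (k * 11 + 12) * maxObs k + 60 * W + 32 * 2 ^ (k + 2) + 100) (fun hb => absurd hb ?_)
    fun _ => (Runs.ite (T := time k 0 j l.length + time k (k * maxObs k) j l.length +
    (k * 11 + 12) * maxObs k + 60 * W + 32 * 2 ^ (k + 2) + 98) (fun hb => absurd hb ?_)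
    fun _ => ?_).mono (by omega) fun _ h => h).mono (by omega) fun _ h => h
  · simp [Test.Holds, i28, i29]
  · simp [Test.Holds, i30, R0.env.zero]
  set c1 : Code := block [st 19 6 3, st 20 6 4, sb 30 30 8, addc 28 29 0, addc 34 10 0,
    addc 35 11 0] with hc1
  have F1 := frame_run (c := c1) rfl τ₀
  have fr1 : ∀ a ∈ [13, 14, 15, 16, 17, 18, 19, 20, 21, 22], ∀ i < d,
      (c1.run τ₀).arr a i = τ₀.arr a i := by
    intro a ha i hi
    have : i ≠ d := by omega
    simp only [List.mem_cons, List.not_mem_nil, or_false] at ha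
    rcases ha with rfl | rfl | rfl | rfl | rfl | rfl | rfl | rfl | rfl | rfl <;>
      simp [hc1, block, Code.run, Instr.eval, R0.depth, this]
  have R1 := R0.frame F1 (by decide) (by decide) fun i _ => by rw [F1.arr 9 (by decide)]
  have P1 : Pres d (lo + l.length) yl (σ.reg 3) (σ.reg 4) {v | v ∈ l} σ (c1.run τ₀) :=
    (F0.pres (by decide) (by decide) _ _ _ _ _ _).trans (F1.pres_of (by decide) (by decide) fr1
      (fun i _ => by rw [F1.arr 9 (by decide)]) (fun i _ => by rw [F1.arr 10 (by decide)])
      (fun i _ => by rw [F1.arr 3 (by decide)]) (fun i _ => by rw [F1.arr 11 (by decide)])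
      (fun i _ => by rw [F1.arr 7 (by decide)]) (F1.arr 8 (by decide)))
  have F01 : Frame [10, 11, 12, 13, 14, 15, 16, 17, 18, 24, 28, 29, 30, 34, 35] [19, 20] σ
      (c1.run τ₀) := (F0.mono (by decide) (by decide)).trans (F1.mono (by decide) (by decide))
  have q19 : (c1.run τ₀).arr 19 d = σ.reg 3 := by
    simp [hc1, block, Code.run, Instr.eval, R0.depth, F0.reg 3]
  have q20 : (c1.run τ₀).arr 20 d = σ.reg 4 := by
    simp [hc1, block, Code.run, Instr.eval, R0.depth, F0.reg 4]
  refine (Runs.block_cons (T := 7) (P := fun τ' => τ' = c1.run τ₀)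
    (Runs.straight (c := c1) rfl rfl) (T' := time k 0 j l.length +
      time k (k * maxObs k) j l.length + (k * 11 + 12) * maxObs k + 60 * W + 32 * 2 ^ (k + 2) + 90)
      ?_).mono (by omega) fun _ h => h
  rintro _ rfl
  refine (Runs.block_cons (runs_invoke (d := d) (lo := lo) (yl := yl) (j := j)
    (l := l) (Y := []) (X := X) (p := 1) (code := solveConn) rfl
    (fun τ hτ => hspec 0 (Nat.zero_le _) X (d + 1) lo yl l [] τ hτ hl hR rfl hS) R1.env R1.depth
    ?_ ?_ ?_ ?_ ?_ R1.seg (by simp [seg_nil]))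
    (T' := time k (k * maxObs k) j l.length + (k * 11 + 12) * maxObs k + 60 * W +
      32 * 2 ^ (k + 2) + 75)
    fun τ₂ ⟨P2, h2, hO⟩ => ?_).mono (by omega) fun _ h => h
  · simp [hc1, block, Code.run, Instr.eval, C0.first]
  · simp [hc1, block, Code.run, Instr.eval, C0.last]
  · simp [hc1, block, Code.run, Instr.eval, i29]
  · rw [F1.reg 29 (by decide), i29, List.length_nil, add_zero]
  · simp [hc1, block, Code.run, Instr.eval, i30, R0.env.one]
  have e3 : (c1.run τ₀).reg 3 = σ.reg 3 := F01.reg 3 (by decide)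
  have e4 : (c1.run τ₀).reg 4 = σ.reg 4 := F01.reg 4 (by decide)
  have R2 := R1.pres P2 h2 le_rfl le_rfl
  rw [e3, e4, List.length_nil, add_zero] at P2
  have P02 := P1.trans (P2.mono (by omega) le_rfl le_rfl le_rfl le_rfl (le_refl _))
  have h02 : τ₂.arr 4 = σ.arr 4 := h2.trans (F01.arr 4 (by decide))
  have hO' := hO.congr_left e3.symm e4.symm (F01.arr 3 (by decide)).symm
  refine (Runs.block_cons (T' := 1) (P := Returns G k X d (lo + l.length) yl (j + 1) l [] σ)
    (Runs.ite (T := time k (k * maxObs k) j l.length + (k * 11 + 12) * maxObs k + 60 * W +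
      32 * 2 ^ (k + 2) + 73) (fun hb => ?_) fun hb => (Runs.skip ?_).mono (by omega) fun _ h => h)
    fun τ h => Runs.block_nil h).mono (by omega) fun _ h => h
  · have hf : τ₂.reg 5 = 1 := by simpa [Test.Holds, R2.env.one] using hb
    cases hO' with
    | tree w g => rw [hf] at g; simp at g
    | reject g => rw [hf] at g; simp at g
    | obstruction O₁ g1 g2 g3 g4 =>
      exact (runs_secondCode hA hK hj hspec hl hR hS R2 P02 h02
        ((P2.frames 19 (by simp) d (by omega)).trans q19)
        ((P2.frames 20 (by simp) d (by omega)).trans q20) g3 g4 g2).mono (by omega) fun _ h => h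
  · have hf : τ₂.reg 5 ≠ 1 := by simpa [Test.Holds, R2.env.one] using hb
    refine ⟨P02, h02, ?_⟩
    cases hO' with
    | tree w g1 g2 g3 g4 =>
      refine .tree w g1 g2 g3 (g4.mono ?_)
      rw [List.length_nil, Nat.succ_mul]
      omega
    | obstruction O g => exact absurd g hf
    | reject g1 g2 => exact .reject g1 g2

/-- The outer induction is on the level, the inner one on the number of pending variables. A new
level needs the previous one for all numbers of pending variables up to `k * maxObs k`. -/
theorem specConn (hA : G.IsAdjList L) (hK : ∀ c, (L c).length ≤ k) :
    ∀ j ≤ k, ∀ y, SpecConn G k L y j := by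
  have hsucc : ∀ j, SpecConn G k L 0 j → ∀ y, SpecConn G k L y j := by
    intro j h0 y
    induction y with
    | zero => exact h0
    | succ y ih => exact specConn_succ hA hK (specSolve_of_specConn hA hK ih) ih
  intro j
  induction j with
  | zero => exact fun _ => hsucc 0 (specConn_zero hA hK)
  | succ j ih =>
    exact fun hj => hsucc _ (specConn_level hA hK (by omega) fun y _ => ih (by omega) y)

theorem specSolve (hA : G.IsAdjList L) (hK : ∀ c, (L c).length ≤ k) (y : ℕ) :
    SpecSolve G k L y k :=
  specSolve_of_specConn hA hK (specConn hA hK k le_rfl y)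

end RAM

/-! ### The main program -/

namespace RAM

open IncidenceGraph BackdoorTree

variable {n m : ℕ} {ps : List Code} {k : ℕ} {L : Fin m → List (Fin n × Bool)}
  {G : IncidenceGraph (Fin n) (Fin m)} {σ : State}

/-- A loop with a bounded number of rounds. -/
theorem Runs.loop {b : Test} {body : Code} {Inv : ℕ → State → Prop} {N T : ℕ}
    (hstep : ∀ i < N, ∀ τ, Inv i τ → b.Holds τ ∧ Runs ps body τ T (Inv (i + 1)))
    (hend : ∀ τ, Inv N τ → ¬ b.Holds τ) (h : Inv 0 σ) :
    Runs ps (.while b body) σ (N * (T + 1) + 1) (Inv N) := by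
  have key : ∀ r i τ, i + r = N → Inv i τ →
      Runs ps (.while b body) τ (r * (T + 1) + 1) (Inv N) := by
    intro r
    induction r with
    | zero =>
      intro i τ hi hτ
      obtain rfl : i = N := by omega
      exact (Runs.while_done (hend τ hτ) hτ).mono (by omega) fun _ h => h
    | succ r ih =>
      intro i τ hi hτ
      obtain ⟨h1, h2⟩ := hstep i (by omega) τ hτ
      exact (Runs.while_step h1 h2 fun ρ hρ => ih (i + 1) ρ (by omega) hρ).mono
        (by rw [Nat.succ_mul]; omega) fun _ h => h
  exact key N 0 σ (by omega) h

def fillVars : Code := .while (.lt 12 1) (block [st 9 12 12, addc 12 12 1])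

/-- List the clauses and look for a clause with too many literals. -/
def fillClauses : Code :=
  .while (.lt 13 2) (block [st 9 12 12, addc 12 12 1, ld 14 0 13, addc 13 13 1, ld 15 0 13,
    sb 15 15 14, .ite (.lt 0 15) (cst 24 1) .skip])

/-- The machine has no instruction that adds two registers, so doubling is done by increments. -/
def double : Code :=
  block [addc 19 9 0, cst 21 0, .while (.lt 21 19) (block [addc 9 9 1, addc 21 21 1])]

/-- Compute the number of rounds of the label propagation. -/
def setRounds : Code := block [cst 9 4, .while (.lt 20 0) (block [double, addc 20 20 1])]

/-- Of the frame `0` only the end of the vertex list and the level are written; the remaining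
entries are `0`, which means a list that starts at `0` and no pending variables. -/
def setUp : Code :=
  block [cst 8 1, fillVars, fillClauses, setRounds, st 14 7 12, st 17 7 0]

/-- The algorithm. -/
def program : Program where
  procs := procs
  main := block [setUp, .ite (.eq 24 7)
    (block [.call 0, .ite (.eq 5 7) (block [cst 0 1, addc 1 3 0]) (cst 0 0)]) (cst 0 0)]

theorem runs_fillVars (h1 : σ.reg 1 = n) (h12 : σ.reg 12 = 0) :
    Runs ps fillVars σ (4 * n + 1) fun τ =>
      τ.reg 12 = n ∧ (∀ i < n, τ.arr 9 i = i) ∧ Frame [12] [9] σ τ := by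
  refine (Runs.loop (N := n) (T := 3) (Inv := fun i τ => τ.reg 12 = i ∧ (∀ i' < i, τ.arr 9 i' = i')
    ∧ Frame [12] [9] σ τ) ?_ ?_ ⟨h12, by simp, Frame.refl _ _ _⟩).mono (by omega) fun _ h => h
  · rintro i hi τ ⟨i1, i2, i3⟩
    refine ⟨?_, Runs.straight (c := block [st 9 12 12, addc 12 12 1]) rfl ⟨?_, fun i' hi' => ?_,
      i3.trans ((frame_run (c := block [st 9 12 12, addc 12 12 1]) rfl τ).mono
        (by decide) (by decide))⟩⟩
    · simp only [Test.Holds, i1, i3.reg 1 (by decide), h1, hi]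
    · simp [block, Code.run, Instr.eval, i1]
    · simp only [block, Code.run, Instr.eval, Function.update_self, i1]
      by_cases h : i' = i
      · rw [h, Function.update_self]
      · rw [Function.update_of_ne h, i2 i' (by omega)]
  · rintro τ ⟨i1, -, i3⟩
    simp [Test.Holds, i1, i3.reg 1, h1]

/-- The length of a clause is the difference of consecutive offsets. Long clauses are thus detected
in constant time each, without reading their literals, as a bound in terms of vertices alone
requires. -/
theorem runs_fillClauses (h0 : σ.reg 0 = k) (h2 : σ.reg 2 = m) (h12 : σ.reg 12 = n)
    (h13 : σ.reg 13 = 0) (h24 : σ.reg 24 = 0) (hL : Loaded L σ.arr)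
    (h9 : ∀ i < n, σ.arr 9 i = i) :
    Runs ps fillClauses σ (10 * m + 1) fun τ =>
      τ.reg 12 = n + m ∧ (∀ i < n + m, τ.arr 9 i = i) ∧
      (τ.reg 24 = 0 ↔ ∀ c, (L c).length ≤ k) ∧ Frame [12, 13, 14, 15, 24] [9] σ τ := by
  set body : Code := block [st 9 12 12, addc 12 12 1, ld 14 0 13, addc 13 13 1, ld 15 0 13,
    sb 15 15 14, .ite (.lt 0 15) (cst 24 1) .skip] with hbody
  refine (Runs.loop (N := m) (T := 9) (Inv := fun i τ => τ.reg 12 = n + i ∧ τ.reg 13 = i ∧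
    (∀ i' < n + i, τ.arr 9 i' = i') ∧ (τ.reg 24 = 0 ↔ ∀ c : Fin m, c < i → (L c).length ≤ k) ∧
    Frame [12, 13, 14, 15, 24] [9] σ τ) ?_ ?_
    ⟨h12, h13, h9, by simp [h24], Frame.refl _ _ _⟩).mono (by omega)
    fun τ ⟨i1, _, i3, i4, i5⟩ => ⟨i1, i3, i4.trans (by simp), i5⟩
  · rintro i hi τ ⟨i1, i2, i3, i4, i5⟩
    have F := frame_run (c := body) rfl τ
    have hoff : τ.arr 0 (i + 1) = τ.arr 0 i + (L ⟨i, hi⟩).length := by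
      rw [i5.arr 0 (by decide)]; exact hL.off ⟨i, hi⟩
    have h0' : τ.reg 0 = k := (i5.reg 0 (by decide)).trans h0
    refine ⟨?_, Runs.straight (c := body) rfl ⟨?_, ?_, fun i' hi' => ?_, ?_,
      i5.trans (F.mono (by decide) (by decide))⟩⟩
    · simp only [Test.Holds, i2, i5.reg 2 (by decide), h2, hi]
    · by_cases hk : k < (L ⟨i, hi⟩).length <;>
        simp [hbody, block, Code.run, Instr.eval, Test.check, i1, i2, h0', hoff, hk, add_assoc]
    · by_cases hk : k < (L ⟨i, hi⟩).length <;>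
        simp [hbody, block, Code.run, Instr.eval, Test.check, i2, h0', hoff, hk]
    · have e9 : (body.run τ).arr 9 = Function.update (τ.arr 9) (n + i) (n + i) := by
        by_cases hk : k < (L ⟨i, hi⟩).length <;>
          simp [hbody, block, Code.run, Instr.eval, Test.check, i1, i2, h0', hoff, hk]
      rw [e9]
      by_cases h : i' = n + i
      · rw [h, Function.update_self]
      · rw [Function.update_of_ne h, i3 i' (by omega)]
    · have e24 : (body.run τ).reg 24 = if k < (L ⟨i, hi⟩).length then 1 else τ.reg 24 := by
        by_cases hk : k < (L ⟨i, hi⟩).length <;>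
          simp [hbody, block, Code.run, Instr.eval, Test.check, i2, h0', hoff, hk]
      rw [e24]
      by_cases hk : k < (L ⟨i, hi⟩).length
      · rw [if_pos hk]
        refine iff_of_false (by simp) fun h => ?_
        have := h ⟨i, hi⟩ (Nat.lt_succ_self i)
        omega
      · rw [if_neg hk, i4]
        refine ⟨fun h c hc => ?_, fun h c hc => h c (by omega)⟩
        by_cases hci : (c : ℕ) = i
        · obtain rfl : c = ⟨i, hi⟩ := Fin.ext hci
          omega
        · exact h c (by omega)
  · rintro τ ⟨-, i2, -, -, i5⟩
    simp [Test.Holds, i2, i5.reg 2, h2]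

theorem runs_double {v : ℕ} (h : σ.reg 9 = v) :
    Runs ps double σ (4 * v + 4) fun τ => τ.reg 9 = 2 * v ∧ Frame [9, 19, 21] [] σ τ := by
  set c1 : Code := block [addc 9 9 1, addc 21 21 1] with hc1
  refine (Runs.block_cons (T := 1) (P := fun τ => τ.reg 19 = v ∧ τ.reg 9 = v ∧
      Frame [9, 19, 21] [] σ τ)
    (Runs.straight (c := addc 19 9 0) rfl ⟨by simp [Code.run, Instr.eval, h],
      by simp [Code.run, Instr.eval, h],
      (frame_run (c := addc 19 9 0) rfl σ).mono (by decide) (by decide)⟩) fun τ₁ ⟨h1, h9, F1⟩ =>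
    Runs.block_cons (T := 1) (P := fun τ => τ.reg 21 = 0 ∧ τ.reg 19 = v ∧ τ.reg 9 = v + 0 ∧
      Frame [9, 19, 21] [] σ τ)
    (Runs.straight (c := cst 21 0) rfl ⟨by simp [Code.run, Instr.eval],
      by simp [Code.run, Instr.eval, h1], by simp [Code.run, Instr.eval, h9],
      F1.trans ((frame_run (c := cst 21 0) rfl τ₁).mono (by decide) (by decide))⟩)
    fun τ₂ h₂ => Runs.block_cons (T' := 1) (Runs.loop (N := v) (T := 3)
      (Inv := fun i τ => τ.reg 21 = i ∧ τ.reg 19 = v ∧ τ.reg 9 = v + i ∧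
        Frame [9, 19, 21] [] σ τ) ?_ ?_ h₂) fun τ₃ ⟨_, _, i3, i4⟩ =>
      Runs.block_nil ⟨by rw [i3]; omega, i4⟩).mono (by omega) fun _ h => h
  · rintro i hi τ ⟨i1, i2, i3, i4⟩
    refine ⟨by simp only [Test.Holds, i1, i2, hi], Runs.straight (c := c1) rfl ⟨?_, ?_, ?_,
      i4.trans ((frame_run (c := c1) rfl τ).mono (by decide) (by decide))⟩⟩
    · simp [hc1, block, Code.run, Instr.eval, i1]
    · simp [hc1, block, Code.run, Instr.eval, i2]
    · simp [hc1, block, Code.run, Instr.eval, i3, add_assoc]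
  · rintro τ ⟨i1, i2, -⟩
    simp [Test.Holds, i1, i2]

theorem runs_setRounds (h0 : σ.reg 0 = k) (h20 : σ.reg 20 = 0) :
    Runs ps setRounds σ (12 * ((k + 1) * 2 ^ (k + 2))) fun τ =>
      τ.reg 9 = 2 ^ (k + 2) ∧ Frame [9, 19, 20, 21] [] σ τ := by
  have hD : 4 ≤ 2 ^ (k + 2) := by
    calc 4 = 2 ^ 2 := by norm_num
      _ ≤ 2 ^ (k + 2) := Nat.pow_le_pow_right (by norm_num) (by omega)
  refine (Runs.block_cons (T := 1) (T' := k * (4 * 2 ^ (k + 2) + 6 + 1) + 1 + 1)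
    (P := fun τ => τ.reg 20 = 0 ∧ τ.reg 9 = 2 ^ (0 + 2) ∧ Frame [9, 19, 20, 21] [] σ τ)
    (Runs.straight (c := cst 9 4) rfl ⟨by simp [Code.run, Instr.eval, h20],
      by simp [Code.run, Instr.eval],
      (frame_run (c := cst 9 4) rfl σ).mono (by decide) (by decide)⟩) fun τ₁ h₁ =>
    Runs.block_cons (Runs.loop (Inv := fun i τ => τ.reg 20 = i ∧ τ.reg 9 = 2 ^ (i + 2) ∧
      Frame [9, 19, 20, 21] [] σ τ) ?_ ?_ h₁) fun τ₂ h₂ => Runs.block_nil h₂.2).mono ?_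
      fun _ h => h
  · rintro i hi τ ⟨i1, i2, i3⟩
    have hle : 2 ^ (i + 2) ≤ 2 ^ (k + 2) := Nat.pow_le_pow_right (by norm_num) (by omega)
    refine ⟨by simp only [Test.Holds, i1, i3.reg 0 (by decide), h0, hi],
      (Runs.block_cons (runs_double i2) (T' := 2) fun ρ ⟨j1, F⟩ =>
        Runs.straight (c := block [addc 20 20 1]) rfl ⟨?_, ?_, (i3.trans
          (F.mono (by decide) (by decide))).trans ((frame_run (c := block [addc 20 20 1])
          rfl ρ).mono (by decide) (by decide))⟩).mono (by omega) fun _ h => h⟩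
    · simp [block, Code.run, Instr.eval, F.reg 20, i1]
    · simp [block, Code.run, Instr.eval, j1, pow_succ]; ring
  · rintro τ ⟨i1, -, i3⟩
    simp [Test.Holds, i1, i3.reg 0, h0]
  · nlinarith

/-- The state in which the subroutine for arbitrary graphs is called. -/
theorem runs_setUp (h0 : σ.reg 0 = k) (h1 : σ.reg 1 = n) (h2 : σ.reg 2 = m)
    (hz : ∀ r, 3 ≤ r → σ.reg r = 0) (hL : Loaded L σ.arr) :
    Runs ps setUp σ (10 * (n + m) + 12 * ((k + 1) * 2 ^ (k + 2)) + 6) fun τ =>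
      (∀ i < n + m, τ.arr 9 i = i) ∧ (τ.reg 24 = 0 ↔ ∀ c, (L c).length ≤ k) ∧ τ.reg 8 = 1 ∧
      τ.reg 9 = 2 ^ (k + 2) ∧ τ.arr 14 0 = n + m ∧ τ.arr 17 0 = k ∧
      Frame [8, 9, 12, 13, 14, 15, 19, 20, 21, 24] [9, 14, 17] σ τ := by
  refine (Runs.block_cons (T := 1) (P := fun τ => τ.reg 8 = 1 ∧ Frame [8] [] σ τ)
    (Runs.straight (c := cst 8 1) rfl ⟨by simp [Code.run, Instr.eval],
      frame_run (c := cst 8 1) rfl σ⟩) fun τ₁ ⟨e8, F1⟩ =>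
    Runs.block_cons (runs_fillVars (n := n) ((F1.reg 1 (by decide)).trans h1)
      ((F1.reg 12 (by decide)).trans (hz 12 (by norm_num)))) fun τ₂ ⟨i1, i2, F2⟩ =>
    Runs.block_cons (runs_fillClauses (k := k) (m := m) (n := n) (L := L)
      (by rw [F2.reg 0 (by decide), F1.reg 0 (by decide), h0])
      (by rw [F2.reg 2 (by decide), F1.reg 2 (by decide), h2]) i1
      (by rw [F2.reg 13 (by decide), F1.reg 13 (by decide), hz 13 (by norm_num)])
      (by rw [F2.reg 24 (by decide), F1.reg 24 (by decide), hz 24 (by norm_num)]) ?_ i2)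
      fun τ₃ ⟨j1, j2, j3, F3⟩ => Runs.block_cons (runs_setRounds (k := k)
      (by rw [F3.reg 0 (by decide), F2.reg 0 (by decide), F1.reg 0 (by decide), h0])
      (by rw [F3.reg 20 (by decide), F2.reg 20 (by decide), F1.reg 20 (by decide),
        hz 20 (by norm_num)]))
      fun τ₄ ⟨k1, F4⟩ => Runs.straight (c := block [st 14 7 12, st 17 7 0]) rfl ?_).mono
      (by simp only [block, Code.cost]; omega) fun _ h => h
  · refine ⟨?_, ?_, ?_⟩
    · rw [F2.arr 0 (by decide), F1.arr 0 (by decide)]; exact hL.off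
    · rw [F2.arr 0 (by decide), F1.arr 0 (by decide), F2.arr 1 (by decide), F1.arr 1 (by decide)]
      exact hL.var
    · rw [F2.arr 0 (by decide), F1.arr 0 (by decide), F2.arr 2 (by decide), F1.arr 2 (by decide)]
      exact hL.pol
  · have F5 := frame_run (c := block [st 14 7 12, st 17 7 0]) rfl τ₄
    have F14 : Frame [8, 9, 12, 13, 14, 15, 19, 20, 21, 24] [9, 14, 17] σ τ₄ :=
      (((F1.mono (by decide) (by decide)).trans (F2.mono (by decide) (by decide))).trans
        (F3.mono (by decide) (by decide))).trans (F4.mono (by decide) (by decide))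
    have e7 : τ₄.reg 7 = 0 := (F14.reg 7 (by decide)).trans (hz 7 (by norm_num))
    have e0 : τ₄.reg 0 = k := (F14.reg 0 (by decide)).trans h0
    have e12 : τ₄.reg 12 = n + m := (F4.reg 12 (by decide)).trans j1
    refine ⟨fun i hi => ?_, ?_, ?_, ?_, ?_, ?_, F14.trans (F5.mono (by decide) (by decide))⟩
    · rw [F5.arr 9 (by decide), F4.arr 9 (by decide), j2 i hi]
    · rw [F5.reg 24 (by decide), F4.reg 24 (by decide), j3]
    · rw [F5.reg 8 (by decide), F4.reg 8 (by decide), F3.reg 8 (by decide), F2.reg 8 (by decide),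
        e8]
    · rw [F5.reg 9 (by decide), k1]
    · simp [block, Code.run, Instr.eval, e7, e12]
    · simp [block, Code.run, Instr.eval, e7, e0]

theorem getElem_flatten_take {α : Type*} (M : List (List α)) {c i : ℕ} (hc : c < M.length)
    (hi : i < M[c].length) :
    M.flatten[(M.take c).flatten.length + i]? = some M[c][i] := by
  have h : M.flatten = (M.take c).flatten ++ (M[c] ++ (M.drop (c + 1)).flatten) := by
    conv_lhs => rw [← List.take_append_drop c M, List.drop_eq_getElem_cons hc,
      List.flatten_append, List.flatten_cons]
  rw [h, List.getElem?_append_right (by omega), Nat.add_sub_cancel_left,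
    List.getElem?_append_left hi, List.getElem?_eq_getElem hi]

theorem loaded_inputState (k : ℕ) (L : Fin m → List (Fin n × Bool)) :
    Loaded L (inputState k n m L).arr := by
  have off : ∀ c ≤ m, (inputState k n m L).arr 0 c = ((List.ofFn L).take c).flatten.length := by
    intro c hc
    change arrayOf _ c = _
    rw [arrayOf, List.getD_eq_getElem?_getD, List.getElem?_map, List.getElem?_range (by omega)]
    rfl
  have key : ∀ (c : Fin m) (i : ℕ) (h : i < (L c).length),
      (List.ofFn L).flatten[((List.ofFn L).take c).flatten.length + i]? = some (L c)[i] := by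
    intro c i h
    rw [getElem_flatten_take (List.ofFn L) (c := c) (by simp) (by simpa using h)]
    simp
  refine ⟨fun c => ?_, fun c i h => ?_, fun c i h => ?_⟩
  · rw [off _ (by omega), off _ (by omega), List.take_add_one, List.flatten_append,
      List.length_append]
    simp
  · rw [off _ (by omega)]
    change arrayOf _ _ = _
    rw [arrayOf, List.getD_eq_getElem?_getD, List.getElem?_map, key c i h]
    rfl
  · rw [off _ (by omega)]
    change arrayOf _ _ = _
    rw [arrayOf, List.getD_eq_getElem?_getD, List.getElem?_map, key c i h]
    rfl

/-- A clause with too many literals forces a large depth. -/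
theorem lt_srbd_of_lt_length (hA : G.IsAdjList L) {c : Fin m} (h : k < (L c).length) :
    (k : ℕ∞) < G.srbd G.edgeless := by
  -- A clause has no complementary literals, so different literals have different variables and the
  -- length of the list counts variables.
  have hnd : ((L c).map Prod.fst).Nodup := by
    refine List.Nodup.map_on ?_ (hA c).1
    rintro ⟨x, s⟩ hs ⟨y, t⟩ ht rfl
    have hs' := ((hA c).2 _ _).1 hs
    have ht' := ((hA c).2 _ _).1 ht
    cases s <;> cases t
    · rfl
    · exact absurd ⟨ht', hs'⟩ (G.not_complementary _ _)
    · exact absurd ⟨hs', ht'⟩ (G.not_complementary _ _)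
    · rfl
  refine lt_srbd_of_forces (forces_of_card (c := c) (X := ∅)
    (F := ((L c).map Prod.fst).toFinset) ?_ fun x hx => ?_)
  · rw [List.toFinset_card_of_nodup hnd, List.length_map]; exact h
  · rw [List.mem_toFinset, List.mem_map] at hx
    obtain ⟨⟨x, s⟩, hs, rfl⟩ := hx
    exact ⟨⟨s, ((hA c).2 _ _).1 hs⟩, by simp⟩

/-- The list of all vertices. -/
def vertices (n m : ℕ) : List (Fin n ⊕ Fin m) :=
  (List.finRange n).map .inl ++ (List.finRange m).map .inr

theorem mem_vertices (v : Fin n ⊕ Fin m) : v ∈ vertices n m := by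
  rcases v with x | c <;> simp [vertices]

theorem nodup_vertices : (vertices n m).Nodup := by
  refine List.Nodup.append ((List.nodup_finRange n).map Sum.inl_injective)
    ((List.nodup_finRange m).map Sum.inr_injective) ?_
  intro v h1 h2
  simp only [List.mem_map] at h1 h2
  obtain ⟨x, -, rfl⟩ := h1
  obtain ⟨c, -, h⟩ := h2
  simp at h

theorem length_vertices : (vertices n m).length = n + m := by simp [vertices]

/-- The set-up writes `i` into the cell `i`, and this is the list of the variables followed by the
clauses. -/
theorem map_vid_vertices : (vertices n m).map vid = List.range (n + m) := by
  apply List.ext_getElem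
  · simp [vertices]
  · intro i h1 h2
    simp only [List.length_map, length_vertices] at h1
    simp only [vertices, List.map_append, List.map_map, List.getElem_append, List.length_map,
      List.length_finRange, List.getElem_map, List.getElem_finRange, List.getElem_range,
      Function.comp]
    split
    · simp [vid]
    · simp [vid]; omega

/-- After clauses with more than `k` literals have been excluded, `solve` runs at level `k` on the
whole graph with nothing assigned or pending. An obstruction of that level leads to rejection just
as a large distance does. -/
theorem runs_main (hA : G.IsAdjList L) :
    Runs program.procs program.main (inputState k n m L) (4 * time k 0 k (n + m)) fun τ =>
      (∃ B : BackdoorTree (Fin n) (Fin m), τ.ReturnsTree B ∧ B.IsSRB G G.edgeless Set.univ ∧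
        B.depth ≤ 3 ^ k * (4 * 2 ^ k) * k ^ 2) ∨ (τ.Rejects ∧ (k : ℕ∞) < G.srbd G.edgeless) := by
  have hlocal := mul_le_time k 0 k (n + m)
  have hz : ∀ r, 3 ≤ r → (inputState k n m L).reg r = 0 := by
    intro r hr
    change arrayOf _ r = 0
    rw [arrayOf, List.getD_eq_default]
    simpa using hr
  have hza : ∀ a, 3 ≤ a → (inputState k n m L).arr a = fun _ => 0 := by
    intro a ha
    obtain ⟨a, rfl⟩ : ∃ i, a = i + 3 := ⟨a - 3, by omega⟩
    funext i
    simp [inputState, arrayOf]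
  have b1 : n + m + 1 ≤ (k + 1) * 2 ^ (k + 2) * (n + m + 1) :=
    Nat.le_mul_of_pos_left _ (by positivity)
  have b2 : (k + 1) * 2 ^ (k + 2) ≤ (k + 1) * 2 ^ (k + 2) * (n + m + 1) :=
    Nat.le_mul_of_pos_right _ (by omega)
  refine (Runs.block_cons (runs_setUp (k := k) (n := n) (m := m) rfl rfl rfl hz
    (loaded_inputState k L)) (T' := 3 * time k 0 k (n + m) + 10)
    fun τ₁ ⟨h9, h24, e8, e9, h14, h17, F1⟩ => ?_).mono (by omega) fun _ h => h
  have e7 : τ₁.reg 7 = 0 := (F1.reg 7 (by decide)).trans (hz 7 (by norm_num))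
  refine Runs.block_cons (T := 3 * time k 0 k (n + m) + 9) (Runs.ite
    (T := 3 * time k 0 k (n + m) + 8) (fun hb => ?_) fun hb => ?_) fun τ h => Runs.block_nil h
  swap
  · have : τ₁.reg 24 ≠ 0 := by simpa [Test.Holds, e7] using hb
    rw [Ne, h24] at this
    push Not at this
    obtain ⟨c, hc⟩ := this
    exact (Runs.straight (c := cst 0 0) rfl (.inr ⟨by simp [State.Rejects, Code.run, Instr.eval],
      lt_srbd_of_lt_length hA hc⟩)).mono (by simp only [Code.cost]; omega) fun _ h => h
  have hK : ∀ c, (L c).length ≤ k := h24.1 (by simpa [Test.Holds, e7] using hb)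
  have hseg : Seg (τ₁.arr 9) 0 ((vertices n m).map vid) := by
    intro i hi
    simp only [map_vid_vertices, List.getElem_range]
    rw [zero_add, h9]
    simpa [length_vertices] using hi
  have hLoad : Loaded L τ₁.arr := by
    have h := loaded_inputState k L
    refine ⟨?_, ?_, ?_⟩
    · rw [F1.arr 0 (by decide)]; exact h.off
    · rw [F1.arr 0 (by decide), F1.arr 1 (by decide)]; exact h.var
    · rw [F1.arr 0 (by decide), F1.arr 2 (by decide)]; exact h.pol
  have hready : Ready k L ∅ 0 0 0 k (vertices n m) [] τ₁ := by
    refine ⟨⟨F1.reg 1 (by decide), e7, e8, e9, hLoad, fun x => ?_⟩, ?_, ?_, ?_, ?_, ?_, h17, hseg,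
      by simp [seg_nil]⟩
    · rw [F1.arr 4 (by decide), hza 4 (by norm_num)]; simp
    · rw [F1.reg 6 (by decide), hz 6 (by norm_num)]
    · rw [F1.arr 13 (by decide), hza 13 (by norm_num)]
    · rw [h14, length_vertices, zero_add]
    · rw [F1.arr 15 (by decide), hza 15 (by norm_num)]
    · rw [F1.arr 16 (by decide), hza 16 (by norm_num)]; rfl
  have huniv : {v | v ∈ vertices n m} = Set.univ := by
    ext v; simp [mem_vertices]
  have hres : G.IsResidual ∅ {v | v ∈ vertices n m} := by
    rw [huniv]
    exact ⟨by simp, by simp, by simp⟩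
  have hrun := specSolve hA hK 0 ∅ 0 0 0 (vertices n m) [] τ₁ hready nodup_vertices hres rfl
  rw [length_vertices] at hrun
  refine (Runs.block_cons (Runs.call (ps := procs) (p := 0) (body := solve) rfl hrun) (T' := 6)
    fun τ₂ ⟨hP, _, hO⟩ => ?_).mono (by omega) fun _ h => h
  have z7 : τ₂.reg 7 = 0 := (hP.reg 7 (by simp)).trans e7
  have hreject : (k : ℕ∞) < G.srbd G.edgeless → Runs procs (cst 0 0) τ₂ 4 fun τ =>
      (∃ B : BackdoorTree (Fin n) (Fin m), τ.ReturnsTree B ∧ B.IsSRB G G.edgeless Set.univ ∧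
        B.depth ≤ 3 ^ k * (4 * 2 ^ k) * k ^ 2) ∨ (τ.Rejects ∧ (k : ℕ∞) < G.srbd G.edgeless) :=
    fun h => (Runs.straight (c := cst 0 0) rfl
      (.inr ⟨by simp [State.Rejects, Code.run, Instr.eval], h⟩)).mono
      (by simp only [Code.cost]; omega) fun _ h => h
  refine Runs.block_cons (T := 5) (Runs.ite (T := 4) (fun hb => ?_) fun hb => ?_)
    fun τ h => Runs.block_nil h
  · have hf : τ₂.reg 5 = 0 := by simpa [Test.Holds, z7] using hb
    cases hO with
    | obstruction O g => rw [hf] at g; simp at g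
    | reject g => rw [hf] at g; simp at g
    | tree w g1 g2 g3 g4 =>
      rw [huniv] at g4
      obtain ⟨B, h1, h2, h3⟩ := g4
      have z3 : τ₁.reg 3 = 0 := (F1.reg 3 (by decide)).trans (hz 3 (by norm_num))
      have hpos := g2.pos
      have hw := g2.seg
      rw [z3] at hpos hw
      rw [zero_add] at hpos
      refine (Runs.straight (c := block [cst 0 1, addc 1 3 0]) rfl (.inl ⟨B, ⟨?_, ?_⟩, h1,
        h2.trans (le_of_eq ?_)⟩)).mono (by simp [block, Code.cost]) fun _ h => h
      · simp [block, Code.run, Instr.eval]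
      · have e1 : ((block [cst 0 1, addc 1 3 0]).run τ₂).reg 1 = w.length := by
          simp [block, Code.run, Instr.eval, hpos]
        have e3 : ((block [cst 0 1, addc 1 3 0]).run τ₂).arr 3 = τ₂.arr 3 := rfl
        rw [e1, e3, hw.map_range]
        exact h3
      -- The depth is at most `k * (k * (4 * 6 ^ k))`, one summand `k * maxObs k` for each of the
      -- `k` levels.
      · rw [List.length_nil, maxObs, show 6 = 3 * 2 by norm_num, mul_pow]
        ring
  · have hf : τ₂.reg 5 ≠ 0 := by simpa [Test.Holds, z7] using hb
    cases hO with
    | tree w g => exact absurd g hf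
    -- An obstruction of level `k` forces depth greater than `k`.
    | obstruction O _ g =>
      obtain ⟨X', -, -, -, h, -⟩ := g.forces
      exact hreject (lt_srbd_of_forces h)
    | reject _ g => exact hreject g

/-- The exponent of `8` in `time` is about `k ^ 2 * maxObs k`, which is single exponential in `k`;
hence the factor is double exponential. With the crude bounds `k ≤ 2 ^ k` and `6 ^ k ≤ 8 ^ k`
everything becomes a power of `2`. -/
theorem time_le (k s : ℕ) : 4 * time k 0 k s ≤ 2 ^ 2 ^ (8 * (k + 1)) * max 1 s := by
  have h0 : k ≤ 2 ^ k := Nat.lt_two_pow_self.le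
  have h1 : k + 1 ≤ 2 ^ k := Nat.lt_two_pow_self
  have h6 : 6 ^ k ≤ 2 ^ (3 * k) := by
    rw [pow_mul]; exact Nat.pow_le_pow_left (by norm_num) k
  have hp : ∀ i, 1 ≤ 2 ^ i := fun i => Nat.one_le_two_pow
  have hM : maxObs k + 1 ≤ 2 ^ (3 * k + 3) := by
    rw [maxObs, pow_add]
    have := hp (3 * k)
    omega
  have hU : unit k ≤ 2 ^ (5 * k + 15) := by
    calc unit k ≤ 2 ^ 10 * (2 ^ k * 2 ^ (k + 2) * 2 ^ (3 * k + 3)) := by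
          rw [unit]; gcongr; norm_num
      _ = 2 ^ (5 * k + 15) := by rw [← pow_add, ← pow_add, ← pow_add]; congr 1; ring
  have hE : 0 + k * (k * maxObs k + 1) + 1 ≤ 2 ^ (5 * k + 4) := by
    calc 0 + k * (k * maxObs k + 1) + 1 ≤ 2 ^ k * (2 ^ k * 2 ^ (3 * k + 3)) + 1 := by
          rw [zero_add]
          gcongr
          rcases Nat.eq_zero_or_pos k with rfl | hk
          · simp
          · calc k * maxObs k + 1 ≤ k * (maxObs k + 1) := by rw [mul_add]; omega
              _ ≤ _ := by gcongr
      _ = 2 ^ (5 * k + 3) + 1 := by rw [← pow_add, ← pow_add]; congr 2; ring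
      _ ≤ 2 ^ (5 * k + 4) := by rw [pow_succ 2 (5 * k + 3)]; have := hp (5 * k + 3); omega
  -- The maximum takes care of the empty graph, on which the machine still makes some steps.
  have hs : s + 1 ≤ 2 * max 1 s := by omega
  have hexp : 2 + (5 * k + 15) + 3 * 2 ^ (5 * k + 4) + 1 ≤ 2 ^ (8 * (k + 1)) := by
    have h2 : 5 * k + 18 ≤ 2 ^ (5 * k + 5) := by
      have : 5 * k + 1 ≤ 2 ^ (5 * k) := Nat.lt_two_pow_self
      rw [pow_add]; omega
    have h3 : 2 ^ (5 * k + 7) ≤ 2 ^ (8 * (k + 1)) := Nat.pow_le_pow_right (by norm_num) (by omega)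
    rw [pow_add] at h2 h3 ⊢
    omega
  calc 4 * time k 0 k s
      ≤ 4 * (2 ^ (5 * k + 15) * 8 ^ 2 ^ (5 * k + 4) * (2 * max 1 s)) := by
        rw [time]; gcongr; norm_num
    _ = 2 ^ (2 + (5 * k + 15) + 3 * 2 ^ (5 * k + 4) + 1) * max 1 s := by
        generalize 2 ^ (5 * k + 4) = E
        rw [show 8 = 2 ^ 3 by norm_num, ← pow_mul]
        ring
    _ ≤ _ := by gcongr; norm_num

end RAM

theorem theorem5p10 :
    ∃ (P : RAM.Program) (a : ℕ), ∀ (k n m : ℕ) (G : IncidenceGraph (Fin n) (Fin m))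
      (L : Fin m → List (Fin n × Bool)), G.IsAdjList L →
      ∃ (t : ℕ) (τ : RAM.State),
        P.HaltsIn (RAM.inputState k n m L) t τ ∧
        t ≤ 2 ^ (2 ^ (a * (k + 1))) * max 1 (n + m) ∧
        ((∃ B : BackdoorTree (Fin n) (Fin m),
            τ.ReturnsTree B ∧ B.IsSRB G G.edgeless Set.univ ∧
            B.depth ≤ 3 ^ k * (4 * 2 ^ k) * k ^ 2) ∨
          (τ.Rejects ∧ (k : ℕ∞) < G.srbd G.edgeless)) := by
  refine ⟨RAM.program, 8, fun k n m G L hA => ?_⟩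
  obtain ⟨t, τ, h1, h2, h3⟩ := RAM.runs_main (k := k) hA
  exact ⟨t, τ, h1, h2.trans (RAM.time_le k (n + m)), h3⟩
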